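/- **Setting.** Let $n\ge 1$ and let party $j\in\{1,\dots,n\}$ hold the description $(\theta_j,\varphi_j)\in[0,2\pi)\times[-\pi/2,\pi/2]$ of the von Neumann measurement $M_j=\cos\theta_j\cos\varphi_j\,\sigma_1+\sin\theta_j\cos\varphi_j\,\sigma_2+\sin\varphi_j\,\sigma_3$. The *GHZ distribution* $p$ on $\{-1,+1\}^n$ is the law of the outcomes of $M_1\otimes\dots\otimes M_n$ on $\frac1{\sqrt2}(|0^n\rangle+|1^n\rangle)$. The parties are to output $x_j$, party $j$ the $j$-th entry, with joint law $p$, using only private independent unbiased random bits and classical messages; each party initially knows only its own $(\theta_j,\varphi_j)$. Party 1 is the leader. The $k$-bit truncation of $v$ is $\lfloor 2^kv\rfloor/2^k$. Communication is counted in bits; in the parallel model, bits sent in the same time step must travel between disjoint pairs of parties. A round is a simultaneous exchange of messages, each of which depends only on what its sender knew before the exchange. Local computation and coin tossing take no time. **Protocol with parameters $k_0\ge1$ and mode (tree or sequential).** 1. *Bernoulli.* For $k=1,2,\dots$ the leader draws an unbiased bit $U_k$, puts $U(k)=0.U_1\dots U_k$, and receives from each other party the $(k+\lceil\log_2 n\rceil)$-bit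 truncation of $\theta_j/2$; with $\hat\vartheta$ the sum of these truncations and of $\theta_1/2$, he puts $p(k)=\cos^2\hat\vartheta$. He stops with $B=1$ if $U(k)\le p(k)-2\cdot2^{-k}$, with $B=0$ if $U(k)\ge p(k)+2^{-k}$, and otherwise continues with $k+1$. After every $k$ he tells each party in one bit whether he stops. 2. *Rejection.* The leader draws an unbiased bit $S$ and sends it to everybody. Each party $j$ samples, with unbiased bits, $X_j\in\{-1,+1\}$ with $\Pr[X_j=+1]=\cos^2(\frac12(\varphi_j-\frac\pi2))$, and replaces $X_j$ by $-X_j$ if $S=1$. Put $c_j=\cos(\frac12(\varphi_j-\frac\pi2X_j))$ and $s_j=-\sin(\frac12(\varphi_j-\frac\pi2X_j))$, except that the leader changes the sign of $s_1$ if $B=0$. Start with $k=k_0$. 3. *Inner loop.* The leader extends his (new) string of unbiased bits to $U(k)=0.U_1\dots U_k$. Let $\ell=k+3+\lceil\log_2n\rceil$. All $c_j,s_j$ are truncated to $\ell$ bits. In *tree* mode, for $m=1,2,4,\dots$ while $m<n$, in parallel for all $j\equiv1\pmod{2m}$ with $j+m\le n$, party $j+m$ sends its current two numbers to party $j$, who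 replaces each of its own two numbers by the $\ell$-bit truncation of the product. In *sequential* mode every party sends its two truncations to the leader, who multiplies them. Let $\hat a_1,\hat a_2$ be the leader's resulting approximations of $\prod_jc_j$ and $\prod_js_j$, and let $L_k=\hat a_1^2+\hat a_2^2$, $R_k=\frac12(\hat a_1+\hat a_2)^2$. The leader accepts if $U(k)L_k-R_k<-4\cdot2^{-k}$, rejects if $U(k)L_k-R_k>4\cdot2^{-k}$, and announces to all parties, in two bits each, whether he accepts (every party outputs its $X_j$), rejects (back to step 2), or cannot tell yet; in the last case $k$ is replaced by $2k$ and step 3 is repeated. **Claim.** There is an absolute constant $C$ such that the following holds for all $n\ge1$ and all $(\theta_j,\varphi_j)_j$. * *Parallel model* (tree mode, $k_0=1$): the outputs have exactly the GHZ distribution; the expected number of bits communicated is at most $Cn^2$; the expected parallel time is at most $Cn\log n$ if $n\ge2$; the expected number of random bits is at most $Cn$. * *Doubling* (sequential mode, $k_0=1$): the outputs have exactly the GHZ distribution; the expected number of rounds is at most $C\log n$ if $n\ge2$; the expected numbers of bits communicated and of random bits are at most $Cn^2$ and $Cn$. * *Bounded number of rounds* (sequential mode, $k_0=n$): the outputs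 have exactly the GHZ distribution; the expected number of rounds is at most $C$; the expected numbers of bits communicated and of random bits are still at most $Cn^2$ and $Cn$. -/

import Mathlib

open scoped ENNReal

noncomputable section

/-! ## Distributed protocols with private inputs, private fair coins and point-to-point messages -/

/-- A protocol for `n` parties. Every party has a private input and a private memory. Whatever a
party does depends on its own index, its own memory and the messages that it has received.
* `toss i m`: if it is `some f`, party `i` in memory state `m` wants an unbiased random bit `b`,
  after which its memory is `f b`; if it is `none`, it is ready to communicate.
* `send i m j`: the bit string that party `i` sends to party `j` in an exchange.
* `recv i m w`: the memory of party `i` after the exchange in which it received `w j` from `j`.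
* `out i m`: the output of party `i`, `none` as long as it has not decided on it. -/
structure Protocol (n : ℕ) (Input Output : Type) where
  Mem : Type
  init : Fin n → Input → Mem
  toss : Fin n → Mem → Option (Bool → Mem)
  send : Fin n → Mem → Fin n → List Bool
  recv : Fin n → Mem → (Fin n → List Bool) → Mem
  out : Fin n → Mem → Option Output

/-- The bits of a family of messages: `⟨i, j, r⟩` is bit number `r` of the message from `i` to `j`. -/
abbrev MessageBit {n : ℕ} (w : Fin n → Fin n → List Bool) : Type :=
  Σ i : Fin n, Σ j : Fin n, Fin (w i j).length

/-- The messages `w i j` (from `i` to `j`) can be transmitted in `T` time steps: every bit is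
assigned a time step, and bits that are transmitted in the same step travel between disjoint
pairs of parties. -/
def CanTransmit {n : ℕ} (w : Fin n → Fin n → List Bool) (T : ℕ) : Prop :=
  ∃ τ : MessageBit w → ℕ, (∀ b, τ b < T) ∧
    ∀ b b' : MessageBit w, b ≠ b' → τ b = τ b' →
      b.1 ≠ b'.1 ∧ b.1 ≠ b'.2.1 ∧ b.2.1 ≠ b'.1 ∧ b.2.1 ≠ b'.2.1

namespace Protocol

variable {n : ℕ} {Input Output : Type} (P : Protocol n Input Output)

/-- A global configuration: the memories of all parties. -/
abbrev Config : Type := Fin n → P.Mem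

/-- Every party has decided on its output: the run is over. -/
def Halted (s : P.Config) : Prop := ∀ i, (P.out i (s i)).isSome

/-- Some party still wants a random bit. -/
def Tossing (s : P.Config) : Prop := ∃ i, (P.toss i (s i)).isSome

/-- An exchange of messages takes place when the run is not over and no party wants a coin. -/
def Exchanging (s : P.Config) : Prop := ¬ P.Halted s ∧ ¬ P.Tossing s

/-- The messages that are due in configuration `s`. -/
def messages (s : P.Config) : Fin n → Fin n → List Bool := fun i j => P.send i (s i) j

/-- The parties that want a random bit get one each, namely `b i` for party `i`. -/
def afterToss (s : P.Config) (b : Fin n → Bool) : P.Config := fun i =>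
  match P.toss i (s i) with
  | some f => f (b i)
  | none => s i

/-- Effect of an exchange: every message depends only on the memory of its sender before it. -/
def afterExchange (s : P.Config) : P.Config := fun i =>
  P.recv i (s i) (fun j => P.messages s j i)

open Classical in
/-- One step of the run; the random bits are independent and unbiased. -/
def step (s : P.Config) : PMF P.Config :=
  if P.Halted s then PMF.pure s
  else if P.Tossing s then (PMF.uniformOfFintype (Fin n → Bool)).map (P.afterToss s)
  else PMF.pure (P.afterExchange s)

/-- The law of the configuration after `t` steps on given inputs. -/
def law (inp : Fin n → Input) : ℕ → PMF P.Config
  | 0 => PMF.pure (fun i => P.init i (inp i))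
  | t + 1 => (law inp t).bind P.step

/-- On the inputs `inp`, the vector of outputs of the parties has exactly the distribution `p`. -/
def Samples (inp : Fin n → Input) (p : (Fin n → Output) → ℝ) : Prop :=
  ∀ x : Fin n → Output,
    Filter.Tendsto
      (fun t => (P.law inp t).toOuterMeasure {s | ∀ i, P.out i (s i) = some (x i)})
      Filter.atTop (nhds (ENNReal.ofReal (p x)))

open Classical in
/-- Number of bits communicated in the step that starts in `s`. -/
def bits (s : P.Config) : ℕ :=
  if P.Exchanging s then ∑ i, ∑ j, (P.messages s i j).length else 0

open Classical in
/-- Parallel communication time of the step that starts in `s`: the least number of time steps in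
which the messages can be transmitted. -/
def time (s : P.Config) : ℕ :=
  if P.Exchanging s then sInf {T | CanTransmit (P.messages s) T} else 0

open Classical in
/-- Number of communication rounds (`0` or `1`) in the step that starts in `s`. -/
def rounds (s : P.Config) : ℕ := if P.Exchanging s then 1 else 0

open Classical in
/-- Number of random bits that are drawn by all the parties in the step that starts in `s`. -/
def coins (s : P.Config) : ℕ :=
  if P.Halted s then 0 else (Finset.univ.filter fun i => (P.toss i (s i)).isSome).card

/-- Expectation of the total, over the whole run, of a quantity that is counted per step. -/
def expected (cost : P.Config → ℕ) (inp : Fin n → Input) : ℝ≥0∞ :=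
  ∑' t, ∑' s, P.law inp t s * (cost s : ℝ≥0∞)

def expectedBits (inp : Fin n → Input) : ℝ≥0∞ := P.expected P.bits inp

def expectedTime (inp : Fin n → Input) : ℝ≥0∞ := P.expected P.time inp

def expectedRounds (inp : Fin n → Input) : ℝ≥0∞ := P.expected P.rounds inp

def expectedCoins (inp : Fin n → Input) : ℝ≥0∞ := P.expected P.coins inp

end Protocol

namespace GHZ

/-! ## The GHZ distribution -/

/-- A von Neumann measurement of one qubit, given by its azimuthal angle `θ` and its elevation
angle `φ`. -/
structure Measurement where
  θ : ℝ
  φ : ℝ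
  θ_mem : θ ∈ Set.Ico 0 (2 * Real.pi)
  φ_mem : φ ∈ Set.Icc (-(Real.pi / 2)) (Real.pi / 2)

/-- The observable `M = cos θ cos φ σ₁ + sin θ cos φ σ₂ + sin φ σ₃`. -/
def Measurement.observable (M : Measurement) : Matrix (Fin 2) (Fin 2) ℂ :=
  !![(Real.sin M.φ : ℂ), Complex.exp (-(Complex.I * M.θ)) * Real.cos M.φ;
     Complex.exp (Complex.I * M.θ) * Real.cos M.φ, -(Real.sin M.φ : ℂ)]

/-- The projector `(1 + x M) / 2` on the eigenspace of the observable for the eigenvalue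
`x = ±1`. -/
def Measurement.projector (M : Measurement) (x : ℤˣ) : Matrix (Fin 2) (Fin 2) ℂ :=
  (1 / 2 : ℂ) • (1 + ((x : ℤ) : ℂ) • M.observable)

/-- The state `(|0…0⟩ + |1…1⟩) / √2` in the computational basis. -/
def state (n : ℕ) : (Fin n → Fin 2) → ℂ := fun b =>
  ((if b = fun _ => 0 then 1 else 0) + (if b = fun _ => 1 then 1 else 0)) / (Real.sqrt 2 : ℂ)

/-- The GHZ distribution, by the Born rule: the probability `⟨Ψ| P₁ ⊗ ⋯ ⊗ Pₙ |Ψ⟩` of the outcomes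
`x`, where `P_j` is the projector of party `j` for the outcome `x j`. -/
def prob {n : ℕ} (M : Fin n → Measurement) (x : Fin n → ℤˣ) : ℝ :=
  (star (state n) ⬝ᵥ
    (Matrix.of fun a b : Fin n → Fin 2 => ∏ j, (M j).projector (x j) (a j) (b j)).mulVec
      (state n)).re

/-! ## Numbers as bit strings -/

/-- The `w` low-order binary digits of `z`. -/
def encodeNat (w z : ℕ) : List Bool := List.ofFn fun i : Fin w => z.testBit i

def decodeNat (m : List Bool) : ℕ := m.foldr (fun b a => 2 * a + b.toNat) 0

/-- The `ℓ`-bit truncation of `t`. -/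
def trunc (ℓ : ℕ) (t : ℝ) : ℝ := (⌊t * 2 ^ ℓ⌋ : ℝ) / 2 ^ ℓ

/-- The `ℓ`-bit truncation of `t ∈ [-1, 1]` as a string of `ℓ + 2` bits (the integer
`⌊t 2^ℓ⌋`, which lies in `[-2^ℓ, 2^ℓ]`, in offset binary). -/
def encodeTrunc (ℓ : ℕ) (t : ℝ) : List Bool :=
  encodeNat (ℓ + 2) (⌊t * 2 ^ ℓ⌋ + 2 ^ (ℓ + 1)).toNat

def decodeTrunc (ℓ : ℕ) (m : List Bool) : ℝ := ((decodeNat m : ℝ) - 2 ^ (ℓ + 1)) / 2 ^ ℓ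

def encodePair (ℓ : ℕ) (a : ℝ × ℝ) : List Bool := encodeTrunc ℓ a.1 ++ encodeTrunc ℓ a.2

def decodePair (ℓ : ℕ) (m : List Bool) : ℝ × ℝ :=
  (decodeTrunc ℓ (m.take (ℓ + 2)), decodeTrunc ℓ (m.drop (ℓ + 2)))

/-- The first `len` binary digits `0.U₁U₂…` of a uniform number in `[0, 1)`. -/
structure Uniform where
  val : ℝ
  len : ℕ

def Uniform.empty : Uniform := ⟨0, 0⟩

/-- Append a digit: `U(k) = U(k-1) + U_k / 2^k`. -/
def Uniform.push (u : Uniform) (b : Bool) : Uniform :=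
  ⟨u.val + (if b then 1 else 0) / 2 ^ (u.len + 1), u.len + 1⟩

/-! ## The protocol -/

/-- The place of a party in its program.
* `bern`, `bernSync`: sampling of the Bernoulli variable with parameter `cos² (∑ θ_j / 2)`.
* `start`: the leader draws and broadcasts the bit `S` at the beginning of a rejection round.
* `work i`: the inner loop of a rejection round. Here `i` counts the exchanges in which the products
  are computed; when `i` has reached their number, the leader announces his verdict.
* `done`: the simulation is complete. -/
inductive Phase where
  | bern
  | bernSync
  | start
  | work (i : ℕ)
  | done

/-- The memory of a party. The entries `u`, `p`, `flip` are used only by the leader (party `0`).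
* `k`: current precision.
* `u`: random digits of the number `U` of the leader (in the phase `start`: the bit `S`).
* `p`: the leader's approximation of the Bernoulli parameter.
* `flip`: whether the leader samples `p₂` instead of `p₁`.
* `S`: the bit that says whether to sample `q₁` or `q₂`.
* `v`: random digits of the uniform number that serves to sample `X_j`.
* `acc`: the current approximate partial products of the `c_j` and of the `s_j`. -/
structure Memory where
  θ : ℝ
  φ : ℝ
  phase : Phase
  k : ℕ
  u : Uniform
  p : ℝ
  flip : Bool
  S : Bool
  v : Uniform
  acc : ℝ × ℝ

namespace Memory

/-- `cos² ((φ - π/2)/2)`, the probability of `+1` under the local Rademacher distribution. -/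
def bias (m : Memory) : ℝ := Real.cos ((m.φ - Real.pi / 2) / 2) ^ 2

/-- The digits drawn so far settle whether the uniform number is less than the bias. -/
def Decided (m : Memory) : Prop :=
  m.v.val + 1 / 2 ^ m.v.len ≤ m.bias ∨ m.bias ≤ m.v.val

open Classical in
/-- The value `X_j ∈ {-1, +1}`: the sample of the local Rademacher distribution, with its sign
changed if `S = 1`. -/
def outcome (m : Memory) : ℤˣ :=
  (if m.S then -1 else 1) * (if m.v.val + 1 / 2 ^ m.v.len ≤ m.bias then 1 else -1)

/-- `c_j = cos ((φ_j - π X_j / 2)/2)`. -/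
def c (m : Memory) : ℝ := Real.cos ((m.φ - Real.pi / 2 * ((m.outcome : ℤ) : ℝ)) / 2)

/-- `s_j = -sin ((φ_j - π X_j / 2)/2)`, with the opposite sign if `flip` is set. This sign turns
`p₁ = (a₁ + a₂)²/2` into `p₂ = (a₁ - a₂)²/2`. -/
def s (m : Memory) : ℝ :=
  (if m.flip then -1 else 1) * -Real.sin ((m.φ - Real.pi / 2 * ((m.outcome : ℤ) : ℝ)) / 2)

/-- Go to the beginning of a rejection round. -/
def restart (m : Memory) : Memory := { m with phase := .start, u := .empty }

end Memory

/-- Number of bits after the binary point to which the `c_j` and `s_j` are truncated. -/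
def prec (n k : ℕ) : ℕ := k + 3 + Nat.clog 2 n

/-- The approximate partial products held by a party after `i` exchanges of the inner loop. -/
def partials (n i : ℕ) (m : Memory) : ℝ × ℝ :=
  if i = 0 then (trunc (prec n m.k) m.c, trunc (prec n m.k) m.s) else m.acc

/-- Precision to which the half angles are transmitted in the Bernoulli sampling. -/
def bernPrec (n k : ℕ) : ℕ := k + Nat.clog 2 n

open Classical in
/-- The leader's decision in the Bernoulli sampling: the value of the Bernoulli variable, or `none`
if he cannot tell yet. -/
def bernVerdict (m : Memory) : Option Bool :=
  if m.u.val ≤ m.p - 2 / 2 ^ m.k then some true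
  else if m.p + 1 / 2 ^ m.k ≤ m.u.val then some false
  else none

open Classical in
/-- The leader's decision in the inner loop, from the approximations `a = (a₁, a₂)` of the products:
`some true` to accept, `some false` to reject, `none` if he cannot tell yet. -/
def verdict (m : Memory) (a : ℝ × ℝ) : Option Bool :=
  let L := a.1 ^ 2 + a.2 ^ 2
  let R := (a.1 + a.2) ^ 2 / 2
  if m.u.val * L - R < -(4 / 2 ^ m.k) then some true
  else if 4 / 2 ^ m.k < m.u.val * L - R then some false
  else none

/-- The two synchronization bits by which the leader announces his verdict. -/
def encodeVerdict : Option Bool → List Bool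
  | none => [false, false]
  | some y => [true, y]

def decodeVerdict : List Bool → Option Bool
  | [true, y] => some y
  | _ => none

/-- What a party does at the end of the inner loop: output, restart, or double the precision. -/
def conclude (m : Memory) : Option Bool → Memory
  | some true => { m with phase := .done }
  | some false => m.restart
  | none => { m with phase := .work 0, k := 2 * m.k }

/-- The number of exchanges in which the products are computed: the depth of the binomial tree, or
one if every party talks directly to the leader. -/
def depth (tree : Bool) (n : ℕ) : ℕ := if tree then Nat.clog 2 n else 1

/-- Does party `j` send its partial products to party `i` in exchange number `l`? In the binomial
tree, `j` is an odd multiple of `2^l` and `i = j - 2^l`; in the sequential model, `i` is the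
leader. -/
def sendsTo (tree : Bool) (l : ℕ) {n : ℕ} (j i : Fin n) : Bool :=
  if tree then decide (j.val % 2 ^ (l + 1) = 2 ^ l ∧ i.val + 2 ^ l = j.val)
  else decide (i.val = 0 ∧ j.val ≠ 0)

/-- New partial products of party `i` in exchange number `l`. In the binomial tree, a pairwise
product is truncated; in the sequential model, the leader multiplies all the numbers that he has
received with his own. -/
def combine (tree : Bool) (l : ℕ) {n : ℕ} (i : Fin n) (m : Memory) (w : Fin n → List Bool) :
    ℝ × ℝ :=
  let ℓ := prec n m.k
  let a := partials n l m
  if tree then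
    if h : i.val % 2 ^ (l + 1) = 0 ∧ i.val + 2 ^ l < n then
      let b := decodePair ℓ (w ⟨i.val + 2 ^ l, h.2⟩)
      (trunc ℓ (a.1 * b.1), trunc ℓ (a.2 * b.2))
    else a
  else if i.val = 0 then
    (a.1 * ∏ j : Fin n, (if j.val = 0 then 1 else (decodePair ℓ (w j)).1),
     a.2 * ∏ j : Fin n, (if j.val = 0 then 1 else (decodePair ℓ (w j)).2))
  else a

section

variable {n : ℕ} [NeZero n]

/-- Initial memory: the party knows only its own measurement. -/
def initMem (M : Measurement) : Memory where
  θ := M.θ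
  φ := M.φ
  phase := .bern
  k := 1
  u := .empty
  p := 0
  flip := false
  S := false
  v := .empty
  acc := (1, 1)

open Classical in
def tossMem (i : Fin n) (m : Memory) : Option (Bool → Memory) :=
  match m.phase with
  | .bern =>
      if i = 0 ∧ m.u.len < m.k then some fun b => { m with u := m.u.push b } else none
  | .start =>
      if i = 0 ∧ m.u.len < 1 then some fun b => { m with u := m.u.push b, S := b } else none
  | .work _ =>
      if ¬ m.Decided then some fun b => { m with v := m.v.push b }
      else if i = 0 ∧ m.u.len < m.k then some fun b => { m with u := m.u.push b }
      else none
  | _ => none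

def sendMem (tree : Bool) (j : Fin n) (m : Memory) (i : Fin n) : List Bool :=
  match m.phase with
  | .bern =>
      if i = 0 ∧ j ≠ 0 then
        encodeNat (bernPrec n m.k + 3) ⌊m.θ / 2 * 2 ^ bernPrec n m.k⌋₊
      else []
  | .bernSync => if j = 0 ∧ i ≠ 0 then [(bernVerdict m).isSome] else []
  | .start => if j = 0 ∧ i ≠ 0 then [m.S] else []
  | .work l =>
      if l < depth tree n then
        if sendsTo tree l j i then encodePair (prec n m.k) (partials n l m) else []
      else if j = 0 ∧ i ≠ 0 then encodeVerdict (verdict m (partials n l m))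
      else []
  | .done => []

def recvMem (tree : Bool) (k₀ : ℕ) (i : Fin n) (m : Memory) (w : Fin n → List Bool) : Memory :=
  match m.phase with
  | .bern =>
      { m with
        phase := .bernSync
        p := Real.cos (m.θ / 2 +
          ∑ j : Fin n, if j = 0 then 0 else (decodeNat (w j) : ℝ) / 2 ^ bernPrec n m.k) ^ 2 }
  | .bernSync =>
      if i = 0 then
        match bernVerdict m with
        | some B => { m.restart with flip := !B }
        | none => { m with phase := .bern, k := m.k + 1 }
      else if w 0 = [true] then m.restart
      else { m with phase := .bern, k := m.k + 1 }
  | .start =>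
      { m with
        phase := .work 0
        k := k₀
        u := .empty
        S := if i = 0 then m.S else (w 0).headD false
        v := .empty }
  | .work l =>
      if l < depth tree n then { m with phase := .work (l + 1), acc := combine tree l i m w }
      else if i = 0 then conclude m (verdict m (partials n l m))
      else conclude m (decodeVerdict (w 0))
  | .done => m

def outMem (m : Memory) : Option ℤˣ :=
  match m.phase with
  | .done => some m.outcome
  | _ => none

end

/-- The protocol for sampling the GHZ distribution in which, in every rejection round, the precision
`k` starts at `k₀` and is doubled each time round the inner loop. The products are computed along a
binomial tree if `tree` is set, and by the leader from messages of all the other parties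
otherwise. -/
def protocol (n : ℕ) [NeZero n] (tree : Bool) (k₀ : ℕ) : Protocol n Measurement ℤˣ where
  Mem := Memory
  init := fun _ M => initMem M
  toss := tossMem
  send := sendMem tree
  recv := recvMem tree k₀
  out := fun _ m => outMem m

end GHZ

end

/-! Write a = ∏ c_j, b = ∏ s_j for a vector y of outcomes and Θ = ∑ θ_j. The Born rule gives y the
probability (a² + b² + 2ab cos Θ)/2, which equals cos²(Θ/2)·(a+b)²/2 + sin²(Θ/2)·(a-b)²/2
(`prob_eq`). The Bernoulli bit picks one of the two components. Both a² and b² are product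
distributions, so the local samples, averaged over S, propose y with probability (a²+b²)/2. Since
(a±b)²/2 ≤ a²+b², rejection sampling applies, and every attempt is accepted with probability 1/2.

The digits drawn so far confine a uniform number t to a dyadic interval, and `avg` is the
conditional expectation over it. A verdict is given only if it is right for every t in the interval
(`verdict_accept`, `verdict_reject`), so finite precision introduces no bias. A missing verdict at
precision k forces |t(a²+b²) - (a±b)²/2| ≤ 7/2^k (`verdict_none`). For a fixed proposal this has
weight at most 7/2^k, whatever a²+b² is (`mass_mul_near_le`); over all 2^n proposals the probability
is at most min(1, 2^n·7/2^k). It decays once k passes n. Doubling from 1 therefore takes about log n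
passages, starting from n takes a bounded number, and in both cases the expected sum of the
precisions is O(n) (`doubling_one`, `doubling_self`).

Costs and exactness come from one supermartingale. For any price list `Tariff` and any f ≥ 0 of the
outputs, `potential` bounds the expected price of the rest of the run plus the expected final value
of f. It is a sum over vectors y of products over the parties, so independence of the coins lets
each party be averaged separately (`potential_toss`, `potential_exchange`, `potential_pays`). With f
= 0 it bounds costs (`expected_le_total`). With zero prices and f the indicator of x, it gives
Pr[output x by time t] ≤ p(x) (`outputs_le_prob`). Suitable unit prices bound the expected number of
steps, so the run ends almost surely; as the upper bounds p(x) sum to 1, all of them are attained in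
the limit (`samples`). -/

/-! ### Expectations under discrete distributions and fair coins -/

/-- The expectation of `V` under `p`. -/
noncomputable def PMF.mean {α : Type*} (p : PMF α) (V : α → ℝ≥0∞) : ℝ≥0∞ := ∑' a, p a * V a

namespace PMF

variable {α β : Type*}

theorem mean_pure (a : α) (V : α → ℝ≥0∞) : (PMF.pure a).mean V = V a := by
  classical
  unfold mean
  rw [tsum_eq_single a]
  · simp
  · intro b hb
    simp [PMF.pure_apply, hb]

theorem mean_bind (p : PMF α) (f : α → PMF β) (V : β → ℝ≥0∞) :
    (p.bind f).mean V = p.mean fun a => (f a).mean V := by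
  unfold mean
  simp only [PMF.bind_apply, ← ENNReal.tsum_mul_right, ← ENNReal.tsum_mul_left]
  rw [ENNReal.tsum_comm]
  simp only [mul_assoc]

theorem mean_map (p : PMF α) (g : α → β) (V : β → ℝ≥0∞) :
    (p.map g).mean V = p.mean (V ∘ g) := by
  rw [← PMF.bind_pure_comp, mean_bind]
  simp [mean_pure, Function.comp_def]

theorem mean_add (p : PMF α) (V W : α → ℝ≥0∞) :
    p.mean (fun a => V a + W a) = p.mean V + p.mean W := by
  simp only [mean, mul_add, ENNReal.tsum_add]

theorem mean_sum {ι : Type*} (p : PMF α) (s : Finset ι) (V : ι → α → ℝ≥0∞) :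
    p.mean (fun a => ∑ i ∈ s, V i a) = ∑ i ∈ s, p.mean (V i) := by
  simp only [mean, Finset.mul_sum]
  exact Summable.tsum_finsetSum fun _ _ => ENNReal.summable

theorem mean_mul_left (p : PMF α) (c : ℝ≥0∞) (V : α → ℝ≥0∞) :
    p.mean (fun a => c * V a) = c * p.mean V := by
  simp only [mean, ← ENNReal.tsum_mul_left]
  exact tsum_congr fun a => by ring

theorem mean_const (p : PMF α) (c : ℝ≥0∞) : p.mean (fun _ => c) = c := by
  simp [mean, ENNReal.tsum_mul_right, p.tsum_coe]

theorem mean_mono (p : PMF α) {V W : α → ℝ≥0∞} (h : ∀ a ∈ p.support, V a ≤ W a) :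
    p.mean V ≤ p.mean W := by
  refine ENNReal.tsum_le_tsum fun a => ?_
  by_cases ha : a ∈ p.support
  · gcongr
    exact h a ha
  · simp [(PMF.apply_eq_zero_iff p a).2 ha]

theorem mean_indicator (p : PMF α) (s : Set α) :
    p.mean (s.indicator 1) = p.toOuterMeasure s := by
  rw [PMF.toOuterMeasure_apply]
  refine tsum_congr fun a => ?_
  by_cases h : a ∈ s <;> simp [h]

theorem mean_uniform {γ : Type*} [Fintype γ] [Nonempty γ] (V : γ → ℝ≥0∞) :
    (PMF.uniformOfFintype γ).mean V = (Fintype.card γ : ℝ≥0∞)⁻¹ * ∑ b, V b := by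
  simp [mean, tsum_fintype, PMF.uniformOfFintype_apply, Finset.mul_sum]

/-- Independent fair coins: the expectation of a product is the product of the expectations. -/
theorem mean_uniform_prod {n : ℕ} (g : Fin n → Bool → ℝ≥0∞) :
    (PMF.uniformOfFintype (Fin n → Bool)).mean (fun b => ∏ j, g j (b j)) =
      ∏ j, (g j false + g j true) / 2 := by
  rw [mean_uniform]
  have h := Finset.prod_univ_sum (fun _ : Fin n => (Finset.univ : Finset Bool)) g
  simp only [Fintype.piFinset_univ] at h
  rw [← h]
  simp only [Fintype.sum_bool, div_eq_mul_inv, Finset.prod_mul_distrib, Finset.prod_const,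
    Finset.card_univ, Fintype.card_fin, Fintype.card_pi, Fintype.card_bool]
  rw [mul_comm]
  congr 1
  · exact Finset.prod_congr rfl fun j _ => add_comm _ _
  · push_cast
    exact ENNReal.inv_pow

theorem mean_uniform_coord {n : ℕ} (j : Fin n) (g : Bool → ℝ≥0∞) :
    (PMF.uniformOfFintype (Fin n → Bool)).mean (fun b => g (b j)) = (g false + g true) / 2 := by
  classical
  have h := mean_uniform_prod (fun i b => if i = j then g b else 1)
  have two : (1 + 1 : ℝ≥0∞) / 2 = 1 := by
    rw [one_add_one_eq_two]; exact ENNReal.div_self (by simp) (by simp)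
  rw [Finset.prod_eq_single j] at h
  · simpa using h
  · intro i _ hi
    simp [hi, two]
  · simp

end PMF

/-! ### Invariants and potentials for arbitrary protocols -/

namespace Protocol

variable {n : ℕ} {Input Output : Type} (P : Protocol n Input Output)

theorem step_support_invariant {Inv : P.Config → Prop}
    (toss : ∀ s b, Inv s → ¬ P.Halted s → P.Tossing s → Inv (P.afterToss s b))
    (exch : ∀ s, Inv s → P.Exchanging s → Inv (P.afterExchange s))
    {inp : Fin n → Input} (init : Inv fun i => P.init i (inp i)) (t : ℕ) :
    ∀ s ∈ (P.law inp t).support, Inv s := by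
  induction t with
  | zero =>
    intro s hs
    simp only [law, PMF.support_pure, Set.mem_singleton_iff] at hs
    exact hs ▸ init
  | succ t ih =>
    intro s hs
    simp only [law, PMF.mem_support_bind_iff] at hs
    obtain ⟨s₀, hs₀, hs⟩ := hs
    have h₀ := ih s₀ hs₀
    unfold step at hs
    split_ifs at hs with h1 h2
    · simp only [PMF.support_pure, Set.mem_singleton_iff] at hs
      exact hs ▸ h₀
    · simp only [PMF.mem_support_map_iff] at hs
      obtain ⟨b, -, rfl⟩ := hs
      exact toss s₀ b h₀ h1 h2
    · simp only [PMF.support_pure, Set.mem_singleton_iff] at hs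
      exact hs ▸ exch s₀ h₀ ⟨h1, h2⟩

/-- A potential that pays, on average, for the cost of every step bounds the expected total cost;
and it never grows on average. -/
theorem expected_le_potential {Inv : P.Config → Prop} {V : P.Config → ℝ≥0∞} {cost : P.Config → ℕ}
    {inp : Fin n → Input} (inv : ∀ t, ∀ s ∈ (P.law inp t).support, Inv s)
    (pays : ∀ s, Inv s → (cost s : ℝ≥0∞) + (P.step s).mean V ≤ V s) :
    P.expected cost inp ≤ V (fun i => P.init i (inp i)) ∧
      ∀ t, (P.law inp t).mean V ≤ V (fun i => P.init i (inp i)) := by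
  have one : ∀ t, (P.law inp t).mean (fun s => (cost s : ℝ≥0∞)) + (P.law inp (t + 1)).mean V ≤
      (P.law inp t).mean V := by
    intro t
    rw [law, PMF.mean_bind, ← PMF.mean_add]
    exact PMF.mean_mono _ fun s hs => pays s (inv t s hs)
  -- The remaining potential is kept on the left while telescoping: dropping it bounds the cost,
  -- dropping the sum gives the second conclusion.
  have all : ∀ t, ∑ i ∈ Finset.range t, (P.law inp i).mean (fun s => (cost s : ℝ≥0∞)) +
      (P.law inp t).mean V ≤ V (fun i => P.init i (inp i)) := by
    intro t
    induction t with
    | zero => simp [law, PMF.mean_pure]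
    | succ t ih =>
      rw [Finset.sum_range_succ, add_assoc]
      exact (add_le_add_right (one t) _).trans ih
  refine ⟨?_, fun t => le_add_self.trans (all t)⟩
  unfold expected
  exact ENNReal.tsum_le_of_sum_range_le fun t => le_self_add.trans (all t)

end Protocol

/-! ### Conditional expectation given the digits of a uniform number -/

namespace GHZ

open MeasureTheory

/-- The conditional expectation of `φ (U)` given the first digits `u` of the uniform number `U`. -/
noncomputable def avg (u : Uniform) (φ : ℝ → ℝ≥0∞) : ℝ≥0∞ :=
  2 ^ u.len * ∫⁻ t in Set.Ico u.val (u.val + 1 / 2 ^ u.len), φ t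

theorem two_pow_mul_ofReal (k : ℕ) : (2 : ℝ≥0∞) ^ k * ENNReal.ofReal (1 / 2 ^ k) = 1 := by
  rw [show (2 : ℝ≥0∞) ^ k = ENNReal.ofReal (2 ^ k) by
    rw [ENNReal.ofReal_pow (by norm_num)]; simp, ← ENNReal.ofReal_mul (by positivity)]
  simp

theorem avg_const (u : Uniform) (c : ℝ≥0∞) : avg u (fun _ => c) = c := by
  simp only [avg, lintegral_const, Measure.restrict_apply MeasurableSet.univ, Set.univ_inter,
    Real.volume_Ico, add_sub_cancel_left]
  rw [mul_left_comm, two_pow_mul_ofReal, mul_one]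

theorem avg_mono {u : Uniform} {φ ψ : ℝ → ℝ≥0∞}
    (h : ∀ t ∈ Set.Ico u.val (u.val + 1 / 2 ^ u.len), φ t ≤ ψ t) : avg u φ ≤ avg u ψ := by
  unfold avg
  gcongr 1
  exact setLIntegral_mono' measurableSet_Ico h

theorem avg_congr {u : Uniform} {φ ψ : ℝ → ℝ≥0∞}
    (h : ∀ t ∈ Set.Ico u.val (u.val + 1 / 2 ^ u.len), φ t = ψ t) : avg u φ = avg u ψ :=
  le_antisymm (avg_mono fun t ht => (h t ht).le) (avg_mono fun t ht => (h t ht).ge)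

theorem avg_eq_const {u : Uniform} {φ : ℝ → ℝ≥0∞} {c : ℝ≥0∞}
    (h : ∀ t ∈ Set.Ico u.val (u.val + 1 / 2 ^ u.len), φ t = c) : avg u φ = c :=
  (avg_congr h).trans (avg_const u c)

theorem avg_const_add (u : Uniform) (c : ℝ≥0∞) (φ : ℝ → ℝ≥0∞) :
    avg u (fun t => c + φ t) = c + avg u φ := by
  rw [avg, lintegral_add_left measurable_const, mul_add]
  exact congrArg (· + _) (avg_const u c)

/-- The next digit selects one half of the dyadic interval, so conditional expectations form a
martingale under a fair digit. -/
theorem avg_push (u : Uniform) (φ : ℝ → ℝ≥0∞) :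
    (avg (u.push false) φ + avg (u.push true) φ) / 2 = avg u φ := by
  set d : ℝ := 1 / 2 ^ (u.len + 1) with hd
  have h2 : (1 : ℝ) / 2 ^ u.len = d + d := by rw [hd, pow_succ]; field_simp; norm_num
  have hd0 : 0 ≤ d := by positivity
  have h : ∫⁻ t in Set.Ico u.val (u.val + 1 / 2 ^ u.len), φ t =
      (∫⁻ t in Set.Ico u.val (u.val + d), φ t) +
        ∫⁻ t in Set.Ico (u.val + d) (u.val + d + d), φ t := by
    rw [← lintegral_union measurableSet_Ico, Set.Ico_union_Ico_eq_Ico (by linarith) (by linarith),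
      h2, add_assoc]
    rw [Set.disjoint_left]
    intro x hx hx'
    exact absurd hx.2 (not_lt.2 hx'.1)
  simp only [avg, Uniform.push, h, ← hd]
  simp only [Bool.false_eq_true, if_false, if_true, zero_div, add_zero, ← mul_add, pow_succ]
  rw [mul_right_comm]
  exact ENNReal.mul_div_cancel_right (by simp) (by simp)

theorem avg_empty (φ : ℝ → ℝ≥0∞) : avg .empty φ = ∫⁻ t in Set.Ico (0 : ℝ) 1, φ t := by
  simp [avg, Uniform.empty]

open Classical in
theorem lintegral_Ico_lt {b : ℝ} (h0 : 0 ≤ b) (h1 : b ≤ 1) (x y : ℝ≥0∞) :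
    ∫⁻ t in Set.Ico (0 : ℝ) 1, (if t < b then x else y) =
      ENNReal.ofReal b * x + ENNReal.ofReal (1 - b) * y := by
  rw [← Set.Ico_union_Ico_eq_Ico h0 h1, lintegral_union measurableSet_Ico]
  · congr 1
    · rw [setLIntegral_congr_fun measurableSet_Ico (g := fun _ => x)
        (fun t ht => by simp [ht.2])]
      simp [mul_comm]
    · rw [setLIntegral_congr_fun measurableSet_Ico (g := fun _ => y)
        (fun t ht => by simp [not_lt.2 ht.1])]
      simp [mul_comm]
  · rw [Set.disjoint_left]
    intro x hx hx'
    exact absurd hx.2 (not_lt.2 hx'.1)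

open Classical in
/-- The probability that a uniform number lies within `δ` of `b`. -/
theorem lintegral_Ico_near_le (b δ : ℝ) (x : ℝ≥0∞) :
    ∫⁻ t in Set.Ico (0 : ℝ) 1, (if |t - b| ≤ δ then x else 0) ≤
      x * min 1 (ENNReal.ofReal (2 * δ)) := by
  have hm : MeasurableSet {t : ℝ | |t - b| ≤ δ} :=
    measurableSet_le (by fun_prop) measurable_const
  have : ∀ t : ℝ, (if |t - b| ≤ δ then x else 0) =
      Set.indicator {t : ℝ | |t - b| ≤ δ} (fun _ => x) t := by
    intro t; simp [Set.indicator_apply]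
  simp only [this]
  rw [lintegral_indicator hm, setLIntegral_const, Measure.restrict_apply hm]
  gcongr
  refine le_min ?_ ?_
  · refine (measure_mono Set.inter_subset_right).trans ?_
    simp
  · refine (measure_mono (t := Set.Icc (b - δ) (b + δ)) ?_).trans ?_
    · rintro t ⟨ht, -⟩
      have := abs_le.1 (show |t - b| ≤ δ from ht)
      exact ⟨by linarith, by linarith⟩
    · rw [Real.volume_Icc]
      exact ENNReal.ofReal_le_ofReal (by linarith)

end GHZ

/-! ### Encodings, truncation and propagation of errors -/

namespace GHZ

theorem length_encodeNat (w z : ℕ) : (encodeNat w z).length = w := by simp [encodeNat]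

theorem decodeNat_encodeNat {w z : ℕ} (h : z < 2 ^ w) : decodeNat (encodeNat w z) = z := by
  induction w generalizing z with
  | zero =>
    have : z = 0 := by simpa using h
    simp [this, encodeNat, decodeNat]
  | succ w ih =>
    have h2 : z / 2 < 2 ^ w := by rw [pow_succ] at h; omega
    have e : encodeNat (w + 1) z = z.testBit 0 :: encodeNat w (z / 2) := by
      simp [encodeNat, List.ofFn_succ, Nat.testBit_succ]
    have ih' := ih h2
    simp only [decodeNat] at ih' ⊢
    rw [e, List.foldr_cons, ih', Nat.testBit_zero]
    rcases Nat.mod_two_eq_zero_or_one z with h | h <;> simp [h] <;> omega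

/-- `t` is an integer multiple of `2^(-ℓ)`. -/
def Dyadic (ℓ : ℕ) (t : ℝ) : Prop := ∃ z : ℤ, t * 2 ^ ℓ = z

/-- Numbers are truncated before they are sent, so transmission adds no error. The offset 2^(ℓ+1)
makes the integer nonnegative, and `ℓ + 2` bits hold the result. -/
theorem decodeTrunc_encodeTrunc {ℓ : ℕ} {t : ℝ} (hd : Dyadic ℓ t) (h1 : |t| ≤ 1) :
    decodeTrunc ℓ (encodeTrunc ℓ t) = t := by
  obtain ⟨z, hz⟩ := hd
  have hp : (0 : ℝ) < 2 ^ ℓ := by positivity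
  obtain ⟨hl, hu⟩ := abs_le.1 h1
  have hl' : -(2 ^ ℓ : ℤ) ≤ z := by
    have : (-(2 ^ ℓ) : ℝ) ≤ z := by rw [← hz]; nlinarith
    exact_mod_cast this
  have hu' : z ≤ (2 ^ ℓ : ℤ) := by
    have : (z : ℝ) ≤ 2 ^ ℓ := by rw [← hz]; nlinarith
    exact_mod_cast this
  have hpz : (0 : ℤ) < 2 ^ ℓ := by positivity
  have h0 : 0 ≤ z + 2 ^ (ℓ + 1) := by rw [pow_succ]; linarith
  have hlt : (z + 2 ^ (ℓ + 1)).toNat < 2 ^ (ℓ + 2) := by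
    zify
    rw [Int.toNat_of_nonneg h0, pow_succ, pow_succ, pow_succ]
    linarith
  unfold decodeTrunc encodeTrunc
  rw [hz, Int.floor_intCast, decodeNat_encodeNat hlt]
  have : (((z + 2 ^ (ℓ + 1)).toNat : ℕ) : ℝ) = z + 2 ^ (ℓ + 1) := by
    have h := Int.toNat_of_nonneg h0
    exact_mod_cast h
  rw [this, add_sub_cancel_right, ← hz, mul_div_cancel_right₀ _ hp.ne']

theorem length_encodeTrunc (ℓ : ℕ) (t : ℝ) : (encodeTrunc ℓ t).length = ℓ + 2 :=
  length_encodeNat _ _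

theorem length_encodePair (ℓ : ℕ) (a : ℝ × ℝ) : (encodePair ℓ a).length = 2 * (ℓ + 2) := by
  rw [encodePair, List.length_append, length_encodeTrunc, length_encodeTrunc, two_mul]

theorem decodePair_encodePair {ℓ : ℕ} {a : ℝ × ℝ} (hd₁ : Dyadic ℓ a.1) (h₁ : |a.1| ≤ 1)
    (hd₂ : Dyadic ℓ a.2) (h₂ : |a.2| ≤ 1) : decodePair ℓ (encodePair ℓ a) = a := by
  unfold decodePair encodePair
  rw [List.take_left' (length_encodeTrunc _ _), List.drop_left' (length_encodeTrunc _ _),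
    decodeTrunc_encodeTrunc hd₁ h₁, decodeTrunc_encodeTrunc hd₂ h₂]

theorem decodeVerdict_encodeVerdict (y : Option Bool) : decodeVerdict (encodeVerdict y) = y := by
  cases y <;> rfl

theorem length_encodeVerdict (y : Option Bool) : (encodeVerdict y).length = 2 := by
  cases y <;> rfl

theorem trunc_le (ℓ : ℕ) (t : ℝ) : trunc ℓ t ≤ t := by
  rw [trunc, div_le_iff₀ (by positivity)]
  exact Int.floor_le _

theorem lt_trunc_add (ℓ : ℕ) (t : ℝ) : t < trunc ℓ t + 1 / 2 ^ ℓ := by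
  rw [trunc, ← add_div, lt_div_iff₀ (by positivity)]
  exact Int.lt_floor_add_one _

/-- `a` is an `ℓ`-bit approximation of `b ∈ [-1, 1]` with error at most `N` units. -/
structure Near (ℓ : ℕ) (N a b : ℝ) : Prop where
  abs_le_one : |a| ≤ 1
  abs_le_one' : |b| ≤ 1
  dyadic : Dyadic ℓ a
  err : |a - b| ≤ N / 2 ^ ℓ

theorem dyadic_trunc (ℓ : ℕ) (t : ℝ) : Dyadic ℓ (trunc ℓ t) :=
  ⟨⌊t * 2 ^ ℓ⌋, by rw [trunc]; field_simp⟩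

theorem abs_trunc_sub_le (ℓ : ℕ) (t : ℝ) : |trunc ℓ t - t| ≤ 1 / 2 ^ ℓ := by
  have h1 := trunc_le ℓ t
  have h2 := lt_trunc_add ℓ t
  rw [abs_le]
  constructor
  · linarith
  · have : (0 : ℝ) ≤ 1 / 2 ^ ℓ := by positivity
    linarith

theorem abs_trunc_le_one (ℓ : ℕ) {t : ℝ} (h : |t| ≤ 1) : |trunc ℓ t| ≤ 1 := by
  obtain ⟨hl, hu⟩ := abs_le.1 h
  refine abs_le.2 ⟨?_, (trunc_le ℓ t).trans hu⟩
  rw [trunc, le_div_iff₀ (by positivity)]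
  have : (-(2 ^ ℓ) : ℤ) ≤ ⌊t * 2 ^ ℓ⌋ := by
    rw [Int.le_floor]
    push_cast
    have hp : (0 : ℝ) < 2 ^ ℓ := by positivity
    nlinarith
  have h : ((-(2 ^ ℓ) : ℤ) : ℝ) ≤ (⌊t * 2 ^ ℓ⌋ : ℝ) := by exact_mod_cast this
  push_cast at h
  linarith

theorem near_trunc (ℓ : ℕ) {t : ℝ} (h : |t| ≤ 1) : Near ℓ 1 (trunc ℓ t) t :=
  ⟨abs_trunc_le_one ℓ h, h, dyadic_trunc ℓ t, abs_trunc_sub_le ℓ t⟩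

theorem abs_mul_sub_mul_le {a a' b b' : ℝ} (ha : |a'| ≤ 1) (hb : |b| ≤ 1) :
    |a * a' - b * b'| ≤ |a - b| + |a' - b'| := by
  have : a * a' - b * b' = (a - b) * a' + b * (a' - b') := by ring
  rw [this]
  refine (abs_add_le _ _).trans ?_
  rw [abs_mul, abs_mul]
  have := abs_nonneg (a - b)
  have := abs_nonneg (a' - b')
  nlinarith

/-- For factors in [-1, 1] the errors add up under multiplication; the extra unit is the truncation
of the product. -/
theorem Near.mul {ℓ : ℕ} {N N' a a' b b' : ℝ} (h : Near ℓ N a b) (h' : Near ℓ N' a' b') :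
    Near ℓ (N + N' + 1) (trunc ℓ (a * a')) (b * b') := by
  have h1 : ∀ {x y : ℝ}, |x| ≤ 1 → |y| ≤ 1 → |x * y| ≤ 1 := fun hx hy => by
    rw [abs_mul]; exact mul_le_one₀ hx (abs_nonneg _) hy
  refine ⟨abs_trunc_le_one ℓ (h1 h.1 h'.1), h1 h.2 h'.2, dyadic_trunc _ _, ?_⟩
  calc |trunc ℓ (a * a') - b * b'|
      ≤ |trunc ℓ (a * a') - a * a'| + |a * a' - b * b'| := abs_sub_le _ _ _
    _ ≤ 1 / 2 ^ ℓ + (N / 2 ^ ℓ + N' / 2 ^ ℓ) := by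
      gcongr
      · exact abs_trunc_sub_le _ _
      · exact (abs_mul_sub_mul_le h'.1 h.2).trans (add_le_add h.4 h'.4)
    _ = (N + N' + 1) / 2 ^ ℓ := by ring

theorem abs_prod_le_one {ι : Type*} (s : Finset ι) {a : ι → ℝ} (ha : ∀ i ∈ s, |a i| ≤ 1) :
    |∏ i ∈ s, a i| ≤ 1 := by
  rw [Finset.abs_prod]
  exact Finset.prod_le_one (fun _ _ => abs_nonneg _) ha

theorem abs_prod_sub_prod_le {ι : Type*} (s : Finset ι) {a b : ι → ℝ} {δ : ℝ}
    (ha : ∀ i ∈ s, |a i| ≤ 1) (hb : ∀ i ∈ s, |b i| ≤ 1) (h : ∀ i ∈ s, |a i - b i| ≤ δ) :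
    |∏ i ∈ s, a i - ∏ i ∈ s, b i| ≤ s.card * δ := by
  classical
  induction s using Finset.induction_on with
  | empty => simp
  | insert i s hi ih =>
    simp only [Finset.forall_mem_insert] at ha hb h
    rw [Finset.prod_insert hi, Finset.prod_insert hi, Finset.card_insert_of_notMem hi]
    refine (abs_mul_sub_mul_le (abs_prod_le_one s ha.2) hb.1).trans ?_
    have := ih ha.2 hb.2 h.2
    push_cast
    linarith [h.1]

/-- The error made in `u L - R` by approximating the two products and `U`. -/
theorem abs_discriminant_sub_le {a b a' b' u t δ : ℝ} (ha : |a'| ≤ 1) (hb : |b'| ≤ 1)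
    (hL : a ^ 2 + b ^ 2 ≤ 1) (h1 : |a' - a| ≤ δ / 4) (h2 : |b' - b| ≤ δ / 4)
    (hu0 : 0 ≤ u) (hu1 : u ≤ 1) (hut : u ≤ t) (htu : t ≤ u + δ) :
    |(u * (a' ^ 2 + b' ^ 2) - (a' + b') ^ 2 / 2) - (t * (a ^ 2 + b ^ 2) - (a + b) ^ 2 / 2)| ≤
      3 * δ := by
  have hδ : 0 ≤ δ := by linarith
  have ha1 : |a| ≤ 1 := abs_le_one_iff_mul_self_le_one.2 (by nlinarith)
  have hb1 : |b| ≤ 1 := abs_le_one_iff_mul_self_le_one.2 (by nlinarith)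
  have sq : ∀ {x y : ℝ}, |x| ≤ 1 → |y| ≤ 1 → |x - y| ≤ δ / 4 → |x ^ 2 - y ^ 2| ≤ δ / 2 := by
    intro x y hx hy h
    have : x ^ 2 - y ^ 2 = x * x - y * y := by ring
    rw [this]
    exact (abs_mul_sub_mul_le hx hy).trans (by linarith)
  have e1 := abs_le.1 (sq ha ha1 h1)
  have e2 := abs_le.1 (sq hb hb1 h2)
  have e3 := abs_le.1 ((abs_mul_sub_mul_le (a := a') (a' := b') (b := a) (b' := b) hb ha1).trans
    (add_le_add h1 h2))
  set L' := a' ^ 2 + b' ^ 2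
  set L := a ^ 2 + b ^ 2 with hLdef
  have hL0 : 0 ≤ L := by positivity
  have eL : |L' - L| ≤ δ := abs_le.2 ⟨by simp only [L', L]; linarith, by simp only [L', L]; linarith⟩
  have e4 : |u * (L' - L)| ≤ δ := by
    rw [abs_mul, abs_of_nonneg hu0]
    nlinarith [abs_nonneg (L' - L)]
  have e5 : |(u - t) * L| ≤ δ := by
    rw [abs_mul, abs_of_nonneg hL0, abs_of_nonpos (by linarith)]
    nlinarith
  have e6 : |((a' + b') ^ 2 / 2 - (a + b) ^ 2 / 2)| ≤ δ := by
    rw [abs_le]; constructor <;> nlinarith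
  -- Three errors of at most δ each: from L, from the unknown digits of the uniform number, and from
  -- R.
  have : (u * L' - (a' + b') ^ 2 / 2) - (t * L - (a + b) ^ 2 / 2) =
      u * (L' - L) + (u - t) * L - ((a' + b') ^ 2 / 2 - (a + b) ^ 2 / 2) := by ring
  rw [this]
  have e4 := abs_le.1 e4
  have e5 := abs_le.1 e5
  have e6 := abs_le.1 e6
  exact abs_le.2 ⟨by linarith, by linarith⟩

end GHZ

/-! ### The GHZ distribution as a mixture of two components -/

namespace GHZ

noncomputable section

/-- `c_j` for the outcome `y`. -/
def Measurement.c (M : Measurement) (y : ℤˣ) : ℝ :=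
  Real.cos ((M.φ - Real.pi / 2 * ((y : ℤ) : ℝ)) / 2)

/-- `s_j` for the outcome `y`. -/
def Measurement.s (M : Measurement) (y : ℤˣ) : ℝ :=
  -Real.sin ((M.φ - Real.pi / 2 * ((y : ℤ) : ℝ)) / 2)

/-- The probability of `+1` under the local Rademacher distribution. -/
def Measurement.bias (M : Measurement) : ℝ := Real.cos ((M.φ - Real.pi / 2) / 2) ^ 2

namespace Measurement

variable (M : Measurement)

theorem c_sq_add_s_sq (y : ℤˣ) : M.c y ^ 2 + M.s y ^ 2 = 1 := by
  rw [c, s, neg_sq, Real.cos_sq_add_sin_sq]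

theorem bias_nonneg : 0 ≤ M.bias := sq_nonneg _

theorem bias_le_one : M.bias ≤ 1 := Real.cos_sq_le_one _

/-- Changing the sign of the outcome shifts the half angle by π/2, which exchanges cosine and sine
up to sign. This is why flipping all X_j when S = 1 turns the proposal ∏ c_j² into ∏ s_j². -/
theorem c_neg (y : ℤˣ) : M.c (-y) = (y : ℤ) * M.s y := by
  have h : (M.φ - Real.pi / 2 * (((-y : ℤˣ) : ℤ) : ℝ)) / 2 =
      (M.φ - Real.pi / 2 * ((y : ℤ) : ℝ)) / 2 + (y : ℤ) * (Real.pi / 2) := by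
    push_cast; ring
  rw [c, s, h]
  rcases Int.units_eq_one_or y with rfl | rfl
  · simp [Real.cos_add_pi_div_two]
  · simp [← sub_eq_add_neg, Real.cos_sub_pi_div_two]

theorem c_one_sq : M.c 1 ^ 2 = M.bias := by simp [c, bias]

theorem s_one_sq : M.s 1 ^ 2 = 1 - M.bias := by
  rw [← c_one_sq, ← M.c_sq_add_s_sq 1]; ring

theorem c_neg_sq (y : ℤˣ) : M.c (-y) ^ 2 = M.s y ^ 2 := by
  rw [c_neg, mul_pow]
  rcases Int.units_eq_one_or y with rfl | rfl <;> simp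

theorem c_neg_one_sq : M.c (-1) ^ 2 = 1 - M.bias := by rw [c_neg_sq, s_one_sq]

theorem s_neg_one_sq : M.s (-1) ^ 2 = M.bias := by
  have := M.c_neg_sq (-1)
  rw [neg_neg, c_one_sq] at this
  exact this.symm

theorem c_sq (y : ℤˣ) : M.c y ^ 2 = (1 + (y : ℤ) * Real.sin M.φ) / 2 := by
  rw [c, Real.cos_sq]
  rcases Int.units_eq_one_or y with rfl | rfl
  · simp [mul_div_cancel₀, Real.cos_sub_pi_div_two]; ring
  · simp [mul_div_cancel₀, ← sub_eq_add_neg, Real.cos_add_pi_div_two]; ring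

theorem s_sq (y : ℤˣ) : M.s y ^ 2 = (1 - (y : ℤ) * Real.sin M.φ) / 2 := by
  have := M.c_sq_add_s_sq y
  rw [c_sq] at this
  linarith

theorem c_mul_s (y : ℤˣ) : M.c y * M.s y = (y : ℤ) * Real.cos M.φ / 2 := by
  have h : 2 * (M.c y * M.s y) = -Real.sin (M.φ - Real.pi / 2 * ((y : ℤ) : ℝ)) := by
    have h2 := Real.sin_two_mul ((M.φ - Real.pi / 2 * ((y : ℤ) : ℝ)) / 2)
    rw [mul_div_cancel₀ _ (two_ne_zero)] at h2
    rw [h2, c, s]; ring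
  rw [mul_div_assoc]
  rcases Int.units_eq_one_or y with rfl | rfl
  · simp [Real.sin_sub_pi_div_two] at h ⊢; linarith
  · simp [Real.sin_add_pi_div_two] at h ⊢; linarith

theorem abs_c_le_one (y : ℤˣ) : |M.c y| ≤ 1 := Real.abs_cos_le_one _

theorem abs_s_le_one (y : ℤˣ) : |M.s y| ≤ 1 := by
  rw [s, abs_neg]; exact Real.abs_sin_le_one _

end Measurement

theorem sum_units (f : ℤˣ → ℝ) : ∑ y, f y = f 1 + f (-1) := by
  rw [UnitsInt.univ, Finset.sum_pair (by decide)]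

variable {n : ℕ} (M : Fin n → Measurement)

/-- The product of the `c_j`. -/
def ampC (y : Fin n → ℤˣ) : ℝ := ∏ j, (M j).c (y j)

/-- The product of the `s_j`. -/
def ampS (y : Fin n → ℤˣ) : ℝ := ∏ j, (M j).s (y j)

/-- The product of the `s_j`, with the sign chosen by the leader. -/
def ampFlip (flip : Bool) (y : Fin n → ℤˣ) : ℝ := (if flip then -1 else 1) * ampS M y

/-- Twice the probability of `y` under the proposal distribution. -/
def mass (y : Fin n → ℤˣ) : ℝ := ampC M y ^ 2 + ampS M y ^ 2

/-- The two distributions of which the GHZ distribution is a mixture. -/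
def component (flip : Bool) (y : Fin n → ℤˣ) : ℝ := (ampC M y + ampFlip M flip y) ^ 2 / 2

theorem ampFlip_sq (flip : Bool) (y : Fin n → ℤˣ) : ampFlip M flip y ^ 2 = ampS M y ^ 2 := by
  cases flip <;> simp [ampFlip]

theorem mass_nonneg (y : Fin n → ℤˣ) : 0 ≤ mass M y := by unfold mass; positivity

theorem component_nonneg (flip : Bool) (y : Fin n → ℤˣ) : 0 ≤ component M flip y := by
  unfold component; positivity

/-- The difference is half the square of the amplitude combination with the other sign. It makes the
acceptance probability R/L at most 1. -/
theorem component_le_mass (flip : Bool) (y : Fin n → ℤˣ) : component M flip y ≤ mass M y := by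
  unfold component mass
  rw [← ampFlip_sq M flip y]
  nlinarith [sq_nonneg (ampC M y - ampFlip M flip y)]

theorem sum_prod_units (f : Fin n → ℤˣ → ℝ) :
    ∑ y : Fin n → ℤˣ, ∏ j, f j (y j) = ∏ j, (f j 1 + f j (-1)) := by
  have h := Finset.prod_univ_sum (fun _ : Fin n => (Finset.univ : Finset ℤˣ)) f
  rw [Fintype.piFinset_univ] at h
  rw [← h]
  exact Finset.prod_congr rfl fun j _ => sum_units _

theorem sum_ampC_sq : ∑ y, ampC M y ^ 2 = 1 := by
  simp only [ampC, ← Finset.prod_pow]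
  rw [sum_prod_units (fun j y => (M j).c y ^ 2)]
  simp [Measurement.c_one_sq, Measurement.c_neg_one_sq]

theorem sum_ampS_sq : ∑ y, ampS M y ^ 2 = 1 := by
  simp only [ampS, ← Finset.prod_pow]
  rw [sum_prod_units (fun j y => (M j).s y ^ 2)]
  simp [Measurement.s_one_sq, Measurement.s_neg_one_sq]

theorem sum_mass : ∑ y, mass M y = 2 := by
  simp only [mass, Finset.sum_add_distrib, sum_ampC_sq, sum_ampS_sq]; norm_num

/-- Each c_j s_j is odd in the outcome of party j, so already the factor of one party sums to zero.
Hence both components are normalised. -/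
theorem sum_ampC_mul_ampS [NeZero n] : ∑ y, ampC M y * ampS M y = 0 := by
  simp only [ampC, ampS, ← Finset.prod_mul_distrib]
  rw [sum_prod_units (fun j y => (M j).c y * (M j).s y)]
  refine Finset.prod_eq_zero (Finset.mem_univ (0 : Fin n)) ?_
  simp only [Measurement.c_mul_s]
  push_cast
  ring

theorem sum_component [NeZero n] (flip : Bool) : ∑ y, component M flip y = 1 := by
  have h : ∀ y, component M flip y =
      1 / 2 * (mass M y + 2 * (if flip then -1 else 1) * (ampC M y * ampS M y)) := by
    intro y
    rw [component, add_sq, ampFlip_sq, mass, ampFlip]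
    ring
  simp only [h, ← Finset.mul_sum, Finset.sum_add_distrib, sum_mass, sum_ampC_mul_ampS]
  norm_num

/-- Party 0 alone contributes c² + s² = 1, and the remaining factors only decrease the two terms.
The bound keeps the error in U·L under control. -/
theorem mass_le_one [NeZero n] (y : Fin n → ℤˣ) : mass M y ≤ 1 := by
  have h : ∀ f : Fin n → ℝ, (∀ j, |f j| ≤ 1) → (∏ j, f j) ^ 2 ≤ f 0 ^ 2 := by
    intro f hf
    rw [← Finset.mul_prod_erase Finset.univ f (Finset.mem_univ 0), mul_pow]
    have := (sq_le_one_iff_abs_le_one _).2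
      (abs_prod_le_one (Finset.univ.erase 0) (a := f) fun i _ => hf i)
    nlinarith [sq_nonneg (f 0)]
  have h1 := h (fun j => (M j).c (y j)) fun j => (M j).abs_c_le_one _
  have h2 := h (fun j => (M j).s (y j)) fun j => (M j).abs_s_le_one _
  have := (M 0).c_sq_add_s_sq (y 0)
  unfold mass ampC ampS
  linarith

/-- Half of the sum of the azimuthal angles. -/
def halfAngle : ℝ := ∑ j, (M j).θ / 2

/-- The parameter of the Bernoulli variable. -/
def bernParam : ℝ := Real.cos (halfAngle M) ^ 2

theorem bernParam_nonneg : 0 ≤ bernParam M := sq_nonneg _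

theorem bernParam_le_one : bernParam M ≤ 1 := Real.cos_sq_le_one _

/-- The GHZ vector is supported on two basis states, so only four entries of the tensor product
contribute. -/
theorem prob_eq_entries (y : Fin n → ℤˣ) :
    prob M y = ((∏ j, (M j).projector (y j) 0 0 + ∏ j, (M j).projector (y j) 1 1 +
      (∏ j, (M j).projector (y j) 0 1 + ∏ j, (M j).projector (y j) 1 0)) / 2).re := by
  have hs : state n = (1 / (Real.sqrt 2 : ℂ)) •
      (Pi.single (fun _ => 0) 1 + Pi.single (fun _ => 1) 1) := by
    ext b
    simp [state, Pi.single_apply, div_eq_inv_mul]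
  have h2 : (1 / (Real.sqrt 2 : ℂ)) * (1 / (Real.sqrt 2 : ℂ)) = 1 / 2 := by
    rw [div_mul_div_comm, ← Complex.ofReal_mul, Real.mul_self_sqrt (by norm_num)]; simp
  have hc : star (1 / (Real.sqrt 2 : ℂ)) = 1 / (Real.sqrt 2 : ℂ) := by simp
  have hstar : star (state n) = (1 / (Real.sqrt 2 : ℂ)) •
      (Pi.single (fun _ => 0) 1 + Pi.single (fun _ => 1) 1) := by
    rw [hs, star_smul, hc, star_add, ← Pi.single_star, ← Pi.single_star, star_one]
  unfold prob
  congr 1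
  rw [hstar, hs, Matrix.mulVec_smul, smul_dotProduct, dotProduct_smul, smul_smul, h2,
    Matrix.mulVec_add, add_dotProduct, dotProduct_add, dotProduct_add]
  simp only [single_dotProduct, Matrix.mulVec_single, one_mul, Matrix.of_apply, smul_eq_mul,
    Matrix.col, Matrix.transpose_apply, MulOpposite.op_one, one_smul]
  ring

/-- The decomposition of the GHZ distribution into two components. -/
theorem prob_eq (y : Fin n → ℤˣ) :
    prob M y = bernParam M * component M false y + (1 - bernParam M) * component M true y := by
  have e00 : ∀ j, (M j).projector (y j) 0 0 = (((M j).c (y j) ^ 2 : ℝ) : ℂ) := by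
    intro j
    rw [Measurement.c_sq]
    simp [Measurement.projector, Measurement.observable]; ring
  have e11 : ∀ j, (M j).projector (y j) 1 1 = (((M j).s (y j) ^ 2 : ℝ) : ℂ) := by
    intro j
    rw [Measurement.s_sq]
    simp [Measurement.projector, Measurement.observable]; ring
  have e01 : ∀ j, (M j).projector (y j) 0 1 =
      (((M j).c (y j) * (M j).s (y j) : ℝ) : ℂ) * Complex.exp (-(Complex.I * (M j).θ)) := by
    intro j
    rw [Measurement.c_mul_s]
    simp [Measurement.projector, Measurement.observable]; ring
  have e10 : ∀ j, (M j).projector (y j) 1 0 =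
      (((M j).c (y j) * (M j).s (y j) : ℝ) : ℂ) * Complex.exp (Complex.I * (M j).θ) := by
    intro j
    rw [Measurement.c_mul_s]
    simp [Measurement.projector, Measurement.observable]; ring
  have hθ : ∑ j, Complex.I * ((M j).θ : ℂ) = ((2 * halfAngle M : ℝ) : ℂ) * Complex.I := by
    rw [← Finset.mul_sum, halfAngle, ← Finset.sum_div]
    push_cast
    ring
  rw [prob_eq_entries]
  simp only [e00, e11, e01, e10, Finset.prod_mul_distrib, ← Complex.exp_sum,
    Finset.sum_neg_distrib, hθ, ← Complex.ofReal_prod]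
  rw [← mul_add, ← neg_mul, add_comm (Complex.exp _), ← Complex.two_cos, ← Complex.ofReal_cos]
  have e : ∀ r s t v : ℝ, (((r : ℂ) + s + t * (2 * v)) / 2).re = (r + s + t * (2 * v)) / 2 := by
    intro r s t v; norm_cast
  -- The off-diagonal phases combine to 2 cos Θ, and cos Θ = 2 cos²(Θ/2) - 1 produces the two
  -- mixture weights.
  rw [e, Finset.prod_pow, Finset.prod_pow, Real.cos_two_mul]
  simp only [component, ampFlip, ampC, ampS, bernParam]
  simp
  ring

end

end GHZ

/-! ### Approximate products and soundness of verdicts -/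

namespace GHZ

noncomputable section

/-- cos² a - cos² b = -sin(a+b) sin(a-b), so the approximate Bernoulli parameter inherits the error
of the angle sum without loss. -/
theorem abs_cos_sq_sub_cos_sq_le (a b : ℝ) : |Real.cos a ^ 2 - Real.cos b ^ 2| ≤ |a - b| := by
  have h : Real.cos a ^ 2 - Real.cos b ^ 2 = -(Real.sin (a + b) * Real.sin (a - b)) := by
    rw [Real.sin_add, Real.sin_sub]
    have h1 := Real.sin_sq a
    have h2 := Real.sin_sq b
    linear_combination (Real.cos b ^ 2) * h1 - (Real.cos a ^ 2) * h2
  rw [h, abs_neg, abs_mul]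
  have h1 := Real.abs_sin_le_one (a + b)
  have h2 : |Real.sin (a - b)| ≤ |a - b| := Real.abs_sin_le_abs
  nlinarith [abs_nonneg (Real.sin (a - b))]

variable {n : ℕ}

/-! ### Products along the binomial tree -/

/-- The parties whose numbers have been collected by party `j` after `i` exchanges. -/
def block (i : ℕ) (j : Fin n) : Finset (Fin n) :=
  Finset.univ.filter fun t => j.val ≤ t.val ∧ t.val < j.val + 2 ^ i

/-- The numbers `a` are good approximations of the products of `f` over the blocks. -/
def BlockNear (ℓ i : ℕ) (f a : Fin n → ℝ) : Prop :=
  ∀ j : Fin n, 2 ^ i ∣ j.val →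
    Near ℓ (2 * ((block i j).card : ℝ) - 1) (a j) (∏ t ∈ block i j, f t)

theorem blockNear_zero (ℓ : ℕ) {f : Fin n → ℝ} (hf : ∀ j, |f j| ≤ 1) :
    BlockNear ℓ 0 f fun j => trunc ℓ (f j) := by
  intro j _
  have h : block 0 j = {j} := by
    ext t
    simp only [block, Finset.mem_filter, Finset.mem_univ, true_and, Finset.mem_singleton,
      Fin.ext_iff]
    omega
  rw [h, Finset.prod_singleton, Finset.card_singleton]
  norm_num
  exact near_trunc ℓ (hf j)

/-- The error 2·card - 1 counts the truncations in a binary tree: one per leaf and one per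
multiplication. Merging two blocks gives (2p-1) + (2q-1) + 1 = 2(p+q) - 1. -/
theorem blockNear_succ {ℓ i : ℕ} {f a a' : Fin n → ℝ} (h : BlockNear ℓ i f a)
    (hmul : ∀ j : Fin n, 2 ^ (i + 1) ∣ j.val → ∀ h : j.val + 2 ^ i < n,
      a' j = trunc ℓ (a j * a ⟨j.val + 2 ^ i, h⟩))
    (hkeep : ∀ j : Fin n, n ≤ j.val + 2 ^ i → a' j = a j) :
    BlockNear ℓ (i + 1) f a' := by
  intro j hj
  have hj' : 2 ^ i ∣ j.val := (pow_dvd_pow 2 (Nat.le_succ i)).trans hj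
  have hp : 2 ^ (i + 1) = 2 ^ i + 2 ^ i := by rw [pow_succ, mul_two]
  by_cases hlt : j.val + 2 ^ i < n
  · have hb : block (i + 1) j = block i j ∪ block i ⟨j.val + 2 ^ i, hlt⟩ := by
      ext t
      simp only [block, Finset.mem_filter, Finset.mem_univ, true_and, Finset.mem_union]
      omega
    have hd : Disjoint (block i j) (block i ⟨j.val + 2 ^ i, hlt⟩) := by
      rw [Finset.disjoint_left]
      intro t
      simp only [block, Finset.mem_filter, Finset.mem_univ, true_and]
      omega
    rw [hb, Finset.prod_union hd, Finset.card_union_of_disjoint hd, hmul j hj hlt]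
    have := (h j hj').mul (h ⟨j.val + 2 ^ i, hlt⟩ (hj'.add (dvd_refl _)))
    convert this using 1
    push_cast
    ring
  · have hb : block (i + 1) j = block i j := by
      ext t
      have := t.isLt
      simp only [block, Finset.mem_filter, Finset.mem_univ, true_and]
      omega
    rw [hb, hkeep j (not_lt.1 hlt)]
    exact h j hj'

theorem BlockNear.top [NeZero n] {ℓ : ℕ} {f a : Fin n → ℝ}
    (h : BlockNear ℓ (Nat.clog 2 n) f a) : Near ℓ (2 * (n : ℝ) - 1) (a 0) (∏ t, f t) := by
  have hb : block (Nat.clog 2 n) (0 : Fin n) = Finset.univ := by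
    ext t
    have := t.isLt.trans_le (Nat.le_pow_clog (b := 2) (by norm_num) n)
    simpa [block] using this
  have := h 0 (by simp)
  rwa [hb, Finset.card_univ, Fintype.card_fin] at this

/-! ### Soundness of the leader's decisions -/

/-- The digits `u` are the binary expansion of a number in `[0, 1)`. -/
structure Uniform.Valid (u : Uniform) : Prop where
  nonneg : 0 ≤ u.val
  le_one : u.val + 1 / 2 ^ u.len ≤ 1

theorem Uniform.valid_empty : Uniform.empty.Valid := ⟨le_rfl, by simp [Uniform.empty]⟩

theorem Uniform.Valid.push {u : Uniform} (h : u.Valid) (b : Bool) : (u.push b).Valid := by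
  have h0 := h.nonneg
  have h1 := h.le_one
  have h2 : (1 : ℝ) / 2 ^ u.len = 1 / 2 ^ (u.len + 1) + 1 / 2 ^ (u.len + 1) := by
    rw [pow_succ]; field_simp; norm_num
  have h3 : (0 : ℝ) < 1 / 2 ^ (u.len + 1) := by positivity
  cases b
  · constructor <;> simp only [Uniform.push, Bool.false_eq_true, if_false, zero_div, add_zero] <;>
      linarith
  · constructor <;> simp only [Uniform.push, if_true] <;> linarith

section Verdict

variable {m : Memory} {a : ℝ × ℝ} {a₁ a₂ t : ℝ}

/-- The error is 3 units of 2^(-k). The threshold 4 therefore makes a verdict valid for every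
completion t of the digits, and a missing verdict confines the true discriminant to 3 + 4 = 7 units.
-/
theorem verdict_discriminant (hu : m.u.Valid) (hlen : m.u.len = m.k) (h₁ : |a.1| ≤ 1)
    (h₂ : |a.2| ≤ 1) (hL : a₁ ^ 2 + a₂ ^ 2 ≤ 1) (e₁ : |a.1 - a₁| ≤ 1 / 2 ^ m.k / 4)
    (e₂ : |a.2 - a₂| ≤ 1 / 2 ^ m.k / 4)
    (ht : t ∈ Set.Ico m.u.val (m.u.val + 1 / 2 ^ m.u.len)) :
    |(m.u.val * (a.1 ^ 2 + a.2 ^ 2) - (a.1 + a.2) ^ 2 / 2) -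
      (t * (a₁ ^ 2 + a₂ ^ 2) - (a₁ + a₂) ^ 2 / 2)| ≤ 3 * (1 / 2 ^ m.k) := by
  have h := hu.le_one
  rw [hlen] at ht h
  have hp : (0 : ℝ) < 1 / 2 ^ m.k := by positivity
  exact abs_discriminant_sub_le h₁ h₂ hL e₁ e₂ hu.nonneg (by linarith) ht.1 ht.2.le

theorem verdict_accept
    (h : |(m.u.val * (a.1 ^ 2 + a.2 ^ 2) - (a.1 + a.2) ^ 2 / 2) -
      (t * (a₁ ^ 2 + a₂ ^ 2) - (a₁ + a₂) ^ 2 / 2)| ≤ 3 * (1 / 2 ^ m.k))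
    (hv : verdict m a = some true) : t * (a₁ ^ 2 + a₂ ^ 2) < (a₁ + a₂) ^ 2 / 2 := by
  have hp : (0 : ℝ) < 1 / 2 ^ m.k := by positivity
  have h4 : (4 : ℝ) / 2 ^ m.k = 4 * (1 / 2 ^ m.k) := by ring
  simp only [verdict] at hv
  split_ifs at hv with h1 h2
  · linarith [(abs_le.1 h).1]
  · simp at hv

theorem verdict_reject
    (h : |(m.u.val * (a.1 ^ 2 + a.2 ^ 2) - (a.1 + a.2) ^ 2 / 2) -
      (t * (a₁ ^ 2 + a₂ ^ 2) - (a₁ + a₂) ^ 2 / 2)| ≤ 3 * (1 / 2 ^ m.k))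
    (hv : verdict m a = some false) : ¬ t * (a₁ ^ 2 + a₂ ^ 2) < (a₁ + a₂) ^ 2 / 2 := by
  have hp : (0 : ℝ) < 1 / 2 ^ m.k := by positivity
  have h4 : (4 : ℝ) / 2 ^ m.k = 4 * (1 / 2 ^ m.k) := by ring
  simp only [verdict] at hv
  split_ifs at hv with h1 h2
  · simp at hv
  · linarith [(abs_le.1 h).2]

theorem verdict_none
    (h : |(m.u.val * (a.1 ^ 2 + a.2 ^ 2) - (a.1 + a.2) ^ 2 / 2) -
      (t * (a₁ ^ 2 + a₂ ^ 2) - (a₁ + a₂) ^ 2 / 2)| ≤ 3 * (1 / 2 ^ m.k))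
    (hv : verdict m a = none) : |t * (a₁ ^ 2 + a₂ ^ 2) - (a₁ + a₂) ^ 2 / 2| ≤ 7 / 2 ^ m.k := by
  have h4 : (4 : ℝ) / 2 ^ m.k = 4 * (1 / 2 ^ m.k) := by ring
  have h7 : (7 : ℝ) / 2 ^ m.k = 7 * (1 / 2 ^ m.k) := by ring
  simp only [verdict] at hv
  split_ifs at hv with h1 h2
  have := abs_le.1 h
  rw [abs_le]
  constructor <;> linarith

end Verdict

section BernVerdict

variable {m : Memory} {p t : ℝ}

/-- The thresholds are asymmetric because the digits approximate t from below: here one unit covers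
the unseen digits of t and one the error of the parameter, while for the opposite verdict only the
second is needed. -/
theorem bernVerdict_true (hp : |m.p - p| ≤ 1 / 2 ^ m.k) (hlen : m.u.len = m.k)
    (ht : t ∈ Set.Ico m.u.val (m.u.val + 1 / 2 ^ m.u.len)) (hv : bernVerdict m = some true) :
    t < p := by
  have h2 : (2 : ℝ) / 2 ^ m.k = 2 * (1 / 2 ^ m.k) := by ring
  rw [hlen] at ht
  simp only [bernVerdict] at hv
  split_ifs at hv with h1 h3
  · linarith [(abs_le.1 hp).2, ht.2]
  · simp at hv

theorem bernVerdict_false (hp : |m.p - p| ≤ 1 / 2 ^ m.k)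
    (ht : t ∈ Set.Ico m.u.val (m.u.val + 1 / 2 ^ m.u.len)) (hv : bernVerdict m = some false) :
    ¬ t < p := by
  simp only [bernVerdict] at hv
  split_ifs at hv with h1 h3
  · simp at hv
  · linarith [(abs_le.1 hp).1, ht.1]

theorem bernVerdict_none (hp : |m.p - p| ≤ 1 / 2 ^ m.k) (hlen : m.u.len = m.k)
    (ht : t ∈ Set.Ico m.u.val (m.u.val + 1 / 2 ^ m.u.len)) (hv : bernVerdict m = none) :
    |t - p| ≤ 3 / 2 ^ m.k := by
  have h2 : (2 : ℝ) / 2 ^ m.k = 2 * (1 / 2 ^ m.k) := by ring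
  have h3 : (3 : ℝ) / 2 ^ m.k = 3 * (1 / 2 ^ m.k) := by ring
  rw [hlen] at ht
  simp only [bernVerdict] at hv
  split_ifs at hv with h4 h5
  have := abs_le.1 hp
  have := ht.1
  have := ht.2
  rw [abs_le]
  constructor <;> linarith

end BernVerdict

end

end GHZ

/-! ### Reachable configurations -/

namespace GHZ

noncomputable section

variable {n : ℕ} [NeZero n] {M : Fin n → Measurement} {tree : Bool} {k₀ : ℕ} {s : Fin n → Memory}

/-! ### Invariants of the runs -/

/-- The partial products after `i` exchanges of the inner loop are accurate. -/
def Close (tree : Bool) (i : ℕ) (s : Fin n → Memory) : Prop :=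
  if tree then
    BlockNear (prec n (s 0).k) i (fun j => (s j).c) (fun j => (partials n i (s j)).1) ∧
      BlockNear (prec n (s 0).k) i (fun j => (s j).s) (fun j => (partials n i (s j)).2)
  else i = 0 ∨
    (|(partials n i (s 0)).1| ≤ 1 ∧
      |(partials n i (s 0)).1 - ∏ j, (s j).c| ≤ n / 2 ^ prec n (s 0).k) ∧
    (|(partials n i (s 0)).2| ≤ 1 ∧
      |(partials n i (s 0)).2 - ∏ j, (s j).s| ≤ n / 2 ^ prec n (s 0).k)

/-- What holds in a given phase. -/
def Stage (M : Fin n → Measurement) (tree : Bool) (s : Fin n → Memory) : Phase → Prop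
  | .bern => (s 0).u.Valid ∧ (s 0).u.len ≤ (s 0).k
  | .bernSync => (s 0).u.Valid ∧ (s 0).u.len = (s 0).k ∧
      |(s 0).p - bernParam M| ≤ 1 / 2 ^ (s 0).k
  | .start => True
  | .work i => (s 0).u.Valid ∧ (s 0).u.len ≤ (s 0).k ∧ i ≤ depth tree n ∧
      (0 < i → (∀ j, (s j).Decided) ∧ (s 0).u.len = (s 0).k ∧ Close tree i s)
  | .done => True

/-- What holds in all reachable configurations. -/
structure Invariant (M : Fin n → Measurement) (tree : Bool) (s : Fin n → Memory) : Prop where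
  θ_eq : ∀ j, (s j).θ = (M j).θ
  φ_eq : ∀ j, (s j).φ = (M j).φ
  flip_eq : ∀ j, j ≠ 0 → (s j).flip = false
  phase_eq : ∀ j, (s j).phase = (s 0).phase
  k_eq : ∀ j, (s j).k = (s 0).k
  stage : Stage M tree s (s 0).phase

theorem halted_iff (s : Fin n → Memory) :
    (protocol n tree k₀).Halted s ↔ ∀ j, (s j).phase = .done := by
  refine forall_congr' fun j => ?_
  change (outMem (s j)).isSome = true ↔ _
  unfold outMem
  cases (s j).phase <;> simp

theorem Invariant.halted_iff (h : Invariant M tree s) :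
    (protocol n tree k₀).Halted s ↔ (s 0).phase = .done := by
  rw [GHZ.halted_iff]
  exact ⟨fun h' => h' 0, fun h' j => (h.phase_eq j).trans h'⟩

/-- The memory of a party after a coin toss with outcome `b`. -/
def tossed (j : Fin n) (m : Memory) (b : Bool) : Memory :=
  match tossMem j m with
  | some f => f b
  | none => m

theorem afterToss_eq (s : Fin n → Memory) (b : Fin n → Bool) :
    (protocol n tree k₀).afterToss s b = fun j => tossed j (s j) (b j) := by
  funext j
  unfold tossed Protocol.afterToss
  rcases h : tossMem j (s j) with _ | f
  · have h' : (protocol n tree k₀).toss j (s j) = none := h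
    rw [h']
  · have h' : (protocol n tree k₀).toss j (s j) = some f := h
    rw [h']

/-- The configuration after an exchange of messages. -/
def exchanged (tree : Bool) (k₀ : ℕ) (s : Fin n → Memory) : Fin n → Memory := fun j =>
  recvMem tree k₀ j (s j) fun i => sendMem tree i (s i) j

theorem afterExchange_eq (s : Fin n → Memory) :
    (protocol n tree k₀).afterExchange s = exchanged tree k₀ s := rfl

section Tossed

variable (j : Fin n) (m : Memory) (b : Bool)

theorem tossed_eq :
    (tossed j m b).θ = m.θ ∧ (tossed j m b).φ = m.φ ∧ (tossed j m b).phase = m.phase ∧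
      (tossed j m b).k = m.k ∧ (tossed j m b).p = m.p ∧ (tossed j m b).flip = m.flip := by
  unfold tossed tossMem
  cases h : m.phase <;> simp only [h] <;> (try split_ifs) <;> simp [h]

theorem tossed_bern (h : m.phase = .bern) :
    (tossed j m b).u = if j = 0 ∧ m.u.len < m.k then m.u.push b else m.u := by
  unfold tossed tossMem
  simp only [h]
  split_ifs <;> rfl

theorem tossed_start (h : m.phase = .start) :
    tossed j m b = if j = 0 ∧ m.u.len < 1 then { m with u := m.u.push b, S := b } else m := by
  unfold tossed tossMem
  simp only [h]
  split_ifs <;> rfl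

theorem tossed_bernSync (h : m.phase = .bernSync) : tossed j m b = m := by
  unfold tossed tossMem
  simp only [h]

open Classical in
theorem tossed_work {i : ℕ} (h : m.phase = .work i) :
    tossed j m b = if ¬ m.Decided then { m with v := m.v.push b }
      else if j = 0 ∧ m.u.len < m.k then { m with u := m.u.push b } else m := by
  unfold tossed tossMem
  simp only [h]
  split_ifs <;> rfl

end Tossed

theorem not_tossing_bern (hph : (s 0).phase = .bern) (h : ¬ (protocol n tree k₀).Tossing s) :
    (s 0).k ≤ (s 0).u.len := by
  by_contra hlt
  exact h ⟨0, by
    change (tossMem 0 (s 0)).isSome = true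
    simp [tossMem, hph, not_le.1 hlt]⟩

theorem not_tossing_start (hph : (s 0).phase = .start) (h : ¬ (protocol n tree k₀).Tossing s) :
    1 ≤ (s 0).u.len := by
  by_contra hlt
  exact h ⟨0, by
    change (tossMem 0 (s 0)).isSome = true
    simp only [tossMem, hph]
    rw [if_pos ⟨trivial, not_le.1 hlt⟩]
    rfl⟩

theorem Invariant.not_tossing_work (hs : Invariant M tree s) {i : ℕ} (hph : (s 0).phase = .work i)
    (h : ¬ (protocol n tree k₀).Tossing s) : (∀ j, (s j).Decided) ∧ (s 0).k ≤ (s 0).u.len := by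
  have hd : ∀ j, (s j).Decided := by
    intro j
    by_contra hlt
    exact h ⟨j, by
      change (tossMem j (s j)).isSome = true
      simp [tossMem, hs.phase_eq j, hph, hlt]⟩
  refine ⟨hd, ?_⟩
  by_contra hlt
  exact h ⟨0, by
    change (tossMem 0 (s 0)).isSome = true
    simp [tossMem, hph, hd 0, not_le.1 hlt]⟩

/-- Once the first exchange of a passage has taken place, every local sample is decided and the
leader has his k digits, so no coin can disturb partial products already computed. -/
theorem Invariant.tossing_work (hs : Invariant M tree s) {i : ℕ} (hph : (s 0).phase = .work i)
    (h : (protocol n tree k₀).Tossing s) : i = 0 := by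
  by_contra hi
  have hst := hs.stage
  rw [hph] at hst
  obtain ⟨hd, hl, -⟩ := hst.2.2.2 (Nat.pos_of_ne_zero hi)
  obtain ⟨j, hj⟩ := h
  change (tossMem j (s j)).isSome = true at hj
  simp only [tossMem, hs.phase_eq j, hph, hd j, not_true_eq_false, if_false] at hj
  by_cases hj0 : j = 0
  · subst hj0
    simp [hl] at hj
  · simp [hj0] at hj

theorem Invariant.afterToss (hs : Invariant M tree s) (b : Fin n → Bool)
    (ht : (protocol n tree k₀).Tossing s) :
    Invariant M tree (fun j => tossed j (s j) (b j)) := by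
  have e := fun j => tossed_eq j (s j) (b j)
  constructor
  · exact fun j => (e j).1.trans (hs.θ_eq j)
  · exact fun j => (e j).2.1.trans (hs.φ_eq j)
  · exact fun j hj => (e j).2.2.2.2.2.trans (hs.flip_eq j hj)
  · exact fun j => (e j).2.2.1.trans ((hs.phase_eq j).trans (e 0).2.2.1.symm)
  · exact fun j => (e j).2.2.2.1.trans ((hs.k_eq j).trans (e 0).2.2.2.1.symm)
  · have hst := hs.stage
    have hk := (e 0).2.2.2.1
    simp only [(e 0).2.2.1]
    cases hph : (s 0).phase with
    | bern =>
      rw [hph] at hst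
      simp only [Stage, hk, tossed_bern _ _ _ hph] at hst ⊢
      split_ifs with h
      · exact ⟨hst.1.push _, h.2⟩
      · exact hst
    | bernSync =>
      rw [hph] at hst
      simpa only [Stage, tossed_bernSync _ _ _ hph] using hst
    | start => trivial
    | done => trivial
    | work i =>
      obtain rfl := hs.tossing_work hph ht
      rw [hph] at hst
      refine ⟨?_, ?_, hst.2.2.1, fun h => absurd h (lt_irrefl _)⟩ <;>
        simp only [tossed_work _ _ _ hph] <;> split_ifs with h h'
      · exact hst.1.push _
      · exact hst.1
      · exact hst.1
      · exact h'.2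
      · exact hst.2.1
      · exact hst.2.1

/-! ### Effect of an exchange -/

/-- All parties overwrite `p`, but only the leader's value is ever used; for the others it may stay
unspecified. -/
theorem exchanged_bern (hph : (s 0).phase = .bern) (hs : Invariant M tree s) (j : Fin n) :
    ∃ p : ℝ, exchanged tree k₀ s j = { s j with phase := .bernSync, p := p } := by
  simp only [exchanged, recvMem, hs.phase_eq j, hph]
  exact ⟨_, rfl⟩

theorem angle_code_lt (P : ℕ) (M : Measurement) : ⌊M.θ / 2 * 2 ^ P⌋₊ < 2 ^ (P + 3) := by
  rw [Nat.floor_lt (mul_nonneg (div_nonneg M.θ_mem.1 (by norm_num)) (by positivity))]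
  push_cast
  rw [pow_add, mul_comm]
  have h := M.θ_mem.2
  have h4 := Real.pi_lt_four
  exact mul_lt_mul_of_pos_left (by norm_num; linarith) (by positivity)

/-- The leader knows his own angle exactly and each other half angle up to 2^(-k)/2^⌈log₂ n⌉. Fewer
than n + 1 such errors stay below 2^(-k), and cos² is 1-Lipschitz. -/
theorem exchanged_bern_p (hph : (s 0).phase = .bern) (hs : Invariant M tree s) :
    |(exchanged tree k₀ s 0).p - bernParam M| ≤ 1 / 2 ^ (s 0).k := by
  set P := bernPrec n (s 0).k with hP
  have hdec : ∀ j : Fin n, j ≠ 0 → (decodeNat (sendMem tree j (s j) 0) : ℝ) =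
      (⌊(M j).θ / 2 * 2 ^ P⌋₊ : ℝ) := by
    intro j hj
    have : sendMem tree j (s j) 0 = encodeNat (P + 3) ⌊(M j).θ / 2 * 2 ^ P⌋₊ := by
      simp [sendMem, hs.phase_eq j, hph, hj, hs.k_eq j, hs.θ_eq j, hP]
    rw [this, decodeNat_encodeNat (angle_code_lt P (M j))]
  have hp : (exchanged tree k₀ s 0).p = Real.cos (∑ j, if j = 0 then
      (M j).θ / 2 else (⌊(M j).θ / 2 * 2 ^ P⌋₊ : ℝ) / 2 ^ P) ^ 2 := by
    unfold exchanged
    simp only [recvMem, hph, ← hP]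
    congr 2
    rw [hs.θ_eq, ← Finset.add_sum_erase Finset.univ _ (Finset.mem_univ (0 : Fin n)),
      ← Finset.add_sum_erase Finset.univ _ (Finset.mem_univ (0 : Fin n))]
    simp only [if_true, zero_add]
    congr 1
    refine Finset.sum_congr rfl fun j hj => ?_
    have hj := Finset.ne_of_mem_erase hj
    simp only [if_neg hj, hdec j hj]
  rw [hp, bernParam, halfAngle]
  refine (abs_cos_sq_sub_cos_sq_le _ _).trans ?_
  rw [← Finset.sum_sub_distrib]
  refine (Finset.abs_sum_le_sum_abs _ _).trans ?_
  refine (Finset.sum_le_card_nsmul _ _ (1 / 2 ^ P : ℝ) ?_).trans ?_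
  · intro j _
    have hPp : (0 : ℝ) < 2 ^ P := by positivity
    split_ifs with h
    · simp
    · have h0 : 0 ≤ (M j).θ / 2 * 2 ^ P :=
        mul_nonneg (div_nonneg (M j).θ_mem.1 (by norm_num)) hPp.le
      have h1 := Nat.floor_le h0
      have h2 := Nat.lt_floor_add_one ((M j).θ / 2 * 2 ^ P)
      have : (⌊(M j).θ / 2 * 2 ^ P⌋₊ : ℝ) / 2 ^ P - (M j).θ / 2 =
          (⌊(M j).θ / 2 * 2 ^ P⌋₊ - (M j).θ / 2 * 2 ^ P) / 2 ^ P := by field_simp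
      rw [this, abs_div, abs_of_pos hPp]
      gcongr
      rw [abs_le]
      constructor <;> linarith
  · have hn : (n : ℝ) ≤ 2 ^ Nat.clog 2 n := by
      exact_mod_cast Nat.le_pow_clog (b := 2) (by norm_num) n
    rw [Finset.card_univ, Fintype.card_fin, nsmul_eq_mul, hP, bernPrec, pow_add, mul_one_div,
      div_le_div_iff₀ (by positivity) (by positivity)]
    have : (0 : ℝ) < 2 ^ (s 0).k := by positivity
    nlinarith

theorem exchanged_bernSync (hph : (s 0).phase = .bernSync) (hs : Invariant M tree s)
    (j : Fin n) : exchanged tree k₀ s j =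
      match bernVerdict (s 0) with
      | some B => { (s j).restart with flip := if j = 0 then !B else (s j).flip }
      | none => { s j with phase := .bern, k := (s j).k + 1 } := by
  unfold exchanged
  by_cases hj : j = 0
  · subst hj
    cases hv : bernVerdict (s 0) <;> simp [recvMem, hph, hv]
  · have : sendMem tree 0 (s 0) j = [(bernVerdict (s 0)).isSome] := by
      simp [sendMem, hph, hj]
    simp only [recvMem, hs.phase_eq j, hph, if_neg hj, this]
    cases bernVerdict (s 0) <;> simp [Memory.restart]

theorem exchanged_start (hph : (s 0).phase = .start) (hs : Invariant M tree s)
    (j : Fin n) : exchanged tree k₀ s j =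
      { s j with phase := .work 0, k := k₀, u := .empty, S := (s 0).S, v := .empty } := by
  unfold exchanged
  by_cases hj : j = 0
  · subst hj
    simp [recvMem, hph]
  · have : sendMem tree 0 (s 0) j = [(s 0).S] := by
      simp [sendMem, hph, hj]
    simp [recvMem, hs.phase_eq j, hph, hj, this]

theorem exchanged_work {i : ℕ} (hph : (s 0).phase = .work i) (hs : Invariant M tree s)
    (hi : i < depth tree n) (j : Fin n) : exchanged tree k₀ s j =
      { s j with
        phase := .work (i + 1)
        acc := combine tree i j (s j) fun r => sendMem tree r (s r) j } := by
  unfold exchanged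
  simp only [recvMem, hs.phase_eq j, hph, if_pos hi]

theorem exchanged_verdict (hph : (s 0).phase = .work (depth tree n))
    (hs : Invariant M tree s) (j : Fin n) : exchanged tree k₀ s j =
      conclude (s j) (verdict (s 0) (partials n (depth tree n) (s 0))) := by
  unfold exchanged
  by_cases hj : j = 0
  · subst hj
    simp [recvMem, hph]
  · have : sendMem tree 0 (s 0) j =
        encodeVerdict (verdict (s 0) (partials n (depth tree n) (s 0))) := by
      simp [sendMem, hph, hj]
    simp [recvMem, hs.phase_eq j, hph, hj, this, decodeVerdict_encodeVerdict]

/-! ### Accuracy of the products -/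

theorem Memory.abs_c_le_one (m : Memory) : |m.c| ≤ 1 := Real.abs_cos_le_one _

theorem Memory.abs_s_le_one (m : Memory) : |m.s| ≤ 1 := by
  rw [Memory.s, abs_mul, abs_neg]
  have h := Real.abs_sin_le_one ((m.φ - Real.pi / 2 * ((m.outcome : ℤ) : ℝ)) / 2)
  split_ifs <;> simpa using h

theorem close_zero (hs : Invariant M tree s) : Close tree 0 s := by
  unfold Close
  split_ifs with h
  · have h1 := blockNear_zero (prec n (s 0).k) fun j => (s j).abs_c_le_one
    have h2 := blockNear_zero (prec n (s 0).k) fun j => (s j).abs_s_le_one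
    simp only [partials, if_true, hs.k_eq]
    exact ⟨h1, h2⟩
  · exact Or.inl rfl

theorem Invariant.close (hs : Invariant M tree s) {i : ℕ} (hph : (s 0).phase = .work i) :
    Close tree i s := by
  rcases Nat.eq_zero_or_pos i with rfl | hi
  · exact close_zero hs
  · have := hs.stage
    rw [hph] at this
    exact (this.2.2.2 hi).2.2

/-- The message is decoded without loss because accuracy of the sender's block includes being dyadic
and bounded by 1. -/
theorem combine_tree {i : ℕ} (hph : (s 0).phase = .work i) (hs : Invariant M true s)
    (hi : i < depth true n) (j : Fin n) (hj : 2 ^ (i + 1) ∣ j.val) (h : j.val + 2 ^ i < n) :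
    combine true i j (s j) (fun r => sendMem true r (s r) j) =
      (trunc (prec n (s 0).k) ((partials n i (s j)).1 *
        (partials n i (s ⟨j.val + 2 ^ i, h⟩)).1),
       trunc (prec n (s 0).k) ((partials n i (s j)).2 *
        (partials n i (s ⟨j.val + 2 ^ i, h⟩)).2)) := by
  have hc := hs.close hph
  simp only [Close, if_true] at hc
  set r : Fin n := ⟨j.val + 2 ^ i, h⟩ with hr
  have hrd : 2 ^ i ∣ r.val :=
    ((pow_dvd_pow 2 (Nat.le_succ i)).trans hj).add (dvd_refl _)
  have hsend : sendMem true r (s r) j = encodePair (prec n (s 0).k) (partials n i (s r)) := by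
    have hst : sendsTo true i r j = true := by
      obtain ⟨q, hq⟩ := hj
      have hlt : 2 ^ i < 2 ^ (i + 1) := Nat.pow_lt_pow_right (by norm_num) (Nat.lt_succ_self i)
      simp only [sendsTo, if_true, decide_eq_true_eq, hr, and_true]
      rw [hq, Nat.mul_add_mod, Nat.mod_eq_of_lt hlt]
    simp [sendMem, hs.phase_eq r, hph, hi, hst, hs.k_eq r]
  have h1 := hc.1 r hrd
  have h2 := hc.2 r hrd
  have hd := decodePair_encodePair h1.dyadic h1.abs_le_one h2.dyadic h2.abs_le_one
  simp only [combine, if_true, hs.k_eq j]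
  rw [dif_pos ⟨Nat.mod_eq_zero_of_dvd hj, h⟩, ← hr, hsend, hd]

theorem combine_tree_keep {n i : ℕ} (j : Fin n) (m : Memory) (w : Fin n → List Bool)
    (h : n ≤ j.val + 2 ^ i) : combine true i j m w = partials n i m := by
  simp only [combine, if_true]
  rw [dif_neg (fun h' => absurd h'.2 (not_lt.2 h))]

theorem combine_star (hph : (s 0).phase = .work 0) (hs : Invariant M false s) :
    combine false 0 0 (s 0) (fun r => sendMem false r (s r) 0) =
      (∏ j, trunc (prec n (s 0).k) (s j).c, ∏ j, trunc (prec n (s 0).k) (s j).s) := by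
  have hsend : ∀ j : Fin n, j ≠ 0 →
      decodePair (prec n (s 0).k) (sendMem false j (s j) 0) =
        (trunc (prec n (s 0).k) (s j).c, trunc (prec n (s 0).k) (s j).s) := by
    intro j hj
    have : sendMem false j (s j) 0 = encodePair (prec n (s 0).k)
        (trunc (prec n (s 0).k) (s j).c, trunc (prec n (s 0).k) (s j).s) := by
      simp [sendMem, hs.phase_eq j, hph, hs.k_eq j, depth, sendsTo, partials, hj]
    rw [this, decodePair_encodePair (dyadic_trunc _ _) (abs_trunc_le_one _ (s j).abs_c_le_one)
      (dyadic_trunc _ _) (abs_trunc_le_one _ (s j).abs_s_le_one)]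
  have e : ∀ j : Fin n, (j.val = 0) ↔ j = 0 := fun j => by rw [Fin.ext_iff]; rfl
  simp only [combine, Bool.false_eq_true, if_false, Fin.val_zero, if_true, partials, e]
  congr 1
  · rw [← Finset.mul_prod_erase Finset.univ _ (Finset.mem_univ (0 : Fin n)),
      ← Finset.mul_prod_erase Finset.univ (fun j => trunc _ (s j).c) (Finset.mem_univ (0 : Fin n))]
    simp only [if_true, one_mul]
    congr 1
    refine Finset.prod_congr rfl fun j hj => ?_
    have hj := Finset.ne_of_mem_erase hj
    rw [if_neg hj, hsend j hj]
  · rw [← Finset.mul_prod_erase Finset.univ _ (Finset.mem_univ (0 : Fin n)),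
      ← Finset.mul_prod_erase Finset.univ (fun j => trunc _ (s j).s) (Finset.mem_univ (0 : Fin n))]
    simp only [if_true, one_mul]
    congr 1
    refine Finset.prod_congr rfl fun j hj => ?_
    have hj := Finset.ne_of_mem_erase hj
    rw [if_neg hj, hsend j hj]

theorem Invariant.close_succ {i : ℕ} (hph : (s 0).phase = .work i) (hs : Invariant M tree s)
    (hi : i < depth tree n) : Close tree (i + 1) (exchanged tree k₀ s) := by
  have hs' : exchanged tree k₀ s = fun j => { s j with
        phase := .work (i + 1)
        acc := combine tree i j (s j) fun r => sendMem tree r (s r) j } :=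
    funext fun j => exchanged_work hph hs hi j
  rw [hs']
  cases tree with
  | true =>
    have hc := hs.close hph
    simp only [Close, if_true] at hc ⊢
    constructor
    · refine blockNear_succ hc.1 (fun j hj h => ?_) (fun j h => ?_)
      · simp only [partials, Nat.succ_ne_zero, if_false]
        rw [combine_tree hph hs hi j hj h]
        rfl
      · simp only [partials, Nat.succ_ne_zero, if_false]
        rw [combine_tree_keep j _ _ h]
        rfl
    · refine blockNear_succ hc.2 (fun j hj h => ?_) (fun j h => ?_)
      · simp only [partials, Nat.succ_ne_zero, if_false]
        rw [combine_tree hph hs hi j hj h]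
        rfl
      · simp only [partials, Nat.succ_ne_zero, if_false]
        rw [combine_tree_keep j _ _ h]
        rfl
  | false =>
    obtain rfl : i = 0 := by simpa [depth] using hi
    simp only [Close, Bool.false_eq_true, if_false]
    right
    simp only [partials, Nat.succ_ne_zero, if_false]
    rw [combine_star hph hs]
    -- Here the leader does not truncate the product, so the error is one unit per factor.
    have key : ∀ f : Fin n → ℝ, (∀ j, |f j| ≤ 1) →
        |∏ j, trunc (prec n (s 0).k) (f j)| ≤ 1 ∧
          |∏ j, trunc (prec n (s 0).k) (f j) - ∏ j, f j| ≤ n / 2 ^ prec n (s 0).k := by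
      intro f hf
      refine ⟨abs_prod_le_one _ fun j _ => abs_trunc_le_one _ (hf j), ?_⟩
      have := abs_prod_sub_prod_le Finset.univ (fun j _ => abs_trunc_le_one (prec n (s 0).k) (hf j))
        (fun j _ => hf j) (fun j _ => abs_trunc_sub_le (prec n (s 0).k) (f j))
      rw [Finset.card_univ, Fintype.card_fin, mul_one_div] at this
      exact this
    exact ⟨key _ fun j => (s j).abs_c_le_one, key _ fun j => (s j).abs_s_le_one⟩

/-- This is what the three extra bits are for: ⌈log₂ n⌉ bits absorb n, one absorbs the factor 2, and
two yield the quarter required by `abs_discriminant_sub_le`. -/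
theorem two_mul_div_prec_le (n k : ℕ) : 2 * (n : ℝ) / 2 ^ prec n k ≤ 1 / 2 ^ k / 4 := by
  have hn : (n : ℝ) ≤ 2 ^ Nat.clog 2 n := by
    exact_mod_cast Nat.le_pow_clog (b := 2) (by norm_num) n
  rw [prec, pow_add, pow_add, div_div, div_le_div_iff₀ (by positivity) (by positivity)]
  have : (0 : ℝ) < 2 ^ k := by positivity
  nlinarith

/-- When the leader decides, his approximations of the products are accurate. -/
theorem Close.final (hs : Close tree (depth tree n) s) :
    (|(partials n (depth tree n) (s 0)).1| ≤ 1 ∧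
      |(partials n (depth tree n) (s 0)).1 - ∏ j, (s j).c| ≤ 1 / 2 ^ (s 0).k / 4) ∧
    (|(partials n (depth tree n) (s 0)).2| ≤ 1 ∧
      |(partials n (depth tree n) (s 0)).2 - ∏ j, (s j).s| ≤ 1 / 2 ^ (s 0).k / 4) := by
  have h2 := two_mul_div_prec_le n (s 0).k
  cases tree with
  | true =>
    simp only [Close, if_true, depth] at hs ⊢
    have key : ∀ {f a : Fin n → ℝ}, BlockNear (prec n (s 0).k) (Nat.clog 2 n) f a →
        |a 0| ≤ 1 ∧ |a 0 - ∏ j, f j| ≤ 1 / 2 ^ (s 0).k / 4 := by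
      intro f a h
      refine ⟨h.top.abs_le_one, h.top.err.trans (le_trans ?_ h2)⟩
      gcongr
      linarith
    exact ⟨key hs.1, key hs.2⟩
  | false =>
    simp only [Close, Bool.false_eq_true, if_false, depth, one_ne_zero, false_or] at hs ⊢
    have h3 : (n : ℝ) / 2 ^ prec n (s 0).k ≤ 1 / 2 ^ (s 0).k / 4 := by
      refine le_trans ?_ h2
      gcongr
      linarith [(Nat.cast_nonneg n : (0 : ℝ) ≤ n)]
    exact ⟨⟨hs.1.1, hs.1.2.trans h3⟩, ⟨hs.2.1, hs.2.2.trans h3⟩⟩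

theorem Invariant.afterExchange (hs : Invariant M tree s)
    (he : (protocol n tree k₀).Exchanging s) :
    Invariant M tree (exchanged tree k₀ s) := by
  have hst := hs.stage
  cases hph : (s 0).phase with
  | bern =>
    rw [hph] at hst
    choose p hp using exchanged_bern (k₀ := k₀) hph hs
    refine ⟨?_, ?_, ?_, ?_, ?_, ?_⟩
    · intro j; rw [hp]; exact hs.θ_eq j
    · intro j; rw [hp]; exact hs.φ_eq j
    · intro j hj; rw [hp]; exact hs.flip_eq j hj
    · intro j; rw [hp, hp]
    · intro j; rw [hp, hp]; exact hs.k_eq j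
    · have := exchanged_bern_p (k₀ := k₀) hph hs
      rw [hp] at this ⊢
      refine ⟨?_, ?_, ?_⟩ <;> rw [hp]
      · exact hst.1
      · exact le_antisymm hst.2 (not_tossing_bern hph he.2)
      · exact this
  | bernSync =>
    rw [hph] at hst
    have hp := exchanged_bernSync (k₀ := k₀) hph hs
    cases hv : bernVerdict (s 0) with
    | none =>
      simp only [hv] at hp
      refine ⟨?_, ?_, ?_, ?_, ?_, ?_⟩
      · intro j; rw [hp]; exact hs.θ_eq j
      · intro j; rw [hp]; exact hs.φ_eq j
      · intro j hj; rw [hp]; exact hs.flip_eq j hj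
      · intro j; rw [hp, hp]
      · intro j; rw [hp, hp]; exact congrArg (· + 1) (hs.k_eq j)
      · rw [hp]
        refine ⟨?_, ?_⟩ <;> rw [hp]
        · exact hst.1
        · exact hst.2.1.le.trans (Nat.le_succ _)
    | some B =>
      simp only [hv] at hp
      refine ⟨?_, ?_, ?_, ?_, ?_, ?_⟩
      · intro j; rw [hp]; exact hs.θ_eq j
      · intro j; rw [hp]; exact hs.φ_eq j
      · intro j hj; rw [hp]; simpa only [if_neg hj] using hs.flip_eq j hj
      · intro j; rw [hp, hp]; rfl
      · intro j; rw [hp, hp]; exact hs.k_eq j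
      · rw [hp]; trivial
  | start =>
    have hp := exchanged_start (k₀ := k₀) hph hs
    refine ⟨?_, ?_, ?_, ?_, ?_, ?_⟩
    · intro j; rw [hp]; exact hs.θ_eq j
    · intro j; rw [hp]; exact hs.φ_eq j
    · intro j hj; rw [hp]; exact hs.flip_eq j hj
    · intro j; rw [hp, hp]
    · intro j; rw [hp, hp]
    · rw [hp]
      refine ⟨?_, ?_, Nat.zero_le _, fun h => absurd h (lt_irrefl _)⟩ <;> rw [hp]
      · exact Uniform.valid_empty
      · exact Nat.zero_le _
  | done => exact absurd (hs.halted_iff.2 hph) he.1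
  | work i =>
    rw [hph] at hst
    obtain ⟨hd, hl⟩ := hs.not_tossing_work hph he.2
    have hl := le_antisymm hst.2.1 hl
    rcases hst.2.2.1.lt_or_eq with hi | rfl
    · have hp := exchanged_work (k₀ := k₀) hph hs hi
      refine ⟨?_, ?_, ?_, ?_, ?_, ?_⟩
      · intro j; rw [hp]; exact hs.θ_eq j
      · intro j; rw [hp]; exact hs.φ_eq j
      · intro j hj; rw [hp]; exact hs.flip_eq j hj
      · intro j; rw [hp, hp]
      · intro j; rw [hp, hp]; exact hs.k_eq j
      · have hc := hs.close_succ (k₀ := k₀) hph hi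
        rw [hp]
        refine ⟨?_, ?_, hi, fun _ => ⟨fun j => ?_, ?_, hc⟩⟩ <;> rw [hp]
        · exact hst.1
        · exact hst.2.1
        · exact hd j
        · exact hl
    · have hp := exchanged_verdict (k₀ := k₀) hph hs
      generalize verdict (s 0) (partials n (depth tree n) (s 0)) = y at hp
      have e : ∀ m : Memory, (conclude m y).θ = m.θ ∧ (conclude m y).φ = m.φ ∧
          (conclude m y).flip = m.flip := by
        intro m
        rcases y with _ | _ | _ <;> simp [conclude, Memory.restart]
      refine ⟨?_, ?_, ?_, ?_, ?_, ?_⟩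
      · intro j; rw [hp, (e _).1]; exact hs.θ_eq j
      · intro j; rw [hp, (e _).2.1]; exact hs.φ_eq j
      · intro j hj; rw [hp, (e _).2.2]; exact hs.flip_eq j hj
      · intro j; rw [hp, hp]; rcases y with _ | _ | _ <;> rfl
      · intro j; rw [hp, hp]
        rcases y with _ | _ | _
        · exact congrArg (2 * ·) (hs.k_eq j)
        · exact hs.k_eq j
        · exact hs.k_eq j
      · rw [hp]
        rcases y with _ | _ | _
        · refine ⟨?_, ?_, Nat.zero_le _, fun h => absurd h (lt_irrefl _)⟩ <;> rw [hp]
          · exact hst.1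
          · change (s 0).u.len ≤ 2 * (s 0).k
            omega
        · trivial
        · trivial

theorem invariant_init (M : Fin n → Measurement) :
    Invariant M tree fun j => (protocol n tree k₀).init j (M j) := by
  refine ⟨fun j => rfl, fun j => rfl, fun j _ => rfl, fun j => rfl, fun j => rfl, ?_⟩
  exact ⟨Uniform.valid_empty, Nat.zero_le _⟩

/-- All reachable configurations satisfy the invariant. -/
theorem invariant_of_mem_support (M : Fin n → Measurement) (t : ℕ) (s : Fin n → Memory)
    (hs : s ∈ ((protocol n tree k₀).law M t).support) : Invariant M tree s :=
  (protocol n tree k₀).step_support_invariant (Inv := Invariant M tree)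
    (fun s b h _ ht =>
      (afterToss_eq (tree := tree) (k₀ := k₀) s b).symm ▸ h.afterToss b ht) (fun _ h he => h.afterExchange he)
    (invariant_init M) t s hs

end

end GHZ

/-! ### Construction of the potential -/

namespace GHZ

open MeasureTheory

noncomputable section

/-! ### Conditional likelihoods -/

open Classical in
/-- The value of `X_j` when the uniform number that serves to sample it is `t`. -/
def Measurement.outcomeAt (M : Measurement) (S : Bool) (t : ℝ) : ℤˣ :=
  (if S then -1 else 1) * (if t < M.bias then 1 else -1)

open Classical in
/-- The conditional probability of `X_j = y`, given the digits `v` and the bit `S`. -/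
def Measurement.likelihood (M : Measurement) (S : Bool) (v : Uniform) (y : ℤˣ) : ℝ≥0∞ :=
  avg v fun t => if M.outcomeAt S t = y then 1 else 0

/-- Decided means that the bias does not separate the dyadic interval, so all completions of the
digits give the same outcome. -/
theorem Measurement.likelihood_of_decided {M : Measurement} {m : Memory} (hφ : m.φ = M.φ)
    (h : m.Decided) (y : ℤˣ) :
    M.likelihood m.S m.v y = if m.outcome = y then 1 else 0 := by
  classical
  have hb : m.bias = M.bias := by rw [Memory.bias, Measurement.bias, hφ]
  have key : ∀ t ∈ Set.Ico m.v.val (m.v.val + 1 / 2 ^ m.v.len),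
      M.outcomeAt m.S t = m.outcome := by
    intro t ht
    have : t < M.bias ↔ m.v.val + 1 / 2 ^ m.v.len ≤ m.bias := by
      rw [hb]
      constructor
      · intro h1
        rcases h with h | h
        · rwa [hb] at h
        · rw [hb] at h
          exact absurd (h1.trans_le h) (not_lt.2 ht.1)
      · exact fun h1 => ht.2.trans_le h1
    simp only [Measurement.outcomeAt, Memory.outcome, this]
  rw [Measurement.likelihood]
  refine avg_eq_const fun t ht => ?_
  rw [key t ht]

theorem Measurement.likelihood_push (M : Measurement) (S : Bool) (v : Uniform) (y : ℤˣ) :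
    (M.likelihood S (v.push false) y + M.likelihood S (v.push true) y) / 2 =
      M.likelihood S v y :=
  avg_push v _

theorem Measurement.likelihood_empty (M : Measurement) (S : Bool) (y : ℤˣ) :
    M.likelihood S .empty y = ENNReal.ofReal (if S then M.s y ^ 2 else M.c y ^ 2) := by
  classical
  have h : ∀ a b : ℝ≥0∞, (∀ t : ℝ, (if M.outcomeAt S t = y then (1 : ℝ≥0∞) else 0) =
      if t < M.bias then a else b) → M.likelihood S .empty y =
        ENNReal.ofReal M.bias * a + ENNReal.ofReal (1 - M.bias) * b := by
    intro a b hab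
    rw [Measurement.likelihood, avg_empty]
    simp only [hab]
    exact lintegral_Ico_lt M.bias_nonneg M.bias_le_one a b
  rcases Int.units_eq_one_or y with rfl | rfl <;> cases S
  · rw [h 1 0 fun t => by by_cases ht : t < M.bias <;> simp [outcomeAt, ht]]
    simp [M.c_one_sq]
  · rw [h 0 1 fun t => by by_cases ht : t < M.bias <;> simp [outcomeAt, ht]]
    simp [M.s_one_sq]
  · rw [h 0 1 fun t => by by_cases ht : t < M.bias <;> simp [outcomeAt, ht]]
    simp [M.c_neg_one_sq]
  · rw [h 1 0 fun t => by by_cases ht : t < M.bias <;> simp [outcomeAt, ht]]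
    simp [M.s_neg_one_sq]

/-- The bias lies on one side of the midpoint, so the half on the other side is decided. Each toss
thus settles the sample with probability at least 1/2. -/
theorem Memory.decided_push {m : Memory} (h : ¬ m.Decided) :
    ({ m with v := m.v.push false } : Memory).Decided ∨
      ({ m with v := m.v.push true } : Memory).Decided := by
  have h' := not_or.1 h
  have h2 : (1 : ℝ) / 2 ^ m.v.len = 1 / 2 ^ (m.v.len + 1) + 1 / 2 ^ (m.v.len + 1) := by
    rw [pow_succ]; field_simp; norm_num
  rcases le_total m.bias (m.v.val + 1 / 2 ^ (m.v.len + 1)) with h1 | h1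
  · right; right
    simpa [Uniform.push, Memory.bias] using h1
  · left; left
    simpa [Uniform.push, Memory.bias] using h1

/-! ### The potential -/

/-- Prices of the random bits and of the exchanges in the various phases. -/
structure Tariff where
  coin : ℝ≥0∞
  bern : ℕ → ℝ≥0∞
  sync : ℝ≥0∞
  start : ℝ≥0∞
  work : ℕ → ℕ → ℝ≥0∞

namespace Tariff

variable (T : Tariff)

/-- The price of the next exchange, from the memory of the leader. -/
def price (m : Memory) : ℝ≥0∞ :=
  match m.phase with
  | .bern => T.bern m.k
  | .bernSync => T.sync
  | .start => T.start
  | .work i => T.work i m.k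
  | .done => 0

/-- The price of what is left of a passage through the inner loop after `i` exchanges, when the
products are computed in `d` exchanges. -/
def rest (d i k : ℕ) : ℝ≥0∞ := ∑ l ∈ Finset.Ico i (d + 1), T.work l k

/-- The price of a second passage through the inner loop, with precision `2 k`. -/
def again (d k : ℕ) : ℝ≥0∞ := T.rest d 0 (2 * k) + T.coin * k

/-- A bound for the expected price of one rejection round. -/
def round (d n k₀ : ℕ) : ℝ≥0∞ :=
  T.coin + (T.start + T.coin * (2 * n + k₀) + T.rest d 0 k₀) +
    ∑' i, T.again d (2 ^ i * k₀) * min 1 (2 ^ n * ENNReal.ofReal (7 / 2 ^ (2 ^ i * k₀)))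

end Tariff

variable {n : ℕ} (T : Tariff) (f : (Fin n → ℤˣ) → ℝ≥0∞) (M : Fin n → Measurement) (d k₀ : ℕ)

/-- The potential at the beginning of a rejection round. -/
def startValue (flip : Bool) : ℝ≥0∞ :=
  2 * T.round d n k₀ + ∑ y, ENNReal.ofReal (component M flip y) * f y

open Classical in
/-- The cost that is still to come after the present passage through the inner loop, if the vector
`y` has been proposed and the uniform number of the leader is `t`. -/
def loopValue (flip : Bool) (k : ℕ) (y : Fin n → ℤˣ) (t : ℝ) : ℝ≥0∞ :=
  (∑' i : ℕ, if |t * mass M y - component M flip y| ≤ 7 / 2 ^ (2 ^ i * k) then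
      T.again d (2 ^ i * k) else 0) +
    if t * mass M y < component M flip y then f y else startValue T f M d k₀ flip

open Classical in
/-- The cost that is still to come after the present attempt to sample the Bernoulli variable, if
the uniform number of the leader is `t`. -/
def bernValue (k : ℕ) (t : ℝ) : ℝ≥0∞ :=
  (∑' i : ℕ, if |t - bernParam M| ≤ 3 / 2 ^ (k + i) then
      T.coin + (T.bern (k + i + 1) + T.sync) else 0) +
    if t < bernParam M then startValue T f M d k₀ false else startValue T f M d k₀ true

/-- The potential after the bit `S` has been drawn. -/
def launchValue (S flip : Bool) : ℝ≥0∞ :=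
  (T.start + T.coin * (2 * n + k₀) + T.rest d 0 k₀) +
    ∑ y : Fin n → ℤˣ, (∏ j, (M j).likelihood S .empty (y j)) *
      avg .empty (loopValue T f M d k₀ flip k₀ y)

open Classical in
/-- A bound for the expected number of coins that a party still needs in the inner loop. -/
def pending [NeZero n] (j : Fin n) (m : Memory) : ℝ≥0∞ :=
  (if m.Decided then 0 else 2) + if j = 0 then ((m.k - m.u.len : ℕ) : ℝ≥0∞) else 0

open Classical in
/-- The contribution of a party to the potential in the inner loop. -/
def factor [NeZero n] (y : Fin n → ℤˣ) (j : Fin n) (m : Memory) : ℝ≥0∞ :=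
  (M j).likelihood m.S m.v (y j) *
    if j = 0 then avg m.u (loopValue T f M d k₀ m.flip m.k y) else 1

/-- The potential: a bound for the expected price of the rest of the run plus the expected
value of `f` at the final outputs. -/
def potential [NeZero n] (s : Fin n → Memory) : ℝ≥0∞ :=
  match (s 0).phase with
  | .bern => T.coin * ((s 0).k - (s 0).u.len : ℕ) + (T.bern (s 0).k + T.sync) +
      avg (s 0).u (bernValue T f M d k₀ (s 0).k)
  | .bernSync => T.sync + avg (s 0).u (bernValue T f M d k₀ (s 0).k)
  | .start => if (s 0).u.len < 1 then startValue T f M d k₀ (s 0).flip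
      else launchValue T f M d k₀ (s 0).S (s 0).flip
  | .work i => T.coin * ∑ j, pending j (s j) + T.rest d i (s 0).k +
      ∑ y, ∏ j, factor T f M d k₀ y j (s j)
  | .done => f fun j => (s j).outcome

variable {T f M d k₀}

/-- Peeling off the first term of the series and shifting the index replaces k by 2k. This
self-similarity lets the potential pay for another passage. -/
theorem loopValue_again {flip : Bool} {k : ℕ} {y : Fin n → ℤˣ} {t : ℝ}
    (h : |t * mass M y - component M flip y| ≤ 7 / 2 ^ k) :
    loopValue T f M d k₀ flip k y t =
      T.again d k + loopValue T f M d k₀ flip (2 * k) y t := by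
  classical
  unfold loopValue
  rw [tsum_eq_zero_add' ENNReal.summable, pow_zero, one_mul, if_pos h, add_assoc]
  congr 3
  funext i
  rw [pow_succ, mul_assoc]

theorem bernValue_again {k : ℕ} {t : ℝ} (h : |t - bernParam M| ≤ 3 / 2 ^ k) :
    bernValue T f M d k₀ k t =
      T.coin + (T.bern (k + 1) + T.sync) + bernValue T f M d k₀ (k + 1) t := by
  classical
  unfold bernValue
  rw [tsum_eq_zero_add' ENNReal.summable, add_zero, if_pos h, add_assoc]
  congr 3
  funext i
  rw [add_right_comm k 1 i, add_assoc k i 1]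

/-! ### The average cost of a rejection round -/

theorem half_add_half (a : ℝ≥0∞) : (a + a) / 2 = a := by
  rw [← mul_two]; exact ENNReal.mul_div_cancel_right (by simp) (by simp)

theorem avg_mul_right (a b c : ℝ≥0∞) : (a * c + b * c) / 2 = (a + b) / 2 * c := by
  rw [← add_mul, ENNReal.mul_div_right_comm]

theorem avg_mul_left (a b c : ℝ≥0∞) : (c * a + c * b) / 2 = c * ((a + b) / 2) := by
  rw [← mul_add, mul_div_assoc]

theorem half_add (a b c : ℝ≥0∞) : (c + a + (c + b)) / 2 = c + (a + b) / 2 := by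
  rw [add_add_add_comm, ENNReal.add_div, half_add_half]

/-- The law of the proposal: S = 0 gives ∏ c_j², S = 1 gives ∏ s_j². -/
theorem likelihood_average (y : Fin n → ℤˣ) :
    (∏ j, (M j).likelihood false .empty (y j) + ∏ j, (M j).likelihood true .empty (y j)) / 2 =
      ENNReal.ofReal (mass M y / 2) := by
  simp only [Measurement.likelihood_empty, Bool.false_eq_true, if_false, if_true]
  rw [← ENNReal.ofReal_prod_of_nonneg fun _ _ => sq_nonneg _,
    ← ENNReal.ofReal_prod_of_nonneg fun _ _ => sq_nonneg _, Finset.prod_pow, Finset.prod_pow,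
    ← ENNReal.ofReal_add (sq_nonneg _) (sq_nonneg _), ENNReal.ofReal_div_of_pos two_pos]
  simp [mass, ampC, ampS]

open Classical in
-- The set of bad t has length at most 2δ/mass, and the weight mass/2 cancels the denominator.
-- Unlikely proposals, whose verdicts are hard to reach, therefore cost no more than δ each.
theorem mass_mul_near_le (flip : Bool) (y : Fin n → ℤˣ) {δ : ℝ} (x : ℝ≥0∞) :
    ENNReal.ofReal (mass M y / 2) *
      ∫⁻ t in Set.Ico (0 : ℝ) 1, (if |t * mass M y - component M flip y| ≤ δ then x else 0) ≤
      x * min (ENNReal.ofReal (mass M y / 2)) (ENNReal.ofReal δ) := by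
  rcases (mass_nonneg M y).eq_or_lt with h0 | hpos
  · simp [← h0]
  have h : ∀ t : ℝ, |t * mass M y - component M flip y| ≤ δ ↔
      |t - component M flip y / mass M y| ≤ δ / mass M y := by
    intro t
    have : t - component M flip y / mass M y =
        (t * mass M y - component M flip y) / mass M y := by field_simp
    rw [this, abs_div, abs_of_pos hpos, div_le_div_iff_of_pos_right hpos]
  simp only [h]
  refine (mul_le_mul_right (lintegral_Ico_near_le _ _ x) _).trans ?_
  rw [mul_left_comm]
  gcongr
  rw [mul_min, mul_one, ← ENNReal.ofReal_mul (by positivity)]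
  gcongr
  apply le_of_eq
  field_simp

open Classical in
theorem mass_mul_lt_le (flip : Bool) (y : Fin n → ℤˣ) (a b : ℝ≥0∞) :
    ENNReal.ofReal (mass M y / 2) *
      ∫⁻ t in Set.Ico (0 : ℝ) 1, (if t * mass M y < component M flip y then a else b) ≤
      ENNReal.ofReal (component M flip y / 2) * a +
        ENNReal.ofReal ((mass M y - component M flip y) / 2) * b := by
  have hc0 := component_nonneg M flip y
  have hcm := component_le_mass M flip y
  rcases (mass_nonneg M y).eq_or_lt with h0 | hpos
  · simp [← h0]
  have h : ∀ t : ℝ, t * mass M y < component M flip y ↔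
      t < component M flip y / mass M y := fun t => (lt_div_iff₀ hpos).symm
  simp only [h]
  rw [lintegral_Ico_lt (by positivity) ((div_le_one hpos).2 hcm), mul_add, ← mul_assoc,
    ← mul_assoc, ← ENNReal.ofReal_mul (by positivity), ← ENNReal.ofReal_mul (by positivity)]
  apply le_of_eq
  congr 3 <;> field_simp

theorem ofReal_sum_mass : ∑ y : Fin n → ℤˣ, ENNReal.ofReal (mass M y / 2) = 1 := by
  rw [← ENNReal.ofReal_sum_of_nonneg fun y _ => div_nonneg (mass_nonneg M y) (by norm_num),
    ← Finset.sum_div, sum_mass]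
  norm_num

theorem measurable_ite_near (a b δ : ℝ) (x : ℝ≥0∞) [∀ t : ℝ, Decidable (|t * a - b| ≤ δ)] :
    Measurable fun t : ℝ => if |t * a - b| ≤ δ then x else 0 :=
  Measurable.ite (measurableSet_le (by fun_prop) measurable_const) measurable_const
    measurable_const

/-- In the minimum, 1 comes from the total weight of the proposals and the factor 2^n from counting
them. -/
theorem sum_mass_mul_loopValue_le [NeZero n] (flip : Bool) :
    ∑ y : Fin n → ℤˣ, ENNReal.ofReal (mass M y / 2) *
      avg .empty (loopValue T f M d k₀ flip k₀ y) ≤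
    (∑' i, T.again d (2 ^ i * k₀) * min 1 (2 ^ n * ENNReal.ofReal (7 / 2 ^ (2 ^ i * k₀)))) +
      ((∑ y, ENNReal.ofReal (component M flip y) * f y) / 2 +
        startValue T f M d k₀ flip / 2) := by
  classical
  have h1 : ∀ y : Fin n → ℤˣ, ENNReal.ofReal (mass M y / 2) *
      avg .empty (loopValue T f M d k₀ flip k₀ y) ≤
      (∑' i, T.again d (2 ^ i * k₀) * min (ENNReal.ofReal (mass M y / 2))
        (ENNReal.ofReal (7 / 2 ^ (2 ^ i * k₀)))) +
      (ENNReal.ofReal (component M flip y / 2) * f y +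
        ENNReal.ofReal ((mass M y - component M flip y) / 2) * startValue T f M d k₀ flip) := by
    intro y
    rw [avg_empty]
    unfold loopValue
    rw [lintegral_add_left (Measurable.tsum fun i => measurable_ite_near _ _ _ _),
      lintegral_tsum fun i => (measurable_ite_near _ _ _ _).aemeasurable, mul_add,
      ← ENNReal.tsum_mul_left]
    exact add_le_add (ENNReal.tsum_le_tsum fun i => mass_mul_near_le _ _ _)
      (mass_mul_lt_le _ _ _ _)
  refine (Finset.sum_le_sum fun y _ => h1 y).trans ?_
  rw [Finset.sum_add_distrib, Finset.sum_add_distrib]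
  refine add_le_add ?_ (add_le_add ?_ ?_)
  · rw [← Summable.tsum_finsetSum fun _ _ => ENNReal.summable]
    refine ENNReal.tsum_le_tsum fun i => ?_
    rw [← Finset.mul_sum]
    gcongr
    refine le_min ?_ ?_
    · exact (Finset.sum_le_sum fun y _ => min_le_left _ _).trans ofReal_sum_mass.le
    · refine (Finset.sum_le_sum fun y _ => min_le_right _ _).trans ?_
      simp [Finset.card_univ, Fintype.card_pi]
  · apply le_of_eq
    rw [div_eq_mul_inv, Finset.sum_mul]
    refine Finset.sum_congr rfl fun y _ => ?_
    rw [ENNReal.ofReal_div_of_pos two_pos, ENNReal.ofReal_ofNat, div_eq_mul_inv]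
    ring
  -- The total rejection weight is (2 - 1)/2 = 1/2, since the masses sum to 2 and the component to
  -- 1.
  · apply le_of_eq
    rw [← Finset.sum_mul, ← ENNReal.ofReal_sum_of_nonneg fun y _ =>
      div_nonneg (sub_nonneg.2 (component_le_mass M flip y)) (by norm_num), ← Finset.sum_div,
      Finset.sum_sub_distrib, sum_mass, sum_component, ENNReal.div_eq_inv_mul]
    norm_num
    congr 1
    rw [one_div, ENNReal.ofReal_inv_of_pos two_pos]
    simp

/-- The average cost of a rejection round. -/
theorem launchValue_le [NeZero n] (flip : Bool) :
    T.coin + (launchValue T f M d k₀ false flip + launchValue T f M d k₀ true flip) / 2 ≤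
      startValue T f M d k₀ flip := by
  unfold launchValue
  rw [half_add, ← Finset.sum_add_distrib, ENNReal.div_eq_inv_mul, Finset.mul_sum]
  have e : ∀ y : Fin n → ℤˣ, 2⁻¹ * ((∏ j, (M j).likelihood false .empty (y j)) *
      avg .empty (loopValue T f M d k₀ flip k₀ y) +
      (∏ j, (M j).likelihood true .empty (y j)) *
      avg .empty (loopValue T f M d k₀ flip k₀ y)) = ENNReal.ofReal (mass M y / 2) *
      avg .empty (loopValue T f M d k₀ flip k₀ y) := by
    intro y
    rw [← ENNReal.div_eq_inv_mul, avg_mul_right, likelihood_average]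
  simp only [e]
  refine (add_le_add_right (add_le_add_right (sum_mass_mul_loopValue_le flip) _) _).trans ?_
  rw [← add_assoc, ← add_assoc, ← Tariff.round]
  -- `startValue` is the solution V of V = round + (∑ component · f)/2 + V/2: one attempt is paid
  -- for, and with probability 1/2 everything starts again.
  apply le_of_eq
  have h2 : (2 * T.round d n k₀) / 2 = T.round d n k₀ :=
    by rw [mul_comm]; exact ENNReal.mul_div_cancel_right (by simp) (by simp)
  rw [startValue, ENNReal.add_div, h2]
  conv_rhs => rw [← half_add_half (∑ y, ENNReal.ofReal (component M flip y) * f y), ENNReal.add_div]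
  ring

end

end GHZ

/-! ### The potential pays for every step -/

namespace GHZ

open MeasureTheory

noncomputable section

variable {n : ℕ} {T : Tariff} {f : (Fin n → ℤˣ) → ℝ≥0∞} {M : Fin n → Measurement} {d k₀ : ℕ}

/-! ### Coin tosses -/

/-- A party adds a digit either to its sample or, as leader, to U; in both cases one conditional
expectation is refined and the other is a constant multiplier. -/
theorem factor_tossed [NeZero n] (y : Fin n → ℤˣ) (j : Fin n) (m : Memory) {i : ℕ}
    (hph : m.phase = .work i) :
    (factor T f M d k₀ y j (tossed j m false) + factor T f M d k₀ y j (tossed j m true)) / 2 =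
      factor T f M d k₀ y j m := by
  classical
  rw [tossed_work _ _ _ hph, tossed_work _ _ _ hph]
  split_ifs with h1 h2
  · obtain ⟨rfl, -⟩ := h2
    simp only [factor, if_true]
    rw [avg_mul_left, avg_push]
  · exact half_add_half _
  · simp only [factor]
    rw [avg_mul_right, Measurement.likelihood_push]

theorem pending_tossed [NeZero n] (j : Fin n) (m : Memory) {i : ℕ} (hph : m.phase = .work i) :
    (if (tossMem j m).isSome then 1 else 0) +
      (pending j (tossed j m false) + pending j (tossed j m true)) / 2 ≤ pending j m := by
  classical
  -- The worst case, with one half still undecided: 2 solves x = 1 + x/2, the expected number of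
  -- tosses at success probability 1/2.
  have one : ∀ c : ℝ≥0∞, 1 + ((2 + c) + (0 + c)) / 2 ≤ 2 + c := by
    intro c
    rw [add_comm 2 c, add_comm 0 c, half_add, add_zero, ENNReal.div_self (by simp) (by simp)]
    rw [← one_add_one_eq_two]
    exact le_of_eq (by ring)
  have two : ∀ a b c : ℝ≥0∞, (a = 0 ∧ (b = 0 ∨ b = 2)) ∨ (b = 0 ∧ (a = 0 ∨ a = 2)) →
      1 + ((a + c) + (b + c)) / 2 ≤ 2 + c := by
    intro a b c h
    refine le_trans ?_ (one c)
    gcongr 1 + ?_ / 2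
    rcases h with ⟨rfl, rfl | rfl⟩ | ⟨rfl, rfl | rfl⟩
    · gcongr; simp
    · rw [add_comm]
    · gcongr; simp
    · exact le_rfl
  have ite : ∀ (p : Prop) [Decidable p],
      ((if p then (0 : ℝ≥0∞) else 2) = 0) ∨ ((if p then (0 : ℝ≥0∞) else 2) = 2) := by
    intro p _; split_ifs <;> simp
  rw [tossed_work _ _ _ hph, tossed_work _ _ _ hph]
  by_cases hd : m.Decided
  · by_cases hj : j = 0 ∧ m.u.len < m.k
    · obtain ⟨rfl, hlt⟩ := hj
      have hD : ∀ b, ({ m with u := m.u.push b } : Memory).Decided := fun b => hd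
      have hsome : (tossMem (0 : Fin n) m).isSome := by simp [tossMem, hph, hd, hlt]
      rw [if_pos hsome]
      simp only [hd, hlt, not_true_eq_false, if_false, and_self, if_true]
      unfold pending
      rw [if_pos (hD false), if_pos (hD true), if_pos hd]
      simp only [if_true, Uniform.push, half_add_half, zero_add]
      apply le_of_eq
      have : m.k - m.u.len = 1 + (m.k - (m.u.len + 1)) := by omega
      rw [this]; push_cast; rfl
    · have hnone : ¬ (tossMem j m).isSome := by simp [tossMem, hph, hd, hj]
      rw [if_neg hnone]
      simp only [hd, hj, not_true_eq_false, if_false, half_add_half, zero_add, le_refl]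
  · have hsome : (tossMem j m).isSome := by simp [tossMem, hph, hd]
    rw [if_pos hsome]
    simp only [hd, not_false_eq_true, if_true]
    unfold pending
    rw [if_neg hd]
    refine two _ _ _ ?_
    rcases m.decided_push hd with h | h
    · exact Or.inl ⟨if_pos h, ite _⟩
    · exact Or.inr ⟨if_pos h, ite _⟩

/-- The counts of pending coins are averaged party by party. The product over parties is averaged
factor by factor, which is where independence of their coins enters. -/
theorem potential_toss_work [NeZero n] {tree : Bool} {s : Fin n → Memory} {i : ℕ}
    (hs : Invariant M tree s) (hph : (s 0).phase = .work i) :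
    T.coin * ∑ j, (if (tossMem j (s j)).isSome then 1 else 0) +
      (PMF.uniformOfFintype (Fin n → Bool)).mean
        (fun b => potential T f M d k₀ fun j => tossed j (s j) (b j)) ≤
      potential T f M d k₀ s := by
  have e : ∀ b : Fin n → Bool, potential T f M d k₀ (fun j => tossed j (s j) (b j)) =
      (T.rest d i (s 0).k + T.coin * ∑ j, pending j (tossed j (s j) (b j))) +
        ∑ y, ∏ j, factor T f M d k₀ y j (tossed j (s j) (b j)) := by
    intro b
    obtain ⟨-, -, hp, hk, -, -⟩ := tossed_eq (0 : Fin n) (s 0) (b 0)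
    unfold potential
    rw [hp, hph]
    simp only [hk]
    rw [add_comm (T.rest _ _ _)]
  have e0 : potential T f M d k₀ s = (T.rest d i (s 0).k + T.coin * ∑ j, pending j (s j)) +
        ∑ y, ∏ j, factor T f M d k₀ y j (s j) := by
    unfold potential
    rw [hph]
    simp only
    rw [add_comm (T.rest _ _ _)]
  simp only [e]
  rw [e0, PMF.mean_add, PMF.mean_add, PMF.mean_const, PMF.mean_mul_left, PMF.mean_sum,
    PMF.mean_sum]
  have hf : ∀ y : Fin n → ℤˣ, (PMF.uniformOfFintype (Fin n → Bool)).mean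
      (fun b => ∏ j, factor T f M d k₀ y j (tossed j (s j) (b j))) =
        ∏ j, factor T f M d k₀ y j (s j) := by
    intro y
    rw [PMF.mean_uniform_prod fun j b => factor T f M d k₀ y j (tossed j (s j) b)]
    exact Finset.prod_congr rfl fun j _ => factor_tossed y j _ ((hs.phase_eq j).trans hph)
  have hp : ∀ j : Fin n, (PMF.uniformOfFintype (Fin n → Bool)).mean
      (fun b => pending j (tossed j (s j) (b j))) =
        (pending j (tossed j (s j) false) + pending j (tossed j (s j) true)) / 2 := fun j =>
    PMF.mean_uniform_coord j fun b => pending j (tossed j (s j) b)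
  simp only [hf, hp]
  rw [← add_assoc, add_left_comm, ← mul_add, ← Finset.sum_add_distrib]
  gcongr with j
  exact pending_tossed j _ ((hs.phase_eq j).trans hph)

theorem sum_toss_leader [NeZero n] {s : Fin n → Memory}
    (h : ∀ j, j ≠ 0 → ¬ (tossMem j (s j)).isSome) (h0 : (tossMem (0 : Fin n) (s 0)).isSome) :
    ∑ j, (if (tossMem j (s j)).isSome then 1 else 0 : ℝ≥0∞) = 1 := by
  rw [Finset.sum_eq_single 0]
  · rw [if_pos h0]
  · intro j _ hj
    rw [if_neg (h j hj)]
  · simp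

theorem potential_toss_bern [NeZero n] {tree : Bool} {s : Fin n → Memory}
    (hs : Invariant M tree s) (hph : (s 0).phase = .bern) (hlt : (s 0).u.len < (s 0).k) :
    T.coin * ∑ j, (if (tossMem j (s j)).isSome then 1 else 0) +
      (PMF.uniformOfFintype (Fin n → Bool)).mean
        (fun b => potential T f M d k₀ fun j => tossed j (s j) (b j)) ≤
      potential T f M d k₀ s := by
  have e : ∀ b : Fin n → Bool, potential T f M d k₀ (fun j => tossed j (s j) (b j)) =
      (T.coin * ((s 0).k - ((s 0).u.len + 1) : ℕ) + (T.bern (s 0).k + T.sync)) +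
      avg ((s 0).u.push (b 0)) (bernValue T f M d k₀ (s 0).k) := by
    intro b
    obtain ⟨-, -, hp, hk, -, -⟩ := tossed_eq (0 : Fin n) (s 0) (b 0)
    have hu := tossed_bern (0 : Fin n) (s 0) (b 0) hph
    rw [if_pos ⟨rfl, hlt⟩] at hu
    unfold potential
    rw [hp, hph]
    simp only [hk, hu]
    rfl
  rw [sum_toss_leader, mul_one]
  · simp only [e]
    rw [PMF.mean_add, PMF.mean_const, PMF.mean_uniform_coord 0 fun b =>
      avg ((s 0).u.push b) (bernValue T f M d k₀ (s 0).k), avg_push]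
    unfold potential
    rw [hph]
    have : (s 0).k - (s 0).u.len = 1 + ((s 0).k - ((s 0).u.len + 1)) := by omega
    simp only [this]
    push_cast
    exact le_of_eq (by ring)
  · intro j hj
    simp [tossMem, hs.phase_eq j, hph, hj]
  · simp [tossMem, hph, hlt]

theorem potential_toss_start [NeZero n] {tree : Bool} {s : Fin n → Memory}
    (hs : Invariant M tree s) (hph : (s 0).phase = .start) (hlt : (s 0).u.len < 1) :
    T.coin * ∑ j, (if (tossMem j (s j)).isSome then 1 else 0) +
      (PMF.uniformOfFintype (Fin n → Bool)).mean
        (fun b => potential T f M d k₀ fun j => tossed j (s j) (b j)) ≤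
      potential T f M d k₀ s := by
  have e : ∀ b : Fin n → Bool, potential T f M d k₀ (fun j => tossed j (s j) (b j)) =
      launchValue T f M d k₀ (b 0) (s 0).flip := by
    intro b
    have ht := tossed_start (0 : Fin n) (s 0) (b 0) hph
    rw [if_pos ⟨rfl, hlt⟩] at ht
    unfold potential
    beta_reduce
    rw [ht]
    simp only [hph, Uniform.push]
    exact if_neg (c := (s 0).u.len + 1 < 1) (by omega)
  rw [sum_toss_leader, mul_one]
  · simp only [e]
    rw [PMF.mean_uniform_coord 0 fun b => launchValue T f M d k₀ b (s 0).flip]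
    refine (launchValue_le _).trans (le_of_eq ?_)
    unfold potential
    rw [hph]
    simp only [if_pos hlt]
  · intro j hj
    simp [tossMem, hs.phase_eq j, hph, hj]
  · simp only [tossMem, hph]
    rw [if_pos ⟨trivial, hlt⟩]
    rfl

theorem potential_toss [NeZero n] {tree : Bool} {s : Fin n → Memory} (hs : Invariant M tree s)
    (ht : ∃ j, (tossMem j (s j)).isSome) :
    T.coin * ∑ j, (if (tossMem j (s j)).isSome then 1 else 0) +
      (PMF.uniformOfFintype (Fin n → Bool)).mean
        (fun b => potential T f M d k₀ fun j => tossed j (s j) (b j)) ≤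
      potential T f M d k₀ s := by
  obtain ⟨j, hj⟩ := ht
  have hpj := hs.phase_eq j
  cases hph : (s 0).phase with
  | bern =>
    refine potential_toss_bern hs hph ?_
    by_contra h
    have : ¬ (tossMem j (s j)).isSome := by
      by_cases hj0 : j = 0
      · subst hj0; simp [tossMem, hph, h]
      · simp [tossMem, hpj, hph, hj0]
    exact this hj
  | bernSync => simp [tossMem, hpj, hph] at hj
  | start =>
    refine potential_toss_start hs hph ?_
    by_contra h
    have : ¬ (tossMem j (s j)).isSome := by
      by_cases hj0 : j = 0
      · subst hj0
        simp only [tossMem, hph]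
        rw [if_neg fun h' => h h'.2]
        simp
      · simp [tossMem, hpj, hph, hj0]
    exact this hj
  | work i => exact potential_toss_work hs hph
  | done => simp [tossMem, hpj, hph] at hj

/-! ### Exchanges -/

section Exchange

variable [NeZero n] {tree : Bool} {s : Fin n → Memory}

theorem potential_bern (hs : Invariant M tree s) (hph : (s 0).phase = .bern) :
    T.bern (s 0).k + potential T f M d k₀ (exchanged tree k₀ s) ≤ potential T f M d k₀ s := by
  obtain ⟨p, hp⟩ := exchanged_bern (k₀ := k₀) hph hs 0
  unfold potential
  rw [hp, hph]
  simp only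
  rw [← add_assoc]
  exact add_le_add_left le_add_self _

theorem potential_of_start {s : Fin n → Memory} (hph : (s 0).phase = .start)
    (hlen : (s 0).u.len < 1) :
    potential T f M d k₀ s = startValue T f M d k₀ (s 0).flip := by
  unfold potential
  rw [hph]
  simp only [if_pos hlen]

theorem potential_bernSync (hs : Invariant M tree s) (hph : (s 0).phase = .bernSync) :
    T.sync + potential T f M d k₀ (exchanged tree k₀ s) ≤ potential T f M d k₀ s := by
  have hst := hs.stage
  rw [hph] at hst
  obtain ⟨-, hlen, hp⟩ := hst
  have hx := exchanged_bernSync (k₀ := k₀) hph hs 0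
  have e0 : potential T f M d k₀ s =
      T.sync + avg (s 0).u (bernValue T f M d k₀ (s 0).k) := by
    unfold potential; rw [hph]
  rw [e0]
  gcongr
  unfold potential
  rw [hx]
  rcases hv : bernVerdict (s 0) with _ | B
  · simp only
    -- Without a verdict every t in the interval lies near the parameter, so the first term of the
    -- series is available throughout. It pays for one more digit and two exchanges.
    rw [avg_congr fun t ht => bernValue_again (bernVerdict_none hp hlen ht hv), avg_const_add]
    have : (s 0).k + 1 - (s 0).u.len = 1 := by omega
    rw [this, Nat.cast_one, mul_one]
  · simp only [Memory.restart, Uniform.empty, if_true]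
    rw [if_pos zero_lt_one, ← avg_const (s 0).u (startValue T f M d k₀ (!B))]
    refine avg_mono fun t ht => ?_
    unfold bernValue
    refine le_add_left ?_
    cases B
    · rw [if_neg (bernVerdict_false hp ht hv)]; rfl
    · rw [if_pos (bernVerdict_true hp hlen ht hv)]; rfl

theorem prod_factor (y : Fin n → ℤˣ) (s : Fin n → Memory) :
    ∏ j, factor T f M d k₀ y j (s j) =
      (∏ j, (M j).likelihood (s j).S (s j).v (y j)) *
        avg (s 0).u (loopValue T f M d k₀ (s 0).flip (s 0).k y) := by
  simp only [factor]
  rw [Finset.prod_mul_distrib]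
  congr 1
  rw [Finset.prod_eq_single 0]
  · simp
  · intro j _ hj; simp [hj]
  · simp

/-- All likelihoods have become indicators, so only the vector actually proposed survives in the
sum. -/
theorem prod_factor_of_decided (hs : Invariant M tree s) (hd : ∀ j, (s j).Decided) :
    ∑ y, ∏ j, factor T f M d k₀ y j (s j) =
      avg (s 0).u (loopValue T f M d k₀ (s 0).flip (s 0).k fun j => (s j).outcome) := by
  classical
  simp only [prod_factor, fun j => Measurement.likelihood_of_decided (hs.φ_eq j) (hd j)]
  rw [Finset.sum_eq_single fun j => (s j).outcome]
  · simp
  · intro y _ hy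
    obtain ⟨j, hj⟩ := Function.ne_iff.1 hy
    rw [Finset.prod_eq_zero (Finset.mem_univ j), zero_mul]
    rw [if_neg (Ne.symm hj)]
  · simp

theorem potential_start (hs : Invariant M tree s) (hph : (s 0).phase = .start)
    (hlen : 1 ≤ (s 0).u.len) :
    T.start + potential T f M d k₀ (exchanged tree k₀ s) ≤ potential T f M d k₀ s := by
  have hx := fun j => exchanged_start (k₀ := k₀) hph hs j
  have e0 : potential T f M d k₀ s = launchValue T f M d k₀ (s 0).S (s 0).flip := by
    unfold potential; rw [hph]; simp only [if_neg (not_lt.2 hlen)]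
  have hpend : ∑ j, pending j (exchanged tree k₀ s j) ≤ 2 * n + k₀ := by
    classical
    unfold pending
    rw [Finset.sum_add_distrib]
    gcongr
    · refine (Finset.sum_le_card_nsmul _ _ 2 fun j _ => ?_).trans ?_
      · split_ifs <;> simp
      · simp [mul_comm]
    · rw [Finset.sum_ite_eq' Finset.univ (0 : Fin n), if_pos (Finset.mem_univ _), hx]
      simp [Uniform.empty]
  rw [e0]
  unfold potential
  rw [hx 0]
  simp only
  rw [launchValue, ← add_assoc, ← add_assoc]
  gcongr with y
  rw [prod_factor]
  simp only [hx]
  rfl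

theorem potential_work (hs : Invariant M tree s) {i : ℕ} (hph : (s 0).phase = .work i)
    (hi : i < depth tree n) :
    T.work i (s 0).k + potential T f M (depth tree n) k₀ (exchanged tree k₀ s) ≤
      potential T f M (depth tree n) k₀ s := by
  have hx := fun j => exchanged_work (k₀ := k₀) hph hs hi j
  have e : ∀ j, pending j (exchanged tree k₀ s j) = pending j (s j) := by
    intro j; rw [hx]; rfl
  have e' : ∀ y j, factor T f M (depth tree n) k₀ y j (exchanged tree k₀ s j) =
      factor T f M (depth tree n) k₀ y j (s j) := by
    intro y j; rw [hx]; rfl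
  unfold potential
  simp only [e, e']
  rw [hx 0, hph]
  simp only
  rw [← add_assoc, add_left_comm]
  gcongr
  rw [Tariff.rest, Tariff.rest]
  conv_rhs => rw [Finset.sum_eq_sum_Ico_succ_bot (by omega)]

theorem prod_c (hs : Invariant M tree s) : ∏ j, (s j).c = ampC M fun j => (s j).outcome := by
  refine Finset.prod_congr rfl fun j _ => ?_
  rw [Memory.c, Measurement.c, hs.φ_eq]

/-- Only the leader can have `flip` set, so the sign enters the product exactly once. -/
theorem prod_s (hs : Invariant M tree s) :
    ∏ j, (s j).s = ampFlip M (s 0).flip fun j => (s j).outcome := by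
  simp only [Memory.s]
  rw [Finset.prod_mul_distrib, ampFlip]
  congr 1
  · rw [Finset.prod_eq_single 0]
    · intro j _ hj; simp [hs.flip_eq j hj]
    · simp
  · refine Finset.prod_congr rfl fun j _ => ?_
    rw [Measurement.s, hs.φ_eq]

/-- Each verdict holds for all t in the current interval, so the average of `loopValue` can be
compared pointwise with what follows: the output value, a fresh start, or a further passage financed
by the first term of the series. -/
theorem potential_verdict (hs : Invariant M tree s) (hph : (s 0).phase = .work (depth tree n))
    (hlen : (s 0).u.len = (s 0).k) (hd : ∀ j, (s j).Decided) :
    T.work (depth tree n) (s 0).k + potential T f M (depth tree n) k₀ (exchanged tree k₀ s) ≤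
      potential T f M (depth tree n) k₀ s := by
  have hx := fun j => exchanged_verdict (k₀ := k₀) hph hs j
  have hst := hs.stage
  rw [hph] at hst
  obtain ⟨⟨h1, e1⟩, h2, e2⟩ := (hs.close hph).final
  rw [prod_c hs] at e1
  rw [prod_s hs] at e2
  set y : Fin n → ℤˣ := fun j => (s j).outcome with hy
  have hL : ampC M y ^ 2 + ampFlip M (s 0).flip y ^ 2 = mass M y := by
    rw [ampFlip_sq, mass]
  have hdisc := fun t ht => verdict_discriminant (t := t) hst.1 hlen h1 h2
    (hL.trans_le (mass_le_one M y)) e1 e2 ht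
  rw [hL] at hdisc
  have e0 : potential T f M (depth tree n) k₀ s =
      T.coin * ∑ j, pending j (s j) + T.work (depth tree n) (s 0).k +
        avg (s 0).u (loopValue T f M (depth tree n) k₀ (s 0).flip (s 0).k y) := by
    unfold potential
    rw [hph, ← prod_factor_of_decided hs hd]
    simp [Tariff.rest]
  have hp0 : ∑ j, pending j (s j) = 0 := by
    classical
    refine Finset.sum_eq_zero fun j _ => ?_
    rw [pending, if_pos (hd j), zero_add]
    split_ifs with hj
    · rw [hj, hlen]; simp
    · rfl
  rw [e0, hp0, mul_zero, zero_add]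
  gcongr
  rcases hv : verdict (s 0) (partials n (depth tree n) (s 0)) with _ | _ | _
  · have hx' : exchanged tree k₀ s = fun j => { s j with phase := .work 0, k := 2 * (s j).k } := by
      funext j; rw [hx, hv]; rfl
    have hk : ∀ t ∈ Set.Ico (s 0).u.val ((s 0).u.val + 1 / 2 ^ (s 0).u.len), _ := fun t ht =>
      loopValue_again (T := T) (f := f) (d := depth tree n) (k₀ := k₀) (by
        have := verdict_none (t := t) (a₁ := ampC M y) (a₂ := ampFlip M (s 0).flip y)
          (by rw [hL]; exact hdisc t ht) hv
        rwa [hL] at this)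
    rw [avg_congr hk, avg_const_add, hx']
    unfold potential
    simp only
    -- Samples stay decided; only the leader needs coins, namely 2k - k = k new digits of U.
    have hpend : ∑ j, pending j ({ s j with phase := .work 0, k := 2 * (s j).k } : Memory) =
        ((s 0).k : ℝ≥0∞) := by
      classical
      rw [Finset.sum_eq_single 0]
      · have hD : ({ s 0 with phase := .work 0, k := 2 * (s 0).k } : Memory).Decided := hd 0
        rw [pending, if_pos hD, if_pos rfl, zero_add]
        simp only [hlen]
        congr 1
        omega
      · intro j _ hj
        have hD : ({ s j with phase := .work 0, k := 2 * (s j).k } : Memory).Decided := hd j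
        rw [pending, if_pos hD, if_neg hj, zero_add]
      · simp
    rw [hpend, Tariff.again, add_comm (T.coin * _)]
    gcongr
    apply le_of_eq
    simp only [prod_factor]
    have hlik : ∀ (y : Fin n → ℤˣ) (j : Fin n), (M j).likelihood (s j).S (s j).v (y j) =
        if (s j).outcome = y j then 1 else 0 := fun y j =>
      Measurement.likelihood_of_decided (hs.φ_eq j) (hd j) _
    simp only [hlik]
    rw [Finset.sum_eq_single y]
    · simp [hy]
    · intro z _ hz
      obtain ⟨j, hj⟩ := Function.ne_iff.1 hz
      rw [Finset.prod_eq_zero (Finset.mem_univ j), zero_mul]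
      rw [if_neg (Ne.symm hj)]
    · simp
  · have hx' : exchanged tree k₀ s = fun j => (s j).restart := by
      funext j; rw [hx, hv]; rfl
    rw [hx', potential_of_start rfl zero_lt_one]
    change startValue T f M _ k₀ (s 0).flip ≤ _
    rw [← avg_const (s 0).u (startValue T f M _ k₀ (s 0).flip)]
    refine avg_mono fun t ht => ?_
    have := verdict_reject (t := t) (a₁ := ampC M y) (a₂ := ampFlip M (s 0).flip y)
      (by rw [hL]; exact hdisc t ht) hv
    rw [hL] at this
    unfold loopValue
    refine le_add_left ?_
    rw [if_neg (c := t * mass M y < component M (s 0).flip y) this]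
  · have hx' : exchanged tree k₀ s = fun j => { s j with phase := .done } := by
      funext j; rw [hx, hv]; rfl
    rw [hx']
    unfold potential
    simp only
    change f y ≤ _
    rw [← avg_const (s 0).u (f y)]
    refine avg_mono fun t ht => ?_
    have := verdict_accept (t := t) (a₁ := ampC M y) (a₂ := ampFlip M (s 0).flip y)
      (by rw [hL]; exact hdisc t ht) hv
    rw [hL] at this
    unfold loopValue
    refine le_add_left ?_
    rw [if_pos (c := t * mass M y < component M (s 0).flip y) this]

theorem potential_exchange (hs : Invariant M tree s)
    (he : (protocol n tree k₀).Exchanging s) :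
    T.price (s 0) + potential T f M (depth tree n) k₀ (exchanged tree k₀ s) ≤
      potential T f M (depth tree n) k₀ s := by
  have hst := hs.stage
  unfold Tariff.price
  cases hph : (s 0).phase with
  | bern => exact potential_bern hs hph
  | bernSync => exact potential_bernSync hs hph
  | start => exact potential_start hs hph (not_tossing_start hph he.2)
  | work i =>
    rw [hph] at hst
    obtain ⟨hd, hl⟩ := hs.not_tossing_work hph he.2
    rcases hst.2.2.1.lt_or_eq with hi | rfl
    · exact potential_work hs hph hi
    · exact potential_verdict hs hph (le_antisymm hst.2.1 hl) hd
  | done => exact absurd (hs.halted_iff.2 hph) he.1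

end Exchange

/-! ### Expected costs and laws of the outputs -/

/-- The prices in the tariff `T` cover the cost. -/
structure Tariff.Covers [NeZero n] (T : Tariff) (M : Fin n → Measurement) (tree : Bool) (k₀ : ℕ)
    (cost : (Fin n → Memory) → ℕ) : Prop where
  halted : ∀ s, Invariant M tree s → (protocol n tree k₀).Halted s → cost s = 0
  toss : ∀ s, Invariant M tree s → ¬ (protocol n tree k₀).Halted s →
    (protocol n tree k₀).Tossing s → (cost s : ℝ≥0∞) ≤ T.coin * (protocol n tree k₀).coins s
  exchange : ∀ s, Invariant M tree s → (protocol n tree k₀).Exchanging s →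
    (cost s : ℝ≥0∞) ≤ T.price (s 0)

/-- This holds for every f and every covering tariff, so the same argument serves the cost bounds,
termination and the law of the outputs. -/
theorem potential_pays [NeZero n] {tree : Bool} {cost : (Fin n → Memory) → ℕ}
    (hc : T.Covers M tree k₀ cost) (s : Fin n → Memory) (hs : Invariant M tree s) :
    (cost s : ℝ≥0∞) + PMF.mean (α := Fin n → Memory) ((protocol n tree k₀).step s)
      (potential T f M (depth tree n) k₀) ≤ potential T f M (depth tree n) k₀ s := by
  unfold Protocol.step
  split_ifs with h1 h2
  · rw [hc.halted s hs h1, Nat.cast_zero, zero_add]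
    exact (PMF.mean_pure (α := Fin n → Memory) s _).le
  · have e : PMF.mean (α := Fin n → Memory) ((PMF.uniformOfFintype (Fin n → Bool)).map
        ((protocol n tree k₀).afterToss s)) (potential T f M (depth tree n) k₀) =
        (PMF.uniformOfFintype (Fin n → Bool)).mean
        (fun b => potential T f M (depth tree n) k₀ fun j => tossed j (s j) (b j)) := by
      refine (PMF.mean_map _ _ _).trans (congrArg _ ?_)
      funext b
      exact congrArg (potential T f M (depth tree n) k₀) (afterToss_eq s b)
    refine (congrArg ((cost s : ℝ≥0∞) + ·) e).trans_le ?_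
    refine le_trans ?_ (potential_toss hs h2)
    gcongr
    refine (hc.toss s hs h1 h2).trans (le_of_eq ?_)
    congr 1
    unfold Protocol.coins
    rw [if_neg h1, Finset.card_filter]
    push_cast
    exact Finset.sum_congr rfl fun j _ => by congr
  · refine (congrArg ((cost s : ℝ≥0∞) + ·)
      (PMF.mean_pure (α := Fin n → Memory) _ _)).trans_le ?_
    refine le_trans ?_ (potential_exchange hs ⟨h1, h2⟩)
    gcongr
    · exact hc.exchange s hs ⟨h1, h2⟩
    · exact (congrArg (potential T f M (depth tree n) k₀) (afterExchange_eq s)).le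

/-- A bound for the expected price of a run. -/
def Tariff.total (T : Tariff) (d n k₀ : ℕ) : ℝ≥0∞ :=
  T.coin + (T.bern 1 + T.sync) +
    (∑' i : ℕ, (T.coin + (T.bern (1 + i + 1) + T.sync)) *
      min 1 (ENNReal.ofReal (2 * (3 / 2 ^ (1 + i))))) +
    2 * T.round d n k₀

/-- Averaging over the Bernoulli uniform number mixes the two components with weights cos² and sin²,
which is the GHZ law. The series weighs each further precision k by the chance that t lies within
3/2^k of the parameter. -/
theorem potential_init_le [NeZero n] {tree : Bool} :
    potential T f M d k₀ (fun j => (protocol n tree k₀).init j (M j)) ≤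
      T.total d n k₀ + ∑ y, ENNReal.ofReal (prob M y) * f y := by
  classical
  have hp0 := bernParam_nonneg M
  have hp1 := bernParam_le_one M
  have e : potential T f M d k₀ (fun j => (protocol n tree k₀).init j (M j)) =
      T.coin + (T.bern 1 + T.sync) + avg .empty (bernValue T f M d k₀ 1) := by
    change T.coin * ((1 - 0 : ℕ) : ℝ≥0∞) + (T.bern 1 + T.sync) + _ = _
    rw [Nat.sub_zero, Nat.cast_one, mul_one]
    rfl
  have hm : ∀ (b δ : ℝ) (x : ℝ≥0∞), Measurable fun t : ℝ => if |t - b| ≤ δ then x else 0 :=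
    fun b δ x => Measurable.ite (measurableSet_le (by fun_prop) measurable_const)
      measurable_const measurable_const
  rw [e, Tariff.total, add_assoc (T.coin + _ + _)]
  rw [add_assoc (T.coin + _)]
  refine add_le_add_right ?_ _
  rw [avg_empty]
  unfold bernValue
  rw [lintegral_add_left (Measurable.tsum fun i => hm _ _ _),
    lintegral_tsum fun i => (hm _ _ _).aemeasurable]
  refine add_le_add (ENNReal.tsum_le_tsum fun i => lintegral_Ico_near_le _ _ _) ?_
  rw [lintegral_Ico_lt hp0 hp1]
  apply le_of_eq
  unfold startValue
  have h1 : ENNReal.ofReal (bernParam M) + ENNReal.ofReal (1 - bernParam M) = 1 := by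
    rw [← ENNReal.ofReal_add hp0 (by linarith)]
    simp
  rw [mul_add, mul_add, add_add_add_comm, ← add_mul, h1, one_mul, Finset.mul_sum, Finset.mul_sum,
    ← Finset.sum_add_distrib]
  congr 1
  refine Finset.sum_congr rfl fun y _ => ?_
  rw [prob_eq, ENNReal.ofReal_add (mul_nonneg hp0 (component_nonneg _ _ _))
    (mul_nonneg (by linarith) (component_nonneg _ _ _)), ENNReal.ofReal_mul hp0,
    ENNReal.ofReal_mul (by linarith)]
  ring

theorem expected_le_total [NeZero n] {tree : Bool} {cost : (Fin n → Memory) → ℕ}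
    (hc : T.Covers M tree k₀ cost) :
    (protocol n tree k₀).expected cost M ≤ T.total (depth tree n) n k₀ := by
  have h := ((protocol n tree k₀).expected_le_potential
    (invariant_of_mem_support M) (potential_pays (f := fun _ => 0) hc)).1
  refine h.trans (potential_init_le.trans ?_)
  simp

/-- All prices are zero and f is the indicator of x, so the potential dominates the event of having
output x and initially is at most the target probability. -/
theorem outputs_le_prob [NeZero n] {tree : Bool} (x : Fin n → ℤˣ) (t : ℕ) :
    ((protocol n tree k₀).law M t).toOuterMeasure
      {s | ∀ i, (protocol n tree k₀).out i (s i) = some (x i)} ≤ ENNReal.ofReal (prob M x) := by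
  classical
  let T₀ : Tariff := ⟨0, fun _ => 0, 0, 0, fun _ _ => 0⟩
  have hT : T₀.Covers M tree k₀ fun _ => 0 :=
    ⟨fun _ _ _ => rfl, fun _ _ _ _ => by simp, fun _ _ _ => by simp⟩
  let f : (Fin n → ℤˣ) → ℝ≥0∞ := fun y => if y = x then 1 else 0
  have h := ((protocol n tree k₀).expected_le_potential
    (invariant_of_mem_support M) (potential_pays (f := f) hT)).2 t
  have h0 : T₀.total (depth tree n) n k₀ = 0 := by
    simp [Tariff.total, Tariff.round, Tariff.rest, Tariff.again, T₀]
  have hb := h.trans potential_init_le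
  rw [h0, zero_add] at hb
  have hsum : ∑ y, ENNReal.ofReal (prob M y) * f y = ENNReal.ofReal (prob M x) := by
    simp [f]
  rw [hsum] at hb
  refine le_trans ?_ hb
  rw [← PMF.mean_indicator]
  refine PMF.mean_mono _ fun s _ => ?_
  by_cases hs : ∀ i, (protocol n tree k₀).out i (s i) = some (x i)
  · have hout : ∀ i, (s i).phase = .done ∧ (s i).outcome = x i := by
      intro i
      have := hs i
      change outMem (s i) = some (x i) at this
      unfold outMem at this
      cases hp : (s i).phase <;> simp_all
    refine (Set.indicator_of_mem (show s ∈ {s : (protocol n tree k₀).Config |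
      ∀ i, (protocol n tree k₀).out i (s i) = some (x i)} from hs) 1).trans_le ?_
    unfold potential
    rw [(hout 0).1]
    simp [f, fun i => (hout i).2]
  · refine (Set.indicator_of_notMem (show s ∉ {s : (protocol n tree k₀).Config |
      ∀ i, (protocol n tree k₀).out i (s i) = some (x i)} from hs) 1).trans_le ?_
    exact zero_le

end

end GHZ

/-! ### Message lengths, parallel transmission and price lists -/

/-- Any messages can be transmitted one bit at a time. -/
theorem canTransmit_sum {n : ℕ} (w : Fin n → Fin n → List Bool) :
    CanTransmit w (∑ i, ∑ j, (w i j).length) := by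
  have hc : Fintype.card (MessageBit w) = ∑ i, ∑ j, (w i j).length := by
    simp [MessageBit, Fintype.card_sigma]
  rw [← hc]
  refine ⟨fun b => Fintype.equivFin _ b, fun b => Fin.isLt _, fun b b' hb h => absurd ?_ hb⟩
  exact (Fintype.equivFin _).injective (Fin.ext h)

/-- Messages of at most `T` bits between disjoint pairs can be transmitted in parallel. -/
theorem canTransmit_of_disjoint {n T : ℕ} (w : Fin n → Fin n → List Bool)
    (hT : ∀ i j, (w i j).length ≤ T)
    (h : ∀ i j i' j', w i j ≠ [] → w i' j' ≠ [] → (i, j) ≠ (i', j') →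
      i ≠ i' ∧ i ≠ j' ∧ j ≠ i' ∧ j ≠ j') :
    CanTransmit w T := by
  refine ⟨fun b => b.2.2.val, fun b => b.2.2.isLt.trans_le (hT _ _), ?_⟩
  rintro ⟨i, j, r⟩ ⟨i', j', r'⟩ hb hr
  have hne : ∀ {i j} (r : Fin (w i j).length), w i j ≠ [] := by
    intro i j r hw
    have := r.isLt
    simp [hw] at this
  refine h i j i' j' (hne r) (hne r') ?_
  rintro hij
  obtain ⟨rfl, rfl⟩ := Prod.mk.inj hij
  exact hb (by rw [Fin.ext (a := r) (b := r') hr])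

namespace GHZ

noncomputable section

variable {n : ℕ}

/-- The number of parties that send a message in exchange number `l` of the inner loop. -/
def senders (tree : Bool) (n l : ℕ) : ℕ :=
  if tree then (Finset.univ.filter fun j : Fin n => j.val % 2 ^ (l + 1) = 2 ^ l).card else n

theorem sendsTo_unique {l : ℕ} {j i i' : Fin n} (h : sendsTo tree l j i = true)
    (h' : sendsTo tree l j i' = true) : i = i' := by
  cases tree <;> simp only [sendsTo, Bool.false_eq_true, if_true, if_false,
    decide_eq_true_eq] at h h' <;> ext <;> omega

theorem sum_sendsTo_le (tree : Bool) (l c : ℕ) :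
    ∑ j : Fin n, ∑ i : Fin n, (if sendsTo tree l j i then c else 0) ≤ senders tree n l * c := by
  have h1 : ∀ j : Fin n, ∑ i : Fin n, (if sendsTo tree l j i then c else 0) ≤ c := by
    intro j
    rw [← Finset.sum_filter, Finset.sum_const, smul_eq_mul]
    have : (Finset.univ.filter fun i : Fin n => sendsTo tree l j i = true).card ≤ 1 := by
      rw [Finset.card_le_one]
      intro a ha b hb
      exact sendsTo_unique (Finset.mem_filter.1 ha).2 (Finset.mem_filter.1 hb).2
    exact (Nat.mul_le_mul_right c this).trans (one_mul c).le
  cases tree with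
  | false =>
    refine (Finset.sum_le_card_nsmul _ _ c fun j _ => h1 j).trans ?_
    simp [senders]
  | true =>
    have h2 : ∀ j : Fin n, ∑ i : Fin n, (if sendsTo true l j i then c else 0) ≤
        if j.val % 2 ^ (l + 1) = 2 ^ l then c else 0 := by
      intro j
      split_ifs with hj
      · exact h1 j
      · refine (Finset.sum_eq_zero fun i _ => ?_).le
        simp [sendsTo, hj]
    refine (Finset.sum_le_sum fun j _ => h2 j).trans ?_
    rw [← Finset.sum_filter, Finset.sum_const, smul_eq_mul]
    exact le_rfl

/-- In the tree, a party sends only at the level given by the 2-adic valuation of its index, hence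
at most once per passage. The number of messages is linear in n, without a logarithm. -/
theorem sum_senders_le (tree : Bool) : ∑ l ∈ Finset.range (depth tree n), senders tree n l ≤ n := by
  cases tree with
  | false => simp [depth, senders]
  | true =>
    simp only [senders, if_true, Finset.card_filter]
    rw [Finset.sum_comm]
    refine (Finset.sum_le_card_nsmul _ _ 1 fun j _ => ?_).trans (by simp)
    rw [← Finset.card_filter, Finset.card_le_one]
    have key : ∀ a b : ℕ, j.val % 2 ^ (a + 1) = 2 ^ a → j.val % 2 ^ (b + 1) = 2 ^ b → ¬ a < b := by
      intro a b ha hb hab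
      have hd : 2 ^ b ∣ j.val := by
        rw [← Nat.mod_add_div j.val (2 ^ (b + 1)), hb]
        exact (dvd_refl _).add (Dvd.dvd.mul_right (pow_dvd_pow 2 (Nat.le_succ b)) _)
      have := Nat.mod_eq_zero_of_dvd ((pow_dvd_pow 2 (Nat.succ_le_of_lt hab)).trans hd)
      rw [Nat.succ_eq_add_one, ha] at this
      exact absurd this (by positivity)
    intro a ha b hb
    have ha := (Finset.mem_filter.1 ha).2
    have hb := (Finset.mem_filter.1 hb).2
    exact le_antisymm (not_lt.1 (key b a hb ha)) (not_lt.1 (key a b ha hb))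

/-! ### Lengths of the messages -/

variable [NeZero n] {M : Fin n → Measurement} {tree : Bool} {k₀ : ℕ} {s : Fin n → Memory}

theorem sum_to_leader (c : ℕ) (g : Fin n → Fin n → ℕ)
    (h : ∀ j i, g j i ≤ if i = 0 then c else 0) : ∑ j, ∑ i, g j i ≤ n * c := by
  refine (Finset.sum_le_card_nsmul _ _ c fun j _ => ?_).trans (by simp)
  refine (Finset.sum_le_sum fun i _ => h j i).trans ?_
  simp

theorem sum_from_leader (c : ℕ) (g : Fin n → Fin n → ℕ)
    (h : ∀ j i, g j i ≤ if j = 0 then c else 0) : ∑ j, ∑ i, g j i ≤ n * c := by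
  rw [Finset.sum_comm]
  exact sum_to_leader c (fun i j => g j i) fun i j => h j i

/-- The number of bits that are sent in an exchange. -/
def bitPrice (tree : Bool) (n : ℕ) (m : Memory) : ℕ :=
  match m.phase with
  | .bern => n * (m.k + Nat.clog 2 n + 3)
  | .bernSync => n
  | .start => n
  | .work l => if l < depth tree n then senders tree n l * (2 * (m.k + Nat.clog 2 n + 5)) else n * 2
  | .done => 0

theorem length_sendMem_work {l : ℕ} (hs : Invariant M tree s) (hph : (s 0).phase = .work l)
    (hl : l < depth tree n) (j i : Fin n) : (sendMem tree j (s j) i).length =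
      if sendsTo tree l j i then 2 * ((s 0).k + Nat.clog 2 n + 5) else 0 := by
  simp only [sendMem, hs.phase_eq j, hph, if_pos hl]
  split_ifs
  · rw [length_encodePair, hs.k_eq, prec]; omega
  · rfl

theorem sum_length_le (hs : Invariant M tree s) :
    ∑ j, ∑ i, (sendMem tree j (s j) i).length ≤ bitPrice tree n (s 0) := by
  have hp := hs.phase_eq
  have hk := hs.k_eq
  unfold bitPrice
  cases hph : (s 0).phase with
  | bern =>
    refine sum_to_leader _ _ fun j i => ?_
    simp only [sendMem, hp j, hph, hk j]
    split_ifs with h1 h2 h2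
    · rw [length_encodeNat, bernPrec]
    · exact absurd h1.1 h2
    · exact Nat.zero_le _
    · exact Nat.zero_le _
  | bernSync =>
    refine (sum_from_leader 1 _ fun j i => ?_).trans (mul_one n).le
    simp only [sendMem, hp j, hph]
    split_ifs <;> simp_all
  | start =>
    refine (sum_from_leader 1 _ fun j i => ?_).trans (mul_one n).le
    simp only [sendMem, hp j, hph]
    split_ifs <;> simp_all
  | work l =>
    simp only
    split_ifs with hl
    · simp only [length_sendMem_work hs hph hl]
      exact sum_sendsTo_le tree l _
    · refine sum_from_leader 2 _ fun j i => ?_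
      simp only [sendMem, hp j, hph, if_neg hl]
      split_ifs with h1 h2 h2
      · rw [length_encodeVerdict]
      · exact absurd h1.1 h2
      · exact Nat.zero_le _
      · exact Nat.zero_le _
  | done =>
    refine (Finset.sum_eq_zero fun j _ => Finset.sum_eq_zero fun i _ => ?_).le
    simp [sendMem, hp j, hph]

theorem bits_le (hs : Invariant M tree s) (he : (protocol n tree k₀).Exchanging s) :
    (protocol n tree k₀).bits s ≤ bitPrice tree n (s 0) := by
  unfold Protocol.bits
  rw [if_pos he]
  exact sum_length_le hs

theorem time_le_bitPrice (hs : Invariant M tree s) (he : (protocol n tree k₀).Exchanging s) :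
    (protocol n tree k₀).time s ≤ bitPrice tree n (s 0) := by
  unfold Protocol.time
  rw [if_pos he]
  exact (Nat.sInf_le (canTransmit_sum _)).trans (sum_length_le hs)

/-- The messages that are sent along one level of the tree are transmitted in parallel. -/
theorem time_le_of_tree {l : ℕ} (hs : Invariant M true s) (hph : (s 0).phase = .work l)
    (hl : l < depth true n) (he : (protocol n true k₀).Exchanging s) :
    (protocol n true k₀).time s ≤ 2 * ((s 0).k + Nat.clog 2 n + 5) := by
  unfold Protocol.time
  rw [if_pos he]
  have hlen : ∀ j i, ((protocol n true k₀).messages s j i).length =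
      if sendsTo true l j i then 2 * ((s 0).k + Nat.clog 2 n + 5) else 0 :=
    length_sendMem_work hs hph hl
  refine Nat.sInf_le (canTransmit_of_disjoint _ (fun j i => ?_) ?_)
  · rw [hlen]; split_ifs <;> simp
  · intro j i j' i' h h' hne
    have hsend : ∀ {j i}, (protocol n true k₀).messages s j i ≠ [] →
        j.val % 2 ^ (l + 1) = 2 ^ l ∧ i.val + 2 ^ l = j.val := by
      intro j i h
      have := List.length_pos_iff.2 h
      rw [hlen] at this
      split_ifs at this with hst
      · simpa [sendsTo] using hst
      · exact absurd this (lt_irrefl _)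
    obtain ⟨hj, hi⟩ := hsend h
    obtain ⟨hj', hi'⟩ := hsend h'
    have hpos : 0 < 2 ^ l := by positivity
    -- Receivers are multiples of 2^(l+1) and senders are odd multiples of 2^l, so no party is both;
    -- equal senders or equal receivers force equal pairs.
    have hi0 : ∀ {a b : ℕ}, b % 2 ^ (l + 1) = 2 ^ l → a + 2 ^ l = b → a % 2 ^ (l + 1) = 0 := by
      intro a b hb hab
      have hd := Nat.mod_add_div b (2 ^ (l + 1))
      rw [hb] at hd
      have : a = 2 ^ (l + 1) * (b / 2 ^ (l + 1)) := by omega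
      rw [this, Nat.mul_mod_right]
    have h1 := hi0 hj hi
    have h2 := hi0 hj' hi'
    refine ⟨?_, ?_, ?_, ?_⟩
    · rintro rfl
      exact hne (by rw [Fin.ext (a := i) (b := i') (by omega)])
    · rintro rfl; omega
    · rintro rfl; omega
    · rintro rfl
      exact hne (by rw [Fin.ext (a := j) (b := j') (by omega)])

/-! ### Tariffs -/

/-- The tariff for the number of bits. -/
def bitTariff (tree : Bool) (n : ℕ) : Tariff where
  coin := 0
  bern k := (n * (k + Nat.clog 2 n + 3) : ℕ)
  sync := n
  start := n
  work l k := (if l < depth tree n then senders tree n l * (2 * (k + Nat.clog 2 n + 5))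
    else n * 2 : ℕ)

/-- The tariff for the parallel time. -/
def timeTariff (n : ℕ) : Tariff where
  coin := 0
  bern k := (n * (k + Nat.clog 2 n + 3) : ℕ)
  sync := n
  start := n
  work l k := (if l < depth true n then 2 * (k + Nat.clog 2 n + 5) else n * 2 : ℕ)

/-- The tariff for a combination of the number of random bits and the number of rounds. -/
def flatTariff (c r : ℕ) : Tariff where
  coin := c
  bern _ := r
  sync := r
  start := r
  work _ _ := r

theorem bitTariff_covers :
    (bitTariff tree n).Covers M tree k₀ (protocol n tree k₀).bits where
  halted s _ h := if_neg fun he => he.1 h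
  toss s _ _ h := by
    have : (protocol n tree k₀).bits s = 0 := if_neg fun he => he.2 h
    simp [this]
  exchange s hs he := by
    have h : (((protocol n tree k₀).bits s : ℕ) : ℝ≥0∞) ≤ (bitPrice tree n (s 0) : ℕ) := by
      exact_mod_cast bits_le hs he
    refine h.trans (le_of_eq ?_)
    unfold bitPrice Tariff.price
    cases (s 0).phase <;> simp [bitTariff]

theorem timeTariff_covers :
    (timeTariff n).Covers M true k₀ (protocol n true k₀).time where
  halted s _ h := if_neg fun he => he.1 h
  toss s _ _ h := by
    have : (protocol n true k₀).time s = 0 := if_neg fun he => he.2 h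
    simp [this]
  exchange s hs he := by
    have h : (((protocol n true k₀).time s : ℕ) : ℝ≥0∞) ≤ (bitPrice true n (s 0) : ℕ) := by
      exact_mod_cast time_le_bitPrice hs he
    unfold Tariff.price
    unfold bitPrice at h
    cases hph : (s 0).phase with
    | bern => rw [hph] at h; exact h
    | bernSync => rw [hph] at h; exact h
    | start => rw [hph] at h; exact h
    | work l =>
      rw [hph] at h
      simp only [timeTariff] at h ⊢
      by_cases hl : l < depth true n
      · rw [if_pos hl]
        exact_mod_cast time_le_of_tree hs hph hl he
      · rwa [if_neg hl] at h ⊢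
    | done => exact absurd (hs.halted_iff.2 hph) he.1

theorem price_flatTariff (c r : ℕ) (hs : Invariant M tree s)
    (he : (protocol n tree k₀).Exchanging s) : (flatTariff c r).price (s 0) = r := by
  unfold Tariff.price
  cases hph : (s 0).phase with
  | done => exact absurd (hs.halted_iff.2 hph) he.1
  | _ => rfl

theorem roundTariff_covers :
    (flatTariff 0 1).Covers M tree k₀ (protocol n tree k₀).rounds where
  halted s _ h := if_neg fun he => he.1 h
  toss s _ _ h := by
    have : (protocol n tree k₀).rounds s = 0 := if_neg fun he => he.2 h
    simp [this]
  exchange s hs he := by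
    rw [price_flatTariff 0 1 hs he]
    unfold Protocol.rounds
    rw [if_pos he]

theorem coinTariff_covers :
    (flatTariff 1 0).Covers M tree k₀ (protocol n tree k₀).coins where
  halted s _ h := if_pos h
  toss s _ _ _ := by simp [flatTariff]
  exchange s hs he := by
    have : (protocol n tree k₀).coins s = 0 := by
      unfold Protocol.coins
      rw [if_neg he.1, Finset.card_eq_zero, Finset.filter_eq_empty_iff]
      exact fun i _ hi => he.2 ⟨i, hi⟩
    simp [this]

open Classical in
-- A step before the end either consumes at least one coin or is an exchange. A finite total at
-- these prices means a finite expected number of steps.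
theorem stepTariff_covers : (flatTariff 1 1).Covers M tree k₀
    fun s => if (protocol n tree k₀).Halted s then 0 else 1 where
  halted s _ h := if_pos h
  toss s _ hh h := by
    obtain ⟨i, hi⟩ := h
    rw [if_neg hh]
    simp only [flatTariff, Nat.cast_one, one_mul]
    have : 1 ≤ (protocol n tree k₀).coins s := by
      unfold Protocol.coins
      rw [if_neg hh]
      exact Finset.card_pos.2 ⟨i, Finset.mem_filter.2 ⟨Finset.mem_univ i, hi⟩⟩
    exact_mod_cast this
  exchange s hs he := by
    rw [price_flatTariff 1 1 hs he, if_neg he.1]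

end

end GHZ

/-! ### Numerical estimates -/

namespace GHZ

noncomputable section

/-! ### Sums over the passages through the inner loop -/

/-- Telescoping: F majorises the tails of the series, so no closed form for the sum is needed. -/
theorem tsum_ofReal_le {g F : ℕ → ℝ} (hg : ∀ i, 0 ≤ g i) (hF : ∀ i, 0 ≤ F i)
    (h : ∀ i, g i + F (i + 1) ≤ F i) : ∑' i, ENNReal.ofReal (g i) ≤ ENNReal.ofReal (F 0) := by
  refine ENNReal.tsum_le_of_sum_range_le fun N => ?_
  rw [← ENNReal.ofReal_sum_of_nonneg fun i _ => hg i]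
  refine ENNReal.ofReal_le_ofReal ?_
  have : ∑ i ∈ Finset.range N, g i + F N ≤ F 0 := by
    induction N with
    | zero => simp
    | succ N ih => rw [Finset.sum_range_succ]; linarith [h N]
  linarith [hF N]

theorem succ_sq_le_two_pow (d : ℕ) : (d + 1) ^ 2 ≤ 4 * 2 ^ d := by
  induction d with
  | zero => norm_num
  | succ d ih =>
    rcases Nat.lt_or_ge d 2 with h | h
    · interval_cases d <;> norm_num
    · rw [pow_succ 2 d]
      nlinarith

/-- With k = n + d one has k ≤ n(d+1) and (d+1)² ≤ 4·2^d. -/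
theorem sq_mul_two_pow_le {n k : ℕ} (hn : 1 ≤ n) (hk : n ≤ k) :
    k ^ 2 * 2 ^ n ≤ 4 * n ^ 2 * 2 ^ k := by
  obtain ⟨d, rfl⟩ := Nat.exists_eq_add_of_le hk
  have h1 : n + d ≤ n * (d + 1) := by nlinarith
  calc (n + d) ^ 2 * 2 ^ n ≤ (n * (d + 1)) ^ 2 * 2 ^ n := by gcongr
    _ = n ^ 2 * 2 ^ n * (d + 1) ^ 2 := by ring
    _ ≤ n ^ 2 * 2 ^ n * (4 * 2 ^ d) := by gcongr; exact succ_sq_le_two_pow d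
    _ = 4 * n ^ 2 * 2 ^ (n + d) := by ring

/-- A bound for the probability that the precision `k` does not suffice. -/
def undecided (n k : ℕ) : ℝ≥0∞ := min 1 (2 ^ n * ENNReal.ofReal (7 / 2 ^ k))

/-- One polynomial bound covers both regimes, k < n trivially and k ≥ n through the exponential
decay (28 = 7·4). Quadratic decay is enough to sum over doubling precisions even with weight k. -/
theorem undecided_le {n k : ℕ} (hn : 1 ≤ n) (hk : 1 ≤ k) :
    undecided n k ≤ ENNReal.ofReal (28 * n ^ 2 / k ^ 2) := by
  have hk0 : (0 : ℝ) < k := by exact_mod_cast hk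
  rcases lt_or_ge k n with h | h
  · refine (min_le_left _ _).trans ?_
    rw [← ENNReal.ofReal_one]
    refine ENNReal.ofReal_le_ofReal ?_
    rw [le_div_iff₀ (by positivity)]
    have : (k : ℝ) ≤ n := by exact_mod_cast h.le
    nlinarith
  · refine (min_le_right _ _).trans ?_
    have h2 : (2 : ℝ≥0∞) ^ n = ENNReal.ofReal (2 ^ n) := by
      rw [ENNReal.ofReal_pow (by norm_num)]; simp
    rw [h2, ← ENNReal.ofReal_mul (by positivity)]
    refine ENNReal.ofReal_le_ofReal ?_
    rw [mul_div_assoc', div_le_div_iff₀ (by positivity) (by positivity)]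
    have : (k : ℝ) ^ 2 * 2 ^ n ≤ 4 * n ^ 2 * 2 ^ k := by exact_mod_cast sq_mul_two_pow_le hn h
    nlinarith

theorem two_pow_clog_le {n : ℕ} (hn : 1 ≤ n) : 2 ^ Nat.clog 2 n ≤ 2 * n := by
  rcases hn.eq_or_lt with rfl | h
  · simp
  · have h1 := Nat.pow_pred_clog_lt_self (b := 2) (by norm_num) h
    have h2 : 0 < Nat.clog 2 n := Nat.clog_pos (by norm_num) h
    obtain ⟨m, hm⟩ := Nat.exists_eq_succ_of_ne_zero h2.ne'
    rw [hm] at h1 ⊢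
    rw [Nat.pred_succ] at h1
    rw [pow_succ]
    omega

/-- The sums of the probabilities to reach the successive precisions. -/
structure Doubling (n k₀ σ : ℕ) : Prop where
  le : k₀ ≤ n
  sum_le : ∑' i, undecided n (2 ^ i * k₀) ≤ σ
  sum_mul_le : ∑' i, ((2 ^ i * k₀ : ℕ) : ℝ≥0∞) * undecided n (2 ^ i * k₀) ≤ (58 * n : ℕ)

theorem undecided_tail {n k : ℕ} (hn : 1 ≤ n) (hk : n ≤ k) (i : ℕ) :
    undecided n (2 ^ i * k) ≤ ENNReal.ofReal (28 / 4 ^ i) := by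
  have hk1 : 1 ≤ k := hn.trans hk
  refine (undecided_le hn (Nat.one_le_iff_ne_zero.2 (by positivity))).trans ?_
  refine ENNReal.ofReal_le_ofReal ?_
  push_cast
  have hk0 : (0 : ℝ) < k := by exact_mod_cast hn.trans hk
  have h : (n : ℝ) ≤ k := by exact_mod_cast hk
  rw [div_le_div_iff₀ (by positivity) (by positivity), mul_pow, ← pow_mul, mul_comm i 2, pow_mul]
  norm_num
  have : (n : ℝ) ^ 2 ≤ k ^ 2 := by gcongr
  have h4 : (0 : ℝ) < 4 ^ i := by positivity
  nlinarith

theorem tsum_undecided_tail_le {n k : ℕ} (hn : 1 ≤ n) (hk : n ≤ k) :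
    ∑' i, undecided n (2 ^ i * k) ≤ (38 : ℕ) := by
  refine (ENNReal.tsum_le_tsum fun i => undecided_tail hn hk i).trans ?_
  -- The geometric sum is 28·4/3 < 38.
  refine (tsum_ofReal_le (F := fun i => 38 / 4 ^ i) (fun i => by positivity)
    (fun i => by positivity) fun i => ?_).trans ?_
  · rw [pow_succ, div_add_div _ _ (by positivity) (by positivity),
      div_le_div_iff₀ (by positivity) (by positivity)]
    have h4 : (0 : ℝ) < 4 ^ i := by positivity
    nlinarith [sq_nonneg ((4 : ℝ) ^ i), mul_pos (mul_pos h4 h4) h4]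
  · simp

theorem tsum_mul_undecided_tail_le {n k : ℕ} (hn : 1 ≤ n) (hk : n ≤ k) :
    ∑' i, ((2 ^ i * k : ℕ) : ℝ≥0∞) * undecided n (2 ^ i * k) ≤
      ENNReal.ofReal (56 * n ^ 2 / k) := by
  have hk0 : (0 : ℝ) < k := by exact_mod_cast hn.trans hk
  have h : ∀ i, ((2 ^ i * k : ℕ) : ℝ≥0∞) * undecided n (2 ^ i * k) ≤
      ENNReal.ofReal (28 * n ^ 2 / k / 2 ^ i) := by
    intro i
    refine (mul_le_mul_right (undecided_le hn
      (Nat.one_le_iff_ne_zero.2 (by have := hn.trans hk; positivity))) _).trans ?_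
    rw [← ENNReal.ofReal_natCast, ← ENNReal.ofReal_mul (by positivity)]
    refine ENNReal.ofReal_le_ofReal (le_of_eq ?_)
    push_cast
    field_simp
  refine (ENNReal.tsum_le_tsum h).trans ?_
  refine (tsum_ofReal_le (F := fun i => 56 * n ^ 2 / k / 2 ^ i) (fun i => by positivity)
    (fun i => by positivity) fun i => le_of_eq ?_).trans ?_
  · rw [pow_succ]; field_simp; ring
  · simp

theorem doubling_self {n : ℕ} (hn : 1 ≤ n) : Doubling n n 38 where
  le := le_rfl
  sum_le := tsum_undecided_tail_le hn le_rfl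
  sum_mul_le := by
    have hn0 : (0 : ℝ) < n := by exact_mod_cast hn
    refine (tsum_mul_undecided_tail_le hn le_rfl).trans ?_
    rw [← ENNReal.ofReal_natCast]
    refine ENNReal.ofReal_le_ofReal ?_
    rw [div_le_iff₀ hn0]
    push_cast
    nlinarith

/-- The first ⌈log₂ n⌉ passages are counted with probability 1; from 2^⌈log₂ n⌉ ≥ n on, the tail
estimates apply. In the weighted sum the two parts contribute 2n and 56n. -/
theorem doubling_one {n : ℕ} (hn : 1 ≤ n) : Doubling n 1 (Nat.clog 2 n + 38) where
  le := hn
  sum_le := by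
    simp only [mul_one]
    rw [← Summable.sum_add_tsum_nat_add' (k := Nat.clog 2 n) ENNReal.summable]
    push_cast
    gcongr
    · refine (Finset.sum_le_card_nsmul _ _ 1 fun i _ => min_le_left _ _).trans ?_
      simp
    · simp only [pow_add]
      exact_mod_cast tsum_undecided_tail_le hn (Nat.le_pow_clog (b := 2) (by norm_num) n)
  sum_mul_le := by
    simp only [mul_one]
    rw [← Summable.sum_add_tsum_nat_add' (k := Nat.clog 2 n) ENNReal.summable]
    have e : 58 * n = 2 * n + 56 * n := by ring
    rw [e, Nat.cast_add]
    refine add_le_add ?_ ?_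
    · refine (Finset.sum_le_sum (g := fun i => ((2 ^ i : ℕ) : ℝ≥0∞)) fun i _ =>
        (mul_le_mul_right (min_le_left _ _) _).trans (mul_one _).le).trans ?_
      rw [← Nat.cast_sum, Nat.cast_le, Nat.geomSum_eq (le_refl 2)]
      have := two_pow_clog_le hn
      omega
    · simp only [pow_add]
      have hle := Nat.le_pow_clog (b := 2) (by norm_num) n
      refine (tsum_mul_undecided_tail_le hn hle).trans ?_
      rw [← ENNReal.ofReal_natCast]
      refine ENNReal.ofReal_le_ofReal ?_
      have hle' : (n : ℝ) ≤ ((2 ^ Nat.clog 2 n : ℕ) : ℝ) := by exact_mod_cast hle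
      have hn0 : (0 : ℝ) < n := by exact_mod_cast hn
      rw [div_le_iff₀ (by linarith)]
      push_cast at hle' ⊢
      nlinarith

/-! ### Bounds for the total price -/

theorem bern_weight_le (i : ℕ) :
    min 1 (ENNReal.ofReal (2 * (3 / 2 ^ (1 + i)))) ≤ ENNReal.ofReal (3 / 2 ^ i) := by
  refine (min_le_right _ _).trans (ENNReal.ofReal_le_ofReal (le_of_eq ?_))
  rw [pow_add]; field_simp

theorem tsum_bern_weight_le :
    ∑' i : ℕ, min 1 (ENNReal.ofReal (2 * (3 / 2 ^ (1 + i)))) ≤ 6 := by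
  refine (ENNReal.tsum_le_tsum bern_weight_le).trans ?_
  refine (tsum_ofReal_le (F := fun i => 6 / 2 ^ i) (fun i => by positivity)
    (fun i => by positivity) fun i => le_of_eq ?_).trans ?_
  · rw [pow_succ]; field_simp; norm_num
  · simp

theorem tsum_mul_bern_weight_le :
    ∑' i : ℕ, ((1 + i + 1 : ℕ) : ℝ≥0∞) * min 1 (ENNReal.ofReal (2 * (3 / 2 ^ (1 + i)))) ≤ 18 := by
  have h : ∀ i : ℕ, ((1 + i + 1 : ℕ) : ℝ≥0∞) * min 1 (ENNReal.ofReal (2 * (3 / 2 ^ (1 + i)))) ≤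
      ENNReal.ofReal (3 * (i + 2) / 2 ^ i) := by
    intro i
    refine (mul_le_mul_right (bern_weight_le i) _).trans ?_
    rw [← ENNReal.ofReal_natCast, ← ENNReal.ofReal_mul (by positivity)]
    refine ENNReal.ofReal_le_ofReal (le_of_eq ?_)
    push_cast
    ring
  refine (ENNReal.tsum_le_tsum h).trans ?_
  -- The majorant is the exact tail of ∑ 3(i+2)/2^i: 3(i+2) + 3(i+4) = 6(i+3).
  refine (tsum_ofReal_le (F := fun i => 6 * (i + 3) / 2 ^ i) (fun i => by positivity)
    (fun i => by positivity) fun i => le_of_eq ?_).trans ?_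
  · rw [pow_succ]; push_cast; field_simp; ring
  · simp; norm_num

/-- The prices in `T` are at most linear functions of the precision. -/
structure Tariff.Linear (T : Tariff) (d c a' b' e a b : ℕ) : Prop where
  coin : T.coin ≤ c
  bern : ∀ k : ℕ, T.bern k + T.sync ≤ (a' * k + b' : ℕ)
  start : T.start ≤ e
  rest : ∀ k : ℕ, T.rest d 0 k ≤ (a * k + b : ℕ)

/-- A linear price needs only the expected sum of the precisions, at most 58n, and the expected
number σ of further passages. A repetition at 2k with k new digits costs at most (2a + c)k + b. -/
theorem Tariff.Linear.round_le {T : Tariff} {d c a' b' e a b n k₀ σ : ℕ}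
    (h : T.Linear d c a' b' e a b) (hσ : Doubling n k₀ σ) :
    T.round d n k₀ ≤ (c * (1 + 61 * n) + e + 117 * a * n + b * (1 + σ) : ℕ) := by
  have h1 : ∀ i : ℕ, T.again d (2 ^ i * k₀) *
      min 1 (2 ^ n * ENNReal.ofReal (7 / 2 ^ (2 ^ i * k₀))) ≤
      (2 * a + c : ℕ) * (((2 ^ i * k₀ : ℕ) : ℝ≥0∞) * undecided n (2 ^ i * k₀)) +
        b * undecided n (2 ^ i * k₀) := by
    intro i
    change T.again d (2 ^ i * k₀) * undecided n (2 ^ i * k₀) ≤ _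
    rw [← mul_assoc, ← add_mul]
    gcongr
    unfold Tariff.again
    refine (add_le_add (h.rest _) (mul_le_mul_left h.coin _)).trans (le_of_eq ?_)
    push_cast
    ring
  have h2 : (T.coin + (T.start + T.coin * (2 * n + k₀) + T.rest d 0 k₀)) ≤
      (c + (e + c * (2 * n + n) + (a * n + b)) : ℕ) := by
    refine le_trans (add_le_add h.coin (add_le_add (add_le_add h.start
      (mul_le_mul_left h.coin _)) (h.rest _))) ?_
    have := hσ.le
    norm_cast
    gcongr
  have h3 : ∑' i, T.again d (2 ^ i * k₀) *
      min 1 (2 ^ n * ENNReal.ofReal (7 / 2 ^ (2 ^ i * k₀))) ≤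
      ((2 * a + c) * (58 * n) + b * σ : ℕ) := by
    refine (ENNReal.tsum_le_tsum h1).trans ?_
    have e : (((2 * a + c) * (58 * n) + b * σ : ℕ) : ℝ≥0∞) =
        (2 * a + c : ℕ) * (58 * n : ℕ) + b * σ := by push_cast; ring
    rw [ENNReal.tsum_add, ENNReal.tsum_mul_left, ENNReal.tsum_mul_left, e]
    exact add_le_add (mul_le_mul_right hσ.sum_mul_le _) (mul_le_mul_right hσ.sum_le _)
  unfold Tariff.round
  refine (add_le_add h2 h3).trans ?_
  norm_cast
  exact le_of_eq (by ring)

theorem Tariff.Linear.total_le {T : Tariff} {d c a' b' e a b n k₀ σ : ℕ}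
    (h : T.Linear d c a' b' e a b) (hσ : Doubling n k₀ σ) (hn : 1 ≤ n) :
    T.total d n k₀ ≤
      (131 * (c * n) + 19 * a' + 7 * b' + 2 * e + 234 * (a * n) + 2 * (b * (1 + σ)) : ℕ) := by
  have h1 : ∀ i : ℕ, (T.coin + (T.bern (1 + i + 1) + T.sync)) *
      min 1 (ENNReal.ofReal (2 * (3 / 2 ^ (1 + i)))) ≤
      a' * (((1 + i + 1 : ℕ) : ℝ≥0∞) * min 1 (ENNReal.ofReal (2 * (3 / 2 ^ (1 + i))))) +
        (b' + c : ℕ) * min 1 (ENNReal.ofReal (2 * (3 / 2 ^ (1 + i)))) := by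
    intro i
    rw [← mul_assoc, ← add_mul]
    refine mul_le_mul_left ?_ _
    refine (add_le_add h.coin (h.bern _)).trans (le_of_eq ?_)
    push_cast
    ring
  have h2 : ∑' i : ℕ, (T.coin + (T.bern (1 + i + 1) + T.sync)) *
      min 1 (ENNReal.ofReal (2 * (3 / 2 ^ (1 + i)))) ≤ (a' * 18 + (b' + c) * 6 : ℕ) := by
    refine (ENNReal.tsum_le_tsum h1).trans ?_
    rw [ENNReal.tsum_add, ENNReal.tsum_mul_left, ENNReal.tsum_mul_left]
    refine (add_le_add (mul_le_mul_right tsum_mul_bern_weight_le _)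
      (mul_le_mul_right tsum_bern_weight_le _)).trans (le_of_eq ?_)
    push_cast
    ring
  unfold Tariff.total
  refine (add_le_add (add_le_add (add_le_add h.coin (h.bern 1)) h2)
    (mul_le_mul_right (h.round_le hσ) 2)).trans ?_
  norm_cast
  nlinarith [Nat.mul_le_mul_left c hn]

theorem bitTariff_linear (tree : Bool) (n : ℕ) :
    (bitTariff tree n).Linear (depth tree n) 0 n (n * (Nat.clog 2 n + 4)) n (2 * n)
      (2 * n * (Nat.clog 2 n + 6)) where
  coin := by simp [bitTariff]
  bern k := by
    simp only [bitTariff]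
    norm_cast
    exact le_of_eq (by ring)
  start := by simp [bitTariff]
  rest k := by
    unfold Tariff.rest
    simp only [bitTariff]
    rw [← Nat.cast_sum, Nat.cast_le, ← Finset.range_eq_Ico, Finset.sum_range_succ,
      if_neg (lt_irrefl _), Finset.sum_congr rfl fun l hl => if_pos (Finset.mem_range.1 hl),
      ← Finset.sum_mul]
    -- All levels together have at most n senders; the final announcement adds 2n bits.
    have := Nat.mul_le_mul_right (2 * (k + Nat.clog 2 n + 5)) (sum_senders_le (n := n) tree)
    refine (Nat.add_le_add_right this _).trans (le_of_eq ?_)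
    ring

theorem timeTariff_linear (n : ℕ) :
    (timeTariff n).Linear (Nat.clog 2 n) 0 n (n * (Nat.clog 2 n + 4)) n (2 * Nat.clog 2 n)
      (2 * Nat.clog 2 n * (Nat.clog 2 n + 5) + 2 * n) where
  coin := by simp [timeTariff]
  bern k := by
    simp only [timeTariff]
    norm_cast
    exact le_of_eq (by ring)
  start := by simp [timeTariff]
  rest k := by
    unfold Tariff.rest
    have hd : depth true n = Nat.clog 2 n := rfl
    simp only [timeTariff, hd]
    rw [← Nat.cast_sum, Nat.cast_le, ← Finset.range_eq_Ico, Finset.sum_range_succ,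
      if_neg (lt_irrefl _), Finset.sum_congr rfl fun l hl => if_pos (Finset.mem_range.1 hl),
      Finset.sum_const, Finset.card_range, smul_eq_mul]
    exact le_of_eq (by ring)

theorem flatTariff_linear (d c r : ℕ) :
    (flatTariff c r).Linear d c 0 (2 * r) r 0 ((d + 1) * r) where
  coin := le_rfl
  bern k := by
    simp only [flatTariff]
    norm_cast
    exact le_of_eq (by ring)
  start := le_rfl
  rest k := by
    unfold Tariff.rest
    simp only [flatTariff]
    simp

end

end GHZ

/-! ### Exact sampling and final bounds -/

namespace GHZ

noncomputable section

variable {n : ℕ}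

/-! ### Exactness -/

theorem prob_nonneg (M : Fin n → Measurement) (y : Fin n → ℤˣ) : 0 ≤ prob M y := by
  rw [prob_eq]
  exact add_nonneg (mul_nonneg (bernParam_nonneg M) (component_nonneg _ _ _))
    (mul_nonneg (sub_nonneg.2 (bernParam_le_one M)) (component_nonneg _ _ _))

theorem sum_prob [NeZero n] (M : Fin n → Measurement) :
    ∑ y, ENNReal.ofReal (prob M y) = 1 := by
  rw [← ENNReal.ofReal_sum_of_nonneg fun y _ => prob_nonneg M y]
  simp only [prob_eq, Finset.sum_add_distrib, ← Finset.mul_sum, sum_component]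
  simp

/-- A halted configuration shows exactly one output vector, so these events partition the
configurations. -/
theorem sum_outputs [NeZero n] {tree : Bool} {k₀ : ℕ} (M : Fin n → Measurement) (t : ℕ) :
    ∑ x : Fin n → ℤˣ, ((protocol n tree k₀).law M t).toOuterMeasure
      {s | ∀ i, (protocol n tree k₀).out i (s i) = some (x i)} +
      ((protocol n tree k₀).law M t).toOuterMeasure {s | ¬ (protocol n tree k₀).Halted s} = 1 := by
  classical
  simp only [← PMF.mean_indicator]
  rw [← PMF.mean_sum, ← PMF.mean_add]
  refine Eq.trans (congrArg _ ?_) (PMF.mean_const ((protocol n tree k₀).law M t) 1)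
  funext s
  by_cases h : (protocol n tree k₀).Halted s
  · choose x hx using fun i => Option.isSome_iff_exists.1 (h i)
    rw [Finset.sum_eq_single x]
    · have h1 : s ∈ {s : (protocol n tree k₀).Config |
          ∀ i, (protocol n tree k₀).out i (s i) = some (x i)} := hx
      have h2 : s ∉ {s | ¬ (protocol n tree k₀).Halted s} := not_not.2 h
      rw [Set.indicator_of_mem h1, Set.indicator_of_notMem h2]
      simp
    · intro y _ hy
      refine Set.indicator_of_notMem (fun h' => hy ?_) _
      funext i
      exact Option.some_injective _ ((h' i).symm.trans (hx i))
    · simp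
  · rw [Finset.sum_eq_zero]
    · have h2 : s ∈ {s | ¬ (protocol n tree k₀).Halted s} := h
      rw [Set.indicator_of_mem h2]
      simp
    · intro y _
      refine Set.indicator_of_notMem (fun h' => h fun i => ?_) _
      rw [h' i]; rfl

theorem one_le [NeZero n] : 1 ≤ n := Nat.one_le_iff_ne_zero.2 (NeZero.ne n)

/-- The protocol terminates almost surely. -/
theorem tendsto_not_halted [NeZero n] {tree : Bool} {k₀ σ : ℕ} (hσ : Doubling n k₀ σ)
    (M : Fin n → Measurement) :
    Filter.Tendsto (fun t => ((protocol n tree k₀).law M t).toOuterMeasure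
      {s | ¬ (protocol n tree k₀).Halted s}) Filter.atTop (nhds 0) := by
  classical
  have h := (expected_le_total (M := M) (tree := tree) (k₀ := k₀) stepTariff_covers).trans
    ((flatTariff_linear (depth tree n) 1 1).total_le hσ one_le)
  have hne := ne_top_of_le_ne_top (ENNReal.natCast_ne_top _) h
  -- The expected number of steps is the sum over t of the probability of not having halted; the
  -- terms of a convergent series tend to zero.
  refine (ENNReal.tendsto_atTop_zero_of_tsum_ne_top hne).congr fun t => ?_
  rw [← PMF.mean_indicator]
  refine tsum_congr fun s => ?_
  congr 1
  by_cases hs : (protocol n tree k₀).Halted s <;> simp [hs]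

/-- The outputs have exactly the GHZ distribution. -/
theorem samples [NeZero n] {tree : Bool} {k₀ σ : ℕ} (hσ : Doubling n k₀ σ)
    (M : Fin n → Measurement) : (protocol n tree k₀).Samples M (prob M) := by
  classical
  intro x
  set r := fun t => ((protocol n tree k₀).law M t).toOuterMeasure
      {s | ¬ (protocol n tree k₀).Halted s} with hr
  have h0 := tendsto_not_halted (tree := tree) hσ M
  have hlow : Filter.Tendsto (fun t => ENNReal.ofReal (prob M x) - r t) Filter.atTop
      (nhds (ENNReal.ofReal (prob M x))) := by
    have := ENNReal.Tendsto.sub (tendsto_const_nhds (x := ENNReal.ofReal (prob M x))) h0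
      (Or.inl ENNReal.ofReal_ne_top)
    simpa using this
  refine tendsto_of_tendsto_of_tendsto_of_le_of_le hlow tendsto_const_nhds (fun t => ?_)
    fun t => outputs_le_prob x t
  have h1 := sum_outputs (tree := tree) (k₀ := k₀) M t
  have h2 := sum_prob M
  rw [← Finset.add_sum_erase _ _ (Finset.mem_univ x)] at h1 h2
  have hfin : ∑ y ∈ Finset.univ.erase x, ENNReal.ofReal (prob M y) ≠ ⊤ :=
    ENNReal.sum_ne_top.2 fun _ _ => ENNReal.ofReal_ne_top
  rw [tsub_le_iff_right]
  -- The lower bound for x follows from the upper bounds for all other vectors: both families sum to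
  -- 1, up to the probability `r t` of not having halted.
  refine (ENNReal.add_le_add_iff_right hfin).1 ?_
  rw [h2, ← h1, add_right_comm]
  gcongr with y
  exact outputs_le_prob y t

/-! ### The bounds -/

/-- With L = ⌈log₂ n⌉, the product is at most 39·6·(L+1)² ≤ 234·4·2^L ≤ 234·8·n. -/
theorem log_factor_le {n : ℕ} (hn : 1 ≤ n) :
    (Nat.clog 2 n + 39) * (Nat.clog 2 n + 6) ≤ 1872 * n := by
  have h1 := succ_sq_le_two_pow (Nat.clog 2 n)
  have h2 := two_pow_clog_le hn
  nlinarith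

/-- ⌈log₂ n⌉ ≤ log₂ n + 1 ≤ 2 log n / log 2 for n ≥ 2, and 2 / log 2 < 3. -/
theorem clog_le_log {n : ℕ} (hn : 2 ≤ n) : (Nat.clog 2 n : ℝ) ≤ 3 * Real.log n := by
  have h1 : Nat.clog 2 n ≤ Nat.log 2 n + 1 := by
    exact Nat.clog_le_of_le_pow (Nat.lt_pow_succ_log_self (by norm_num) n).le
  have h2 : (Nat.log 2 n : ℝ) * Real.log 2 ≤ Real.log n := by
    rw [← Real.log_pow]
    refine Real.log_le_log (by positivity) ?_
    exact_mod_cast Nat.pow_log_le_self 2 (by omega)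
  have h3 : Real.log 2 ≤ Real.log n :=
    Real.log_le_log (by norm_num) (by exact_mod_cast hn)
  have h4 := Real.log_two_gt_d9
  have h5 : (Nat.clog 2 n : ℝ) ≤ Nat.log 2 n + 1 := by exact_mod_cast h1
  have h6 : (0 : ℝ) ≤ Nat.log 2 n := Nat.cast_nonneg _
  nlinarith

theorem le_ofReal_of_le {x : ℝ≥0∞} {m : ℕ} {r : ℝ} (h : x ≤ m) (hr : (m : ℝ) ≤ r) :
    x ≤ ENNReal.ofReal r := by
  refine h.trans ?_
  rw [← ENNReal.ofReal_natCast]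
  exact ENNReal.ofReal_le_ofReal hr

section Bounds

variable [NeZero n] (M : Fin n → Measurement) {tree : Bool} {k₀ σ : ℕ}

/-- Transmitted digits cost n times the expected precision, of order n². The overhead of log n bits
per number, over at most about log n passages, adds n log² n, which `log_factor_le` absorbs. -/
theorem expectedBits_le (hσ : Doubling n k₀ σ) (h : σ ≤ Nat.clog 2 n + 38) :
    (protocol n tree k₀).expectedBits M ≤ ENNReal.ofReal (100000 * (n : ℝ) ^ 2) := by
  refine le_ofReal_of_le ((expected_le_total (M := M) bitTariff_covers).trans
    ((bitTariff_linear tree n).total_le hσ one_le)) ?_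
  have hn : 1 ≤ n := one_le
  have h1 := log_factor_le hn
  norm_cast
  set L := Nat.clog 2 n
  have h39 : 1 + σ ≤ L + 39 := by omega
  calc 131 * (0 * n) + 19 * n + 7 * (n * (L + 4)) + 2 * n + 234 * (2 * n * n) +
        2 * (2 * n * (L + 6) * (1 + σ))
      ≤ 131 * (0 * n) + 19 * n + 7 * (n * (L + 4)) + 2 * n + 234 * (2 * n * n) +
        2 * (2 * n * (L + 6) * (L + 39)) := by gcongr _ + 2 * (_ * ?_)
    _ = n * (19 + 7 * (L + 4) + 2 + 468 * n + 4 * ((L + 39) * (L + 6))) := by ring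
    _ ≤ n * (100000 * n) := by gcongr; nlinarith
    _ = 100000 * n ^ 2 := by ring

/-- Three contributions: log n levels times an expected precision of order n, announcements of order
n in about log n passages, and log³ n overhead, reduced to n log n by `log_factor_le`. -/
theorem expectedTime_le (hσ : Doubling n k₀ σ) (h : σ ≤ Nat.clog 2 n + 38) (hn : 2 ≤ n) :
    (protocol n true k₀).expectedTime M ≤ ENNReal.ofReal (100000 * (n * Real.log n)) := by
  have h1 := log_factor_le (one_le (n := n))
  have hL : 1 ≤ Nat.clog 2 n := Nat.clog_pos (by norm_num) hn
  have hlog := clog_le_log hn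
  have hbound : 131 * (0 * n) + 19 * n + 7 * (n * (Nat.clog 2 n + 4)) + 2 * n +
      234 * (2 * Nat.clog 2 n * n) +
      2 * ((2 * Nat.clog 2 n * (Nat.clog 2 n + 5) + 2 * n) * (1 + σ)) ≤
        30000 * (n * Nat.clog 2 n) := by
    generalize Nat.clog 2 n = L at *
    have hnL : n ≤ n * L := by nlinarith
    have h39 : 1 + σ ≤ L + 39 := by omega
    have h56 : L + 5 ≤ L + 6 := by omega
    calc _ ≤ 131 * (0 * n) + 19 * n + 7 * (n * (L + 4)) + 2 * n + 234 * (2 * L * n) +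
          2 * ((2 * L * (L + 6) + 2 * n) * (L + 39)) := by gcongr _ + 2 * ((2 * L * ?_ + 2 * n) * ?_)
      _ = 205 * n + 479 * (n * L) + 4 * L * ((L + 39) * (L + 6)) := by ring
      _ ≤ 205 * (n * L) + 479 * (n * L) + 4 * L * (1872 * n) := by gcongr
      _ ≤ 30000 * (n * L) := by nlinarith
  refine le_ofReal_of_le ((expected_le_total (M := M) timeTariff_covers).trans
    ((timeTariff_linear n).total_le hσ one_le)) ?_
  refine (Nat.cast_le.2 hbound).trans ?_
  push_cast
  have hn0 : (0 : ℝ) < n := by positivity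
  nlinarith [mul_le_mul_of_nonneg_left hlog hn0.le,
    mul_nonneg hn0.le ((Nat.cast_nonneg (Nat.clog 2 n) : (0 : ℝ) ≤ _).trans hlog)]

theorem expectedCoins_le (hσ : Doubling n k₀ σ) :
    (protocol n tree k₀).expectedCoins M ≤ ENNReal.ofReal (100000 * n) := by
  refine le_ofReal_of_le ((expected_le_total (M := M) coinTariff_covers).trans
    ((flatTariff_linear _ 1 0).total_le hσ one_le)) ?_
  norm_cast
  nlinarith [one_le (n := n)]

theorem expectedRounds_le_card (hσ : Doubling n k₀ σ) :
    (protocol n false k₀).expectedRounds M ≤ (20 + 4 * σ : ℕ) := by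
  refine ((expected_le_total (M := M) roundTariff_covers).trans
    ((flatTariff_linear _ 0 1).total_le hσ one_le)).trans ?_
  have : depth false n = 1 := rfl
  rw [this, Nat.cast_le]
  omega

theorem expectedRounds_le (hσ : Doubling n k₀ (Nat.clog 2 n + 38)) (hn : 2 ≤ n) :
    (protocol n false k₀).expectedRounds M ≤ ENNReal.ofReal (100000 * Real.log n) := by
  refine le_ofReal_of_le (expectedRounds_le_card M hσ) ?_
  have hL : 1 ≤ Nat.clog 2 n := Nat.clog_pos (by norm_num) hn
  have hL' : (1 : ℝ) ≤ Nat.clog 2 n := by exact_mod_cast hL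
  have hlog := clog_le_log hn
  push_cast
  linarith

end Bounds

end

end GHZ

theorem mainTheorem2 :
    ∃ C : ℝ, ∀ (n : ℕ) [NeZero n] (M : Fin n → GHZ.Measurement),
      -- parallel model: binomial tree, precision doubled from `1` on
      ((GHZ.protocol n true 1).Samples M (GHZ.prob M) ∧
        (GHZ.protocol n true 1).expectedBits M ≤ ENNReal.ofReal (C * (n : ℝ) ^ 2) ∧
        (2 ≤ n → (GHZ.protocol n true 1).expectedTime M ≤
          ENNReal.ofReal (C * ((n : ℝ) * Real.log n))) ∧
        (GHZ.protocol n true 1).expectedCoins M ≤ ENNReal.ofReal (C * n)) ∧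
      -- sequential model, precision doubled from `1` on
      ((GHZ.protocol n false 1).Samples M (GHZ.prob M) ∧
        (2 ≤ n → (GHZ.protocol n false 1).expectedRounds M ≤ ENNReal.ofReal (C * Real.log n)) ∧
        (GHZ.protocol n false 1).expectedBits M ≤ ENNReal.ofReal (C * (n : ℝ) ^ 2) ∧
        (GHZ.protocol n false 1).expectedCoins M ≤ ENNReal.ofReal (C * n)) ∧
      -- sequential model, precision doubled from `n` on
      ((GHZ.protocol n false n).Samples M (GHZ.prob M) ∧
        (GHZ.protocol n false n).expectedRounds M ≤ ENNReal.ofReal C ∧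
        (GHZ.protocol n false n).expectedBits M ≤ ENNReal.ofReal (C * (n : ℝ) ^ 2) ∧
        (GHZ.protocol n false n).expectedCoins M ≤ ENNReal.ofReal (C * n)) := by
  refine ⟨100000, fun n _ M => ?_⟩
  have h1 := GHZ.doubling_one (GHZ.one_le (n := n))
  have h2 := GHZ.doubling_self (GHZ.one_le (n := n))
  refine ⟨⟨GHZ.samples h1 M, GHZ.expectedBits_le M h1 le_rfl, GHZ.expectedTime_le M h1 le_rfl,
    GHZ.expectedCoins_le M h1⟩, ⟨GHZ.samples h1 M, GHZ.expectedRounds_le M h1,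
    GHZ.expectedBits_le M h1 le_rfl, GHZ.expectedCoins_le M h1⟩, ⟨GHZ.samples h2 M, ?_,
    GHZ.expectedBits_le M h2 (by omega), GHZ.expectedCoins_le M h2⟩⟩
  -- With σ = 38 the number of rounds is at most 20 + 4·38 = 172.
  exact GHZ.le_ofReal_of_le (GHZ.expectedRounds_le_card M h2) (by norm_num)
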